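/- A semiring is commutative with $0$ and $1$, and $\mathbb{N}=\{0,1,2,\dots\}$. Let $P$ be the set of partitions, and let $(m_\lambda)_{\lambda\in P}$ and $(s_\lambda)_{\lambda\in P}$ be the monomial symmetric functions and the Schur functions in the ring of symmetric functions over $\mathbb{Z}$ in infinitely many variables. Put $\Lambda_{\mathbb N}=\bigoplus_{\lambda\in P}\mathbb{N}\,m_\lambda$ and $\Lambda^{\mathrm{Sch}}=\bigoplus_{\lambda\in P}\mathbb{N}\,s_\lambda$; both are subsemirings of that ring. For a semiring $A$, let $$W(A)=\mathrm{Hom}_{\mathrm{semiring}}(\Lambda_{\mathbb N},A),\qquad W^{\mathrm{Sch}}(A)=\mathrm{Hom}_{\mathrm{semiring}}(\Lambda^{\mathrm{Sch}},A).$$ For $n\in\mathbb{N}$ let $A_n=\mathbb{N}/(n=n+1)$ be the quotient of $\mathbb{N}$ by the semiring congruence generated by $n\sim n+1$; in particular $A_1=\mathbf{B}$ is the Boolean semiring. Theorem. Let $n\ge 0$ be an integer. 1. $W(A_n)$ is countable if and only if $n\le 2$. 2. $W^{\mathrm{Sch}}(A_n)$ is countable if and only if $n\le 2$. Moreover: 3.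 If $n\ge 3$, then for every set $U$ of nonzero partitions there is a Witt vector $f_U\in W(A_n)$ with $f_U(m_0)=1$, $f_U(m_\lambda)=n-1$ for $\lambda\in U$, and $f_U(m_\lambda)=n$ for every nonzero partition $\lambda\notin U$; distinct sets $U$ give distinct $f_U$. The same holds for $W^{\mathrm{Sch}}(A_n)$ with $s_\lambda$ in place of $m_\lambda$. 4. For $n=2$, every fibre of the map $W(A_2)\to W(\mathbf{B})$ induced by the unique semiring homomorphism $A_2\to\mathbf{B}$ is finite. -/

import Mathlib

/-- The ring `Λ_ℤ` of symmetric functions with integer coefficients in the variables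
`x₀, x₁, x₂, …`: the formal power series of bounded degree that are invariant under all
permutations of the variables. -/
def SymmetricFunctions : Subring (MvPowerSeries ℕ ℤ) where
  carrier := {f | (∀ (σ : Equiv.Perm ℕ) (α : ℕ →₀ ℕ),
      MvPowerSeries.coeff (Finsupp.equivMapDomain σ α) f = MvPowerSeries.coeff α f) ∧
    ∃ d : ℕ, ∀ α : ℕ →₀ ℕ, MvPowerSeries.coeff α f ≠ 0 → α.degree ≤ d}
  zero_mem' := ⟨fun σ α => by simp, 0, fun α h => by simp at h⟩
  one_mem' := by
    classical
    refine ⟨fun σ α => ?_, 0, fun α h => ?_⟩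
    · have : Finsupp.equivMapDomain σ α = 0 ↔ α = 0 := by
        constructor
        · intro h
          ext i
          have := DFunLike.congr_fun h (σ i)
          simpa using this
        · rintro rfl
          simp
      simp [MvPowerSeries.coeff_one, this]
    · have h0 : α = 0 := by
        by_contra h0
        simp [MvPowerSeries.coeff_one, h0] at h
      simp [h0]
  add_mem' := by
    rintro f g ⟨hf, d, hd⟩ ⟨hg, e, he⟩
    refine ⟨fun σ α => by simp [hf σ α, hg σ α], max d e, fun α h => ?_⟩
    by_cases h1 : MvPowerSeries.coeff α f = 0
    · have h2 : MvPowerSeries.coeff α g ≠ 0 := fun h2 => h (by simp [h1, h2])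
      exact (he α h2).trans (le_max_right _ _)
    · exact (hd α h1).trans (le_max_left _ _)
  neg_mem' := by
    rintro f ⟨hf, d, hd⟩
    refine ⟨fun σ α => by simp [hf σ α], d, fun α h => hd α ?_⟩
    simpa using h
  mul_mem' := by
    classical
    rintro f g ⟨hf, d, hd⟩ ⟨hg, e, he⟩
    refine ⟨fun σ α => ?_, d + e, fun α h => ?_⟩
    · rw [MvPowerSeries.coeff_mul, MvPowerSeries.coeff_mul]
      symm
      refine Finset.sum_nbij'
        (fun p => (Finsupp.equivMapDomain σ p.1, Finsupp.equivMapDomain σ p.2))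
        (fun p => (Finsupp.equivMapDomain σ.symm p.1, Finsupp.equivMapDomain σ.symm p.2))
        ?_ ?_ ?_ ?_ ?_
      · intro p hp
        rw [Finset.HasAntidiagonal.mem_antidiagonal] at hp ⊢
        rw [← hp]
        ext i
        simp
      · intro p hp
        rw [Finset.HasAntidiagonal.mem_antidiagonal] at hp ⊢
        ext i
        have := DFunLike.congr_fun hp (σ i)
        simpa using this
      · intro p _
        ext i <;> simp
      · intro p _
        ext i <;> simp
      · intro p _
        simp [hf σ, hg σ]
    · rw [MvPowerSeries.coeff_mul] at h
      obtain ⟨p, hp, hne⟩ := Finset.exists_ne_zero_of_sum_ne_zero h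
      rw [Finset.HasAntidiagonal.mem_antidiagonal] at hp
      rw [← hp, map_add]
      exact add_le_add (hd _ (left_ne_zero_of_mul hne)) (he _ (right_ne_zero_of_mul hne))

open Classical in
/-- The monomial symmetric function `m_μ`, the sum of all the distinct monomials `x^α` whose
exponent sequence `α` is a permutation of the sequence `(μ₀, μ₁, μ₂, …)` of parts of `μ`
(extended by zeros).  Partitions are encoded as Young diagrams; the zero partition is `⊥`. -/
noncomputable def monomialSymmetric (μ : YoungDiagram) : MvPowerSeries ℕ ℤ :=
  fun α => if ∃ σ : Equiv.Perm ℕ, ∀ i, α (σ i) = μ.rowLen i then 1 else 0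

/-- The Schur function `s_μ`, the generating function of semistandard Young tableaux of shape `μ`:
the coefficient of `x^α` is the number of such tableaux in which each `i` occurs exactly `α i`
times. -/
noncomputable def schurFunction (μ : YoungDiagram) : MvPowerSeries ℕ ℤ :=
  fun α => (Nat.card {T : SemistandardYoungTableau μ //
    ∀ i, (μ.cells.filter fun c => T c.1 c.2 = i).card = α i} : ℤ)

theorem coeff_monomialSymmetric (μ : YoungDiagram) (α : ℕ →₀ ℕ) [Decidable
    (∃ σ : Equiv.Perm ℕ, ∀ i, α (σ i) = μ.rowLen i)] :
    MvPowerSeries.coeff α (monomialSymmetric μ) =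
      if ∃ σ : Equiv.Perm ℕ, ∀ i, α (σ i) = μ.rowLen i then 1 else 0 := by
  show monomialSymmetric μ α = _
  unfold monomialSymmetric
  congr

theorem finite_setOf_lt_rowLen (μ : YoungDiagram) (j : ℕ) : {i | j < μ.rowLen i}.Finite := by
  refine (Set.finite_lt_nat (μ.colLen j)).subset fun i hi => ?_
  exact YoungDiagram.mem_iff_lt_colLen.1 (YoungDiagram.mem_iff_lt_rowLen.2 hi)

/-- A partition is determined by its sequence of parts up to permutation. -/
theorem eq_of_rowLen_perm {μ ν : YoungDiagram} (σ : Equiv.Perm ℕ)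
    (h : ∀ i, μ.rowLen (σ i) = ν.rowLen i) : μ = ν := by
  have key : ∀ κ : YoungDiagram, ∀ j, κ.colLen j = {i | j < κ.rowLen i}.ncard := by
    intro κ j
    have : {i | j < κ.rowLen i} = ((Finset.range (κ.colLen j) : Finset ℕ) : Set ℕ) := by
      ext i
      simp [← YoungDiagram.mem_iff_lt_rowLen, YoungDiagram.mem_iff_lt_colLen]
    rw [this, Set.ncard_coe_finset, Finset.card_range]
  have hc : ∀ j, μ.colLen j = ν.colLen j := by
    intro j
    rw [key, key, ← Set.ncard_image_of_injective {i | j < ν.rowLen i} σ.injective]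
    congr 1
    ext i
    simp only [Set.mem_ofPred_eq, Set.mem_image]
    constructor
    · intro hi
      exact ⟨σ.symm i, by rw [← h]; simpa using hi, by simp⟩
    · rintro ⟨k, hk, rfl⟩
      rw [h]
      exact hk
  ext ⟨i, j⟩
  simp [YoungDiagram.mem_iff_lt_colLen, hc]

/-- Every finitely supported exponent sequence is a permutation of a partition. -/
theorem exists_perm_rowLen (α : ℕ →₀ ℕ) :
    ∃ (μ : YoungDiagram) (σ : Equiv.Perm ℕ), ∀ i, α (σ i) = μ.rowLen i := by
  classical
  obtain ⟨N, hN⟩ : ∃ N, ∀ i, N ≤ i → α i = 0 := by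
    refine ⟨α.support.sup id + 1, fun i hi => ?_⟩
    by_contra h
    have := Finset.le_sup (f := id) (Finsupp.mem_support_iff.2 h)
    simp only [id] at this
    omega
  let g : Fin N → ℕᵒᵈ := fun i => OrderDual.toDual (α i)
  let τ : Equiv.Perm (Fin N) := Tuple.sort g
  have hτ : Monotone (g ∘ τ) := Tuple.monotone_sort g
  have hτ' : ∀ a b : Fin N, a ≤ b → α (τ b) ≤ α (τ a) := fun a b hab => hτ hab
  let σ : Equiv.Perm ℕ := τ.extendDomain (Fin.equivSubtype (n := N))
  have hσ1 : ∀ i : Fin N, σ i = τ i := by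
    intro i
    have := Equiv.Perm.extendDomain_apply_image τ (Fin.equivSubtype (n := N)) i
    simpa [σ] using this
  have hσ2 : ∀ i, N ≤ i → σ i = i := by
    intro i hi
    exact Equiv.Perm.extendDomain_apply_not_subtype τ _ (by simpa using hi)
  have hanti : ∀ a b, a ≤ b → α (σ b) ≤ α (σ a) := by
    intro a b hab
    by_cases hb : b < N
    · have e1 := hσ1 ⟨b, hb⟩
      have e2 := hσ1 ⟨a, hab.trans_lt hb⟩
      simp only at e1 e2
      rw [e1, e2]
      exact hτ' _ _ hab
    · rw [hσ2 b (not_lt.1 hb), hN b (not_lt.1 hb)]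
      exact Nat.zero_le _
  let μ : YoungDiagram :=
    { cells := (Finset.range N ×ˢ Finset.range (α (σ 0))).filter fun c => c.2 < α (σ c.1)
      isLowerSet := by
        rintro ⟨i2, j2⟩ ⟨i1, j1⟩ ⟨hi : i1 ≤ i2, hj : j1 ≤ j2⟩ hc
        simp only [Finset.mem_coe, Finset.mem_filter, Finset.mem_product,
          Finset.mem_range] at hc ⊢
        have := hanti _ _ hi
        omega }
  have hmem : ∀ i j, (i, j) ∈ μ ↔ j < α (σ i) := by
    intro i j
    rw [← YoungDiagram.mem_cells]
    simp only [μ, Finset.mem_filter, Finset.mem_product, Finset.mem_range]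
    refine ⟨fun h => h.2, fun hj => ⟨⟨?_, hj.trans_le (hanti _ _ (Nat.zero_le _))⟩, hj⟩⟩
    by_contra hi
    rw [hσ2 i (not_lt.1 hi), hN i (not_lt.1 hi)] at hj
    omega
  refine ⟨μ, σ, fun i => ?_⟩
  refine eq_of_forall_lt_iff fun j => ?_
  rw [← hmem, YoungDiagram.mem_iff_lt_rowLen]

theorem card_le_degree {μ : YoungDiagram} {α : ℕ →₀ ℕ} {σ : Equiv.Perm ℕ}
    (h : ∀ i, α (σ i) = μ.rowLen i) : α.degree = μ.cells.card := by
  classical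
  have h1 : μ.cells.card = ∑ i ∈ α.support.image σ.symm, μ.rowLen i := by
    rw [Finset.card_eq_sum_card_fiberwise (f := Prod.fst) (t := α.support.image σ.symm)]
    · refine Finset.sum_congr rfl fun i _ => ?_
      rw [YoungDiagram.rowLen_eq_card]
      rfl
    · intro c hc
      have : c.2 < μ.rowLen c.1 := YoungDiagram.mem_iff_lt_rowLen.1 hc
      simp only [Finset.coe_image, Set.mem_image, Finset.mem_coe, Finsupp.mem_support_iff]
      exact ⟨σ c.1, by rw [h]; omega, by simp⟩
  rw [h1, Finset.sum_image (fun _ _ _ _ hab => σ.symm.injective hab), Finsupp.degree_apply]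
  refine Finset.sum_congr rfl fun i _ => ?_
  rw [← h]
  simp

theorem finite_card_le (d : ℕ) : {μ : YoungDiagram | μ.cells.card ≤ d}.Finite := by
  classical
  have hinj : Function.Injective YoungDiagram.cells := fun a b h => YoungDiagram.ext h
  refine Set.Finite.of_finite_image (f := YoungDiagram.cells) ?_ hinj.injOn
  refine ((Finset.range d ×ˢ Finset.range d).powerset.finite_toSet).subset ?_
  rintro _ ⟨μ, hμ, rfl⟩
  simp only [Finset.coe_powerset, Set.mem_preimage, Set.mem_powerset_iff]
  rintro ⟨i, j⟩ hc
  have hc' : (i, j) ∈ μ := hc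
  have h1 : j < μ.rowLen i := YoungDiagram.mem_iff_lt_rowLen.1 hc'
  have h2 : i < μ.colLen j := YoungDiagram.mem_iff_lt_colLen.1 hc'
  rw [YoungDiagram.rowLen_eq_card] at h1
  rw [YoungDiagram.colLen_eq_card] at h2
  have h3 : (μ.row i).card ≤ μ.cells.card := Finset.card_le_card (Finset.filter_subset _ _)
  have h4 : (μ.col j).card ≤ μ.cells.card := Finset.card_le_card (Finset.filter_subset _ _)
  have h5 : μ.cells.card ≤ d := hμ
  simp only [Finset.coe_product, Finset.coe_range, Set.mem_prod, Set.mem_Iio]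
  omega

/-- The `ℕ`-linear combinations of the `m_μ` are exactly the symmetric functions with nonnegative
coefficients. -/
theorem mem_span_monomialSymmetric (f : MvPowerSeries ℕ ℤ) :
    f ∈ Submodule.span ℕ (Set.range monomialSymmetric) ↔
      f ∈ SymmetricFunctions ∧ ∀ α, 0 ≤ MvPowerSeries.coeff α f := by
  classical
  constructor
  · intro hf
    induction hf using Submodule.span_induction with
    | mem x hx =>
      obtain ⟨μ, rfl⟩ := hx
      refine ⟨⟨fun σ α => ?_, μ.cells.card, fun α h => ?_⟩, fun α => ?_⟩
      · rw [coeff_monomialSymmetric, coeff_monomialSymmetric]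
        refine if_congr ⟨?_, ?_⟩ rfl rfl
        · rintro ⟨τ, hτ⟩
          exact ⟨τ.trans σ.symm, fun i => by simpa using hτ i⟩
        · rintro ⟨τ, hτ⟩
          exact ⟨τ.trans σ, fun i => by simpa using hτ i⟩
      · rw [coeff_monomialSymmetric] at h
        split_ifs at h with hτ
        · obtain ⟨τ, hτ⟩ := hτ
          exact (card_le_degree hτ).le
        · exact absurd rfl h
      · rw [coeff_monomialSymmetric]
        split_ifs <;> simp
    | zero => exact ⟨zero_mem _, fun α => by simp⟩
    | add x y _ _ hx hy =>
      exact ⟨add_mem hx.1 hy.1, fun α => by simpa using add_nonneg (hx.2 α) (hy.2 α)⟩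
    | smul a x _ hx =>
      refine ⟨nsmul_mem hx.1 a, fun α => ?_⟩
      rw [map_nsmul]
      exact nsmul_nonneg (hx.2 α) a
  · rintro ⟨⟨hs, d, hd⟩, hpos⟩
    let row : YoungDiagram → (ℕ →₀ ℕ) := fun μ =>
      Finsupp.ofSupportFinite μ.rowLen ((finite_setOf_lt_rowLen μ 0).subset fun i hi =>
        Nat.pos_of_ne_zero hi)
    have hrow : ∀ (μ : YoungDiagram) (α : ℕ →₀ ℕ) (σ : Equiv.Perm ℕ),
        (∀ i, α (σ i) = μ.rowLen i) →
        MvPowerSeries.coeff (row μ) f = MvPowerSeries.coeff α f := by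
      intro μ α σ h
      rw [← hs σ (row μ)]
      congr 2
      ext i
      have := h (σ.symm i)
      simp only [Equiv.apply_symm_apply] at this
      rw [this]
      rfl
    have hf : f = ∑ μ ∈ (finite_card_le d).toFinset,
        (MvPowerSeries.coeff (row μ) f).toNat • monomialSymmetric μ := by
      ext α
      obtain ⟨μ, σ, h⟩ := exists_perm_rowLen α
      rw [map_sum]
      have hother : ∀ ν, ν ≠ μ → MvPowerSeries.coeff α (monomialSymmetric ν) = 0 := by
        intro ν hν
        rw [coeff_monomialSymmetric, if_neg]
        rintro ⟨τ, hτ⟩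
        refine hν (eq_of_rowLen_perm (σ.trans τ.symm) fun i => ?_)
        rw [← hτ, ← h]
        simp
      have hself : MvPowerSeries.coeff α (monomialSymmetric μ) = 1 := by
        rw [coeff_monomialSymmetric, if_pos ⟨σ, h⟩]
      rw [Finset.sum_eq_single μ]
      · rw [map_nsmul, hself, hrow μ α σ h]
        simp [hpos α]
      · intro ν _ hν
        rw [map_nsmul, hother ν hν, smul_zero]
      · intro hμ
        rw [map_nsmul, hself, hrow μ α σ h]
        have : MvPowerSeries.coeff α f = 0 := by
          by_contra hne
          refine hμ ?_
          simp only [Set.Finite.mem_toFinset, Set.mem_ofPred_eq]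
          rw [← card_le_degree h]
          exact hd α hne
        simp [this]
    rw [hf]
    exact sum_mem fun μ _ =>
      nsmul_mem (Submodule.subset_span (Set.mem_range_self μ)) _

/-- The semiring `Λ_ℕ = ⨁ ℕ m_μ`. -/
def LambdaN : Subsemiring (MvPowerSeries ℕ ℤ) where
  carrier := Submodule.span ℕ (Set.range monomialSymmetric)
  zero_mem' := zero_mem _
  add_mem' := fun ha hb => add_mem ha hb
  one_mem' := by
    classical
    refine (mem_span_monomialSymmetric 1).2 ⟨one_mem _, fun α => ?_⟩
    rw [MvPowerSeries.coeff_one]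
    split_ifs <;> simp
  mul_mem' := by
    classical
    intro a b ha hb
    have ha' := (mem_span_monomialSymmetric a).1 ha
    have hb' := (mem_span_monomialSymmetric b).1 hb
    refine (mem_span_monomialSymmetric (a * b)).2 ⟨mul_mem ha'.1 hb'.1, fun α => ?_⟩
    rw [MvPowerSeries.coeff_mul]
    exact Finset.sum_nonneg fun p _ => mul_nonneg (ha'.2 _) (hb'.2 _)

/-- The semiring `Λ^Sch = ⨁ ℕ s_μ`: the semiring generated by the Schur functions.  (A product of
Schur functions is an `ℕ`-linear combination of Schur functions, by the Littlewood-Richardson rule;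
so this semiring is the `ℕ`-span of the Schur functions.) -/
noncomputable def LambdaSch : Subsemiring (MvPowerSeries ℕ ℤ) :=
  Subsemiring.closure (Set.range schurFunction)

/-- `m_μ` as an element of `Λ_ℕ`. -/
noncomputable def LambdaN.m (μ : YoungDiagram) : LambdaN :=
  ⟨monomialSymmetric μ, Submodule.subset_span (Set.mem_range_self μ)⟩

/-- `s_μ` as an element of `Λ^Sch`. -/
noncomputable def LambdaSch.s (μ : YoungDiagram) : LambdaSch :=
  ⟨schurFunction μ, Subsemiring.subset_closure (Set.mem_range_self μ)⟩

/-- The set `W(A)` of big Witt vectors with entries in the semiring `A`. -/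
abbrev BigWitt (A : Type*) [CommSemiring A] : Type _ := LambdaN →+* A

/-- The set `W^Sch(A)` of Schur Witt vectors with entries in the semiring `A`. -/
abbrev SchurWitt (A : Type*) [CommSemiring A] : Type _ := LambdaSch →+* A

/-- The congruence on the semiring `ℕ` generated by `n = n + 1`. -/
def truncCon (n : ℕ) : RingCon ℕ := ringConGen fun a b => a = n ∧ b = n + 1

/-- The semiring `ℕ/(n = n + 1)`.  For `n = 1` it is the Boolean semiring. -/
abbrev TruncNat (n : ℕ) : Type := (truncCon n).Quotient

theorem truncCon_add (n k : ℕ) : truncCon n n (n + k) := by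
  induction k with
  | zero => exact (truncCon n).refl n
  | succ k ih =>
    have h1 : truncCon n n (n + 1) := RingConGen.Rel.of _ _ ⟨rfl, rfl⟩
    have h2 := (truncCon n).add h1 ((truncCon n).refl k)
    have e : n + 1 + k = n + (k + 1) := by omega
    rw [e] at h2
    exact (truncCon n).trans ih h2

theorem truncCon_le {m n : ℕ} (h : m ≤ n) : truncCon n ≤ truncCon m := by
  refine RingCon.ringConGen_le.2 ?_
  rintro a b ⟨rfl, rfl⟩
  obtain ⟨k, rfl⟩ := Nat.exists_eq_add_of_le h
  exact (truncCon m).trans ((truncCon m).symm (truncCon_add m k)) (truncCon_add m (k + 1))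

/-- The canonical (and only) semiring homomorphism `ℕ/(n = n + 1) → ℕ/(m = m + 1)` for `m ≤ n`. -/
def truncMap {m n : ℕ} (h : m ≤ n) : TruncNat n →+* TruncNat m :=
  (truncCon n).lift (truncCon m).mk' (by rw [RingCon.ker_mk'_eq]; exact truncCon_le h)

/-- The map `W(A) → W(B)` induced by a semiring homomorphism `A → B`. -/
noncomputable def BigWitt.map {A B : Type*} [CommSemiring A] [CommSemiring B] (f : A →+* B)
    (a : BigWitt A) : BigWitt B := f.comp a

/-! ### Young diagrams -/

namespace YoungDiagram

/-! Both `Λ_ℕ` and `Λ^Sch` are free over `ℕ` on a basis indexed by partitions, the empty one being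
the unit, so a homomorphism to `A_n` is a table of values that must respect structure constants in
`ℕ`.

For `n ≥ 3` the values `n - 1` and `n` impose no condition: a product of two of them is `n`, and so
is any sum with two such summands. A product of two nontrivial basis elements always has at least
two nontrivial basis elements as summands, so every table with these values is multiplicative
(`PartitionBasis.exists_hom`), and the subsets of an infinite set embed in the Witt vectors.

For `1 ≤ n ≤ 2` consider the support, the set of partitions with nonzero value. Since `A_n` has no
zero divisors and no nontrivial zero sums, the support is closed under passing to smaller partitions
and under joins. One further product of near-rectangles shows that it is everything or a fat hook
`μ_a ≤ b` (`eq_univ_or_eq_hook`); that leaves countably many supports. For `n = 1` the support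
determines the homomorphism, and `A_0` is trivial.

For `n = 2` a value in the support is `1` or `2`, and it is `2` as soon as the square of the basis
element has two summands in the support, counted with multiplicity. For `m_μ` and a hook `(a, b)`
this leaves only the rectangles with `a` rows and more than `b` columns. There `f` is multiplicative
in the width, so finitely many widths determine it. For `s_μ` exceptions remain only if `a = 0` or
`b = 0`, and they are powers of a single column or row. Hence each support carries finitely many
homomorphisms; as `A_2 → 𝐁` reflects zero, this also bounds the fibres.

The monomial products are computed from exponent sequences. The Schur products need the
Littlewood-Richardson rule, which is obtained by cancelling alternants with Bender-Knuth
involutions, and the symmetry `s_μ ↦ s_μ'`, which follows from the two Pieri rules. -/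

theorem ext_rowLen {μ ν : YoungDiagram} (h : ∀ i, μ.rowLen i = ν.rowLen i) : μ = ν :=
  eq_of_rowLen_perm 1 h

theorem le_iff_rowLen {μ ν : YoungDiagram} : μ ≤ ν ↔ ∀ i, μ.rowLen i ≤ ν.rowLen i := by
  constructor
  · intro h i
    by_contra! hi
    have : (i, ν.rowLen i) ∈ ν := h (mem_iff_lt_rowLen.2 hi)
    exact lt_irrefl _ (mem_iff_lt_rowLen.1 this)
  · rintro h ⟨i, j⟩ hc
    exact mem_iff_lt_rowLen.2 ((mem_iff_lt_rowLen.1 hc).trans_le (h i))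

theorem rowLen_sup (μ ν : YoungDiagram) (i : ℕ) :
    (μ ⊔ ν).rowLen i = max (μ.rowLen i) (ν.rowLen i) := by
  refine eq_of_forall_lt_iff fun j => ?_
  rw [← mem_iff_lt_rowLen, mem_sup, mem_iff_lt_rowLen, mem_iff_lt_rowLen, lt_max_iff]

theorem rowLen_bot (i : ℕ) : (⊥ : YoungDiagram).rowLen i = 0 := by
  by_contra h
  exact notMem_bot (i, 0) (mem_iff_lt_rowLen.2 (Nat.pos_of_ne_zero h))

theorem rowLen_eq_zero_iff {μ : YoungDiagram} {i : ℕ} : μ.rowLen i = 0 ↔ μ.colLen 0 ≤ i := by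
  rw [← not_lt, ← mem_iff_lt_colLen, mem_iff_lt_rowLen]
  omega

theorem colLen_eq_zero_iff {μ : YoungDiagram} {j : ℕ} : μ.colLen j = 0 ↔ μ.rowLen 0 ≤ j := by
  rw [← not_lt, ← mem_iff_lt_rowLen, mem_iff_lt_colLen]
  omega

theorem eq_bot_iff_rowLen_zero {μ : YoungDiagram} : μ = ⊥ ↔ μ.rowLen 0 = 0 := by
  constructor
  · rintro rfl
    exact rowLen_bot 0
  · intro h
    refine ext_rowLen fun i => ?_
    rw [rowLen_bot]
    have := μ.rowLen_anti 0 i (Nat.zero_le _)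
    omega

theorem card_eq_sum_rowLen (μ : YoungDiagram) {N : ℕ} (hN : μ.colLen 0 ≤ N) :
    μ.cells.card = ∑ i ∈ Finset.range N, μ.rowLen i := by
  rw [Finset.card_eq_sum_card_fiberwise (f := Prod.fst) (t := Finset.range N)]
  · refine Finset.sum_congr rfl fun i _ => ?_
    rw [rowLen_eq_card]
    rfl
  · rintro ⟨i, j⟩ hc
    have h : i < μ.colLen j := mem_iff_lt_colLen.1 hc
    have := μ.colLen_anti 0 j (Nat.zero_le _)
    simp only [Finset.coe_range, Set.mem_Iio]
    omega

theorem card_transpose (μ : YoungDiagram) : μ.transpose.cells.card = μ.cells.card := by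
  simp [transpose]

theorem transpose_eq_bot_iff {μ : YoungDiagram} : μ.transpose = ⊥ ↔ μ = ⊥ := by
  rw [eq_bot_iff_rowLen_zero, eq_bot_iff_rowLen_zero, rowLen_transpose, colLen_eq_zero_iff]
  omega

/-- The rectangle with `p` rows and `q` columns. -/
def rect (p q : ℕ) : YoungDiagram where
  cells := Finset.range p ×ˢ Finset.range q
  isLowerSet := by
    rintro ⟨i2, j2⟩ ⟨i1, j1⟩ ⟨hi : i1 ≤ i2, hj : j1 ≤ j2⟩ hc
    simp only [Finset.mem_coe, Finset.mem_product, Finset.mem_range] at hc ⊢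
    omega

theorem mem_rect {p q : ℕ} {c : ℕ × ℕ} : c ∈ rect p q ↔ c.1 < p ∧ c.2 < q := by
  rw [← mem_cells]
  simp [rect]

theorem rowLen_rect (p q i : ℕ) : (rect p q).rowLen i = if i < p then q else 0 := by
  refine eq_of_forall_lt_iff fun j => ?_
  rw [← mem_iff_lt_rowLen, mem_rect]
  split_ifs <;> simp [*]

theorem transpose_rect (p q : ℕ) : (rect p q).transpose = rect q p := by
  ext c
  rw [mem_cells, mem_cells, mem_transpose, mem_rect, mem_rect, and_comm]
  rfl

theorem rect_succ_le_iff {a b : ℕ} {μ : YoungDiagram} :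
    rect (a + 1) (b + 1) ≤ μ ↔ b < μ.rowLen a := by
  rw [le_iff_rowLen]
  constructor
  · intro h
    have := h a
    rw [rowLen_rect, if_pos (Nat.lt_succ_self a)] at this
    omega
  · intro h i
    rw [rowLen_rect]
    split_ifs with hi
    · exact (Nat.succ_le_of_lt h).trans (μ.rowLen_anti i a (by omega))
    · exact Nat.zero_le _

theorem rect_zero_left (q : ℕ) : rect 0 q = ⊥ := by
  rw [eq_bot_iff_rowLen_zero, rowLen_rect, if_neg (lt_irrefl 0)]

theorem rect_zero_right (p : ℕ) : rect p 0 = ⊥ := by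
  rw [eq_bot_iff_rowLen_zero, rowLen_rect, ite_self]

open Classical in
/-- The Young diagram with row lengths `g 0 ≥ g 1 ≥ …`. -/
noncomputable def ofFun (g : ℕ → ℕ) : YoungDiagram :=
  if h : Antitone g ∧ ∃ N, g N = 0 then
    { cells := (Finset.range h.2.choose ×ˢ Finset.range (g 0)).filter fun c => c.2 < g c.1
      isLowerSet := by
        rintro ⟨i2, j2⟩ ⟨i1, j1⟩ ⟨hi : i1 ≤ i2, hj : j1 ≤ j2⟩ hc
        simp only [Finset.mem_coe, Finset.mem_filter, Finset.mem_product,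
          Finset.mem_range] at hc ⊢
        have := h.1 hi
        omega }
  else ⊥

theorem rowLen_ofFun {g : ℕ → ℕ} (hg : Antitone g) {N : ℕ} (hN : g N = 0) (i : ℕ) :
    (ofFun g).rowLen i = g i := by
  classical
  have h : Antitone g ∧ ∃ N, g N = 0 := ⟨hg, N, hN⟩
  refine eq_of_forall_lt_iff fun j => ?_
  rw [← mem_iff_lt_rowLen, ← mem_cells, ofFun, dif_pos h]
  simp only [Finset.mem_filter, Finset.mem_product, Finset.mem_range]
  refine ⟨fun h => h.2, fun hj => ⟨⟨?_, hj.trans_le (hg (Nat.zero_le _))⟩, hj⟩⟩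
  by_contra! hi
  have := hg hi
  have := h.2.choose_spec
  omega

/-- A directed lower set of Young diagrams whose complement behaves well under adding a row is
everything or a fat hook. -/
theorem eq_univ_or_eq_hook {S : Set YoungDiagram} (hbot : ⊥ ∈ S)
    (lower : ∀ μ κ, μ ≤ κ → κ ∈ S → μ ∈ S) (sup : ∀ μ ν, μ ∈ S → ν ∈ S → μ ⊔ ν ∈ S)
    (step : ∀ a b L, a < L → rect a (b + 1) ⊔ rect L b ∈ S → rect (a + 1) b ∈ S →
      rect (a + 1) (b + 1) ∉ S → rect (L + 1) b ∈ S) :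
    S = Set.univ ∨ ∃ a b, S = {μ | μ.rowLen a ≤ b} := by
  classical
  by_cases hall : ∀ p q, rect p q ∈ S
  · left
    refine Set.eq_univ_of_forall fun μ => lower μ (rect (μ.colLen 0) (μ.rowLen 0)) ?_ (hall _ _)
    rw [le_iff_rowLen]
    intro i
    rw [rowLen_rect]
    split_ifs with h
    · exact μ.rowLen_anti _ _ (Nat.zero_le _)
    · rw [rowLen_eq_zero_iff.2 (not_lt.1 h)]
  right
  push Not at hall
  -- The corner of the hook: `p = a + 1` is the least number of rows for which some rectangle is
  -- missing from `S`, and `q = b + 1` is the least width of a missing rectangle with `p` rows.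
  -- Neither is `0`, because an empty rectangle is `⊥`.
  obtain ⟨hp, hpmin⟩ := And.intro (Nat.find_spec hall) (fun m => Nat.find_min hall (m := m))
  set p := Nat.find hall
  obtain ⟨hq, hqmin⟩ := And.intro (Nat.find_spec hp) (fun m => Nat.find_min hp (m := m))
  set q := Nat.find hp
  clear_value q
  clear_value p
  obtain _ | a := p
  · rw [rect_zero_left] at hq
    exact absurd hbot hq
  obtain _ | b := q
  · rw [rect_zero_right] at hq
    exact absurd hbot hq
  have hK : ∀ K, rect a K ∈ S := fun K => by
    have := hpmin a (Nat.lt_succ_self a)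
    push Not at this
    exact this K
  have hY : rect (a + 1) b ∈ S := not_not.1 (hqmin b (Nat.lt_succ_self b))
  -- The leg of width `b` grows row by row. The joins of `rect a K` and `rect L b` then lie in `S`
  -- and are cofinal in the hook.
  have hL : ∀ L, a < L → rect L b ∈ S := by
    intro L hL
    induction L, hL using Nat.le_induction with
    | base => exact hY
    | succ L hL ih => exact step a b L hL (sup _ _ (hK _) ih) hY hq
  refine ⟨a, b, Set.ext fun μ => ⟨fun hμ => ?_, fun hμ => ?_⟩⟩
  · by_contra h
    exact hq (lower _ _ (rect_succ_le_iff.2 (not_le.1 h)) hμ)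
  · refine lower _ (rect a (μ.rowLen 0) ⊔ rect (max (a + 1) (μ.colLen 0)) b) ?_
      (sup _ _ (hK _) (hL _ (by omega)))
    rw [le_iff_rowLen]
    intro i
    rw [rowLen_sup, rowLen_rect, rowLen_rect]
    by_cases hi : i < a
    · rw [if_pos hi]
      exact (μ.rowLen_anti _ _ (Nat.zero_le _)).trans (le_max_left _ _)
    · by_cases hi' : i < μ.colLen 0
      · rw [if_pos (lt_max_of_lt_right hi')]
        exact ((μ.rowLen_anti a i (not_lt.1 hi)).trans hμ).trans (le_max_right _ _)
      · rw [rowLen_eq_zero_iff.2 (not_lt.1 hi')]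
        exact Nat.zero_le _

theorem infinite_ne_bot : Infinite {μ : YoungDiagram // μ ≠ ⊥} := by
  refine Infinite.of_injective (fun k : ℕ => (⟨rect 1 (k + 1), ?_⟩ : {μ : YoungDiagram // μ ≠ ⊥}))
    ?_
  · rw [Ne, eq_bot_iff_rowLen_zero, rowLen_rect]
    simp
  · intro k l h
    have := congrArg (fun μ : {μ : YoungDiagram // μ ≠ ⊥} => μ.1.rowLen 0) h
    simpa [rowLen_rect] using this

end YoungDiagram

/-! ### The semirings `ℕ/(n = n + 1)` -/

namespace TruncNat

theorem exists_natCast {n : ℕ} (x : TruncNat n) : ∃ k : ℕ, x = k := by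
  obtain ⟨k, rfl⟩ := (truncCon n).mk'_surjective x
  exact ⟨k, rfl⟩

/-- Equality after truncation at `n` is itself a congruence, since a positive multiple of a number
at least `n` is at least `n`. It contains the generating pair, and conversely `n` is congruent to
every larger number. -/
theorem natCast_eq_iff {n a b : ℕ} : (a : TruncNat n) = b ↔ min a n = min b n := by
  constructor
  · intro h
    let c : RingCon ℕ :=
      { r := fun a b => min a n = min b n
        iseqv := ⟨fun _ => rfl, fun h => h.symm, fun h h' => h.trans h'⟩
        add' := by
          intro w x y z h h'
          show min _ _ = min _ _
          omega
        mul' := by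
          intro w x y z h h'
          show min (w * y) n = min (x * z) n
          have key : ∀ w x y : ℕ, min w n = min x n → min (w * y) n = min (x * y) n := by
            intro w x y h
            rcases eq_or_ne w x with rfl | hne
            · rfl
            have hw : n ≤ w := by omega
            have hx : n ≤ x := by omega
            rcases Nat.eq_zero_or_pos y with rfl | hy
            · simp
            rw [min_eq_right (hw.trans (Nat.le_mul_of_pos_right _ hy)),
              min_eq_right (hx.trans (Nat.le_mul_of_pos_right _ hy))]
          rw [key w x y h, mul_comm, key y z x h', mul_comm] }
    have hc : truncCon n ≤ c := by
      refine RingCon.ringConGen_le.2 ?_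
      rintro a b ⟨rfl, rfl⟩
      show min _ _ = min _ _
      omega
    exact hc ((RingCon.eq (truncCon n)).1 h)
  · intro h
    rcases eq_or_ne a b with rfl | hne
    · rfl
    obtain ⟨k, rfl⟩ := Nat.exists_eq_add_of_le (show n ≤ a by omega)
    obtain ⟨l, rfl⟩ := Nat.exists_eq_add_of_le (show n ≤ b by omega)
    exact (RingCon.eq (truncCon n)).2
      ((truncCon n).trans ((truncCon n).symm (truncCon_add n k)) (truncCon_add n l))

instance (n : ℕ) : Finite (TruncNat n) := by
  refine Finite.of_surjective (fun i : Fin (n + 1) => ((i : ℕ) : TruncNat n)) fun x => ?_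
  obtain ⟨k, rfl⟩ := exists_natCast x
  refine ⟨⟨min k n, by omega⟩, natCast_eq_iff.2 ?_⟩
  simp

theorem natCast_eq_zero_iff {n k : ℕ} (hn : 1 ≤ n) : (k : TruncNat n) = 0 ↔ k = 0 := by
  rw [← Nat.cast_zero, natCast_eq_iff]
  omega

theorem one_ne_zero {n : ℕ} (hn : 1 ≤ n) : (1 : TruncNat n) ≠ 0 := by
  rw [← Nat.cast_one, Ne, natCast_eq_zero_iff hn]
  omega

theorem add_ne_zero {n : ℕ} (hn : 1 ≤ n) {x y : TruncNat n} (hx : x ≠ 0) : x + y ≠ 0 := by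
  obtain ⟨a, rfl⟩ := exists_natCast x
  obtain ⟨b, rfl⟩ := exists_natCast y
  rw [Ne, natCast_eq_zero_iff hn] at hx
  rw [← Nat.cast_add, Ne, natCast_eq_zero_iff hn]
  omega

theorem mul_ne_zero {n : ℕ} (hn : 1 ≤ n) {x y : TruncNat n} (hx : x ≠ 0) (hy : y ≠ 0) :
    x * y ≠ 0 := by
  obtain ⟨a, rfl⟩ := exists_natCast x
  obtain ⟨b, rfl⟩ := exists_natCast y
  rw [Ne, natCast_eq_zero_iff hn] at hx hy
  rw [← Nat.cast_mul, Ne, natCast_eq_zero_iff hn]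
  exact Nat.mul_ne_zero hx hy

theorem add_add_eq {n : ℕ} {x y z : TruncNat n} (hn : 2 ≤ n)
    (hx : x = (n - 1 : ℕ) ∨ x = n) (hy : y = (n - 1 : ℕ) ∨ y = n) : x + y + z = n := by
  obtain ⟨c, rfl⟩ := exists_natCast z
  rcases hx with rfl | rfl <;> rcases hy with rfl | rfl <;>
  · norm_cast
    rw [natCast_eq_iff]
    omega

/-- Here `n ≥ 3` is essential: `(n - 1)² ≥ 2 (n - 1) ≥ n`. For `n = 2` the value `n - 1 = 1` is
idempotent. -/
theorem mul_eq {n : ℕ} {x y : TruncNat n} (hn : 3 ≤ n)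
    (hx : x = (n - 1 : ℕ) ∨ x = n) (hy : y = (n - 1 : ℕ) ∨ y = n) : x * y = n := by
  have key : ∀ a b : ℕ, n - 1 ≤ a → n - 1 ≤ b → n ≤ a * b := by
    intro a b ha hb
    have := Nat.mul_le_mul ha (show 2 ≤ b by omega)
    omega
  rcases hx with rfl | rfl <;> rcases hy with rfl | rfl <;>
  · norm_cast
    rw [natCast_eq_iff, min_eq_right (key _ _ (by omega) (by omega)), min_self]

theorem natCast_pred_ne {n : ℕ} (hn : 1 ≤ n) : ((n - 1 : ℕ) : TruncNat n) ≠ n := by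
  rw [Ne, natCast_eq_iff]
  omega

theorem eq_zero_or_eq_one (x : TruncNat 1) : x = 0 ∨ x = 1 := by
  obtain ⟨a, rfl⟩ := exists_natCast x
  rw [natCast_eq_zero_iff le_rfl, show (1 : TruncNat 1) = ((1 : ℕ) : TruncNat 1) from rfl,
    natCast_eq_iff]
  omega

/-- In `A_2` the elements `0` and `1` are idempotent, whereas a sum with two nonzero summands is
`2`. -/
theorem eq_two_of_mul_self {x y z w : TruncNat 2} (h : x * x = y + z + w) (hy : y ≠ 0)
    (hz : z ≠ 0) : x = 2 := by
  obtain ⟨a, rfl⟩ := exists_natCast x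
  obtain ⟨b, rfl⟩ := exists_natCast y
  obtain ⟨c, rfl⟩ := exists_natCast z
  obtain ⟨d, rfl⟩ := exists_natCast w
  rw [Ne, natCast_eq_zero_iff one_le_two] at hy hz
  rw [show (2 : TruncNat 2) = ((2 : ℕ) : TruncNat 2) from rfl, natCast_eq_iff]
  norm_cast at h
  rw [natCast_eq_iff] at h
  have : a ≠ 0 ∧ a ≠ 1 := ⟨by rintro rfl; omega, by rintro rfl; omega⟩
  omega

theorem truncMap_eq_zero_iff (x : TruncNat 2) : truncMap one_le_two x = 0 ↔ x = 0 := by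
  obtain ⟨a, rfl⟩ := exists_natCast x
  rw [map_natCast, natCast_eq_zero_iff le_rfl, natCast_eq_zero_iff one_le_two]

theorem subsingleton_zero : Subsingleton (TruncNat 0) := by
  refine ⟨fun x y => ?_⟩
  obtain ⟨a, rfl⟩ := exists_natCast x
  obtain ⟨b, rfl⟩ := exists_natCast y
  rw [natCast_eq_iff]
  omega

end TruncNat

/-! ### Semirings with a basis indexed by partitions -/

namespace PartitionBasis

open YoungDiagram

variable {R : Type*} [CommSemiring R]

theorem hom_ext (B : Module.Basis YoungDiagram ℕ R) {A : Type*} [CommSemiring A] {f g : R →+* A}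
    (h : ∀ μ, f (B μ) = g (B μ)) : f = g := by
  have : (f : R →+ A).toNatLinearMap = (g : R →+ A).toNatLinearMap := B.ext h
  ext x
  exact DFunLike.congr_fun this x

theorem exists_repr_ne_zero (B : Module.Basis YoungDiagram ℕ R) {A : Type*} [CommSemiring A]
    {f : R →+* A} {x : R} (h : f x ≠ 0) : ∃ κ, B.repr x κ ≠ 0 ∧ f (B κ) ≠ 0 := by
  rw [← B.linearCombination_repr x, Finsupp.linearCombination_apply, Finsupp.sum, map_sum] at h
  obtain ⟨κ, hκ, hne⟩ := Finset.exists_ne_zero_of_sum_ne_zero h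
  refine ⟨κ, Finsupp.mem_support_iff.1 hκ, fun h0 => hne ?_⟩
  rw [map_nsmul, h0, smul_zero]

/-- Coordinates lie in `ℕ`, where `p ≤ q` means `q = p + r`. Splitting off a dominated part replaces
subtraction, which `R` does not have. -/
theorem eq_add_of_single_le (B : Module.Basis YoungDiagram ℕ R) {x : R} {p : YoungDiagram →₀ ℕ}
    (h : p ≤ B.repr x) : ∃ r, x = B.repr.symm p + r := by
  obtain ⟨q, hq⟩ := exists_add_of_le h
  refine ⟨B.repr.symm q, ?_⟩
  rw [← map_add, ← hq, LinearEquiv.symm_apply_apply]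

theorem eq_add_of_repr_ne_zero (B : Module.Basis YoungDiagram ℕ R) {x : R} {κ : YoungDiagram}
    (h : B.repr x κ ≠ 0) : ∃ r, x = B κ + r := by
  classical
  obtain ⟨r, hr⟩ := eq_add_of_single_le B (x := x) (p := Finsupp.single κ 1)
    (Finsupp.single_le_iff.2 (Nat.one_le_iff_ne_zero.2 h))
  exact ⟨r, by rwa [B.repr_symm_single_one] at hr⟩

theorem eq_add_add_of_repr_ne_zero (B : Module.Basis YoungDiagram ℕ R) {x : R}
    {κ κ' : YoungDiagram} (hne : κ ≠ κ') (h : B.repr x κ ≠ 0) (h' : B.repr x κ' ≠ 0) :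
    ∃ r, x = B κ + B κ' + r := by
  classical
  obtain ⟨r, hr⟩ := eq_add_of_single_le B (x := x)
    (p := Finsupp.single κ 1 + Finsupp.single κ' 1) (by
      intro ν
      rw [Finsupp.add_apply, Finsupp.single_apply, Finsupp.single_apply]
      split_ifs with h1 h2 h2
      · exact absurd (h1.trans h2.symm) hne
      · subst h1; omega
      · subst h2; omega
      · omega)
  exact ⟨r, by rwa [map_add, B.repr_symm_single_one, B.repr_symm_single_one] at hr⟩

theorem eq_add_self_add_of_two_le_repr (B : Module.Basis YoungDiagram ℕ R) {x : R}
    {κ : YoungDiagram} (h : 2 ≤ B.repr x κ) : ∃ r, x = B κ + B κ + r := by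
  classical
  obtain ⟨r, hr⟩ := eq_add_of_single_le B (x := x) (p := Finsupp.single κ 2)
    (Finsupp.single_le_iff.2 h)
  refine ⟨r, ?_⟩
  rwa [B.repr_symm_single, two_smul] at hr

/-- The support of a homomorphism on the basis is everything or a fat hook. -/
theorem support_eq_univ_or_eq_hook (B : Module.Basis YoungDiagram ℕ R) (hone : B ⊥ = 1)
    (hlower : ∀ μ κ, μ ≤ κ → ∃ x, B.repr (B μ * x) κ ≠ 0)
    (hle : ∀ μ ν κ, B.repr (B μ * B ν) κ ≠ 0 → μ ≤ κ)
    (hstep : ∀ a b L κ, a < L →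
      B.repr (B (rect a (b + 1) ⊔ rect L b) * B (rect (a + 1) b)) κ ≠ 0 →
      κ.rowLen a ≤ b → rect (L + 1) b ≤ κ)
    {n : ℕ} (hn : 1 ≤ n) (f : R →+* TruncNat n) :
    {μ | f (B μ) ≠ 0} = Set.univ ∨ ∃ a b, {μ | f (B μ) ≠ 0} = {μ | μ.rowLen a ≤ b} := by
  -- If `f (B μ) = 0`, then `f` vanishes on the whole ideal of `B μ`, hence on each basis element
  -- that occurs there, as sums with a nonzero summand do not vanish.
  have lower : ∀ μ κ, μ ≤ κ → f (B κ) ≠ 0 → f (B μ) ≠ 0 := by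
    intro μ κ h hκ h0
    obtain ⟨x, hx⟩ := hlower μ κ h
    obtain ⟨r, hr⟩ := eq_add_of_repr_ne_zero B hx
    refine TruncNat.add_ne_zero hn (y := f r) hκ ?_
    rw [← map_add, ← hr, map_mul, h0, zero_mul]
  have prod : ∀ μ ν, f (B μ) ≠ 0 → f (B ν) ≠ 0 →
      ∃ κ, B.repr (B μ * B ν) κ ≠ 0 ∧ f (B κ) ≠ 0 := fun μ ν hμ hν =>
    exists_repr_ne_zero B (by rw [map_mul]; exact TruncNat.mul_ne_zero hn hμ hν)
  refine eq_univ_or_eq_hook ?_ lower ?_ ?_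
  · rw [Set.mem_ofPred_eq, hone, map_one]
    exact TruncNat.one_ne_zero hn
  -- The product is nonzero under `f`, so some component of it is in the support, and each component
  -- contains both factors.
  · intro μ ν hμ hν
    obtain ⟨κ, hκ, hne⟩ := prod μ ν hμ hν
    exact lower _ κ (sup_le (hle _ _ _ hκ) (hle ν μ κ (by rwa [mul_comm]))) hne
  -- A component in the support cannot contain the missing rectangle, so it satisfies `κ.rowLen a ≤
  -- b` and `hstep` applies.
  · intro a b L hL hX hY hR
    obtain ⟨κ, hκ, hne⟩ := prod _ _ hX hY
    refine lower _ κ (hstep a b L κ hL hκ ?_) hne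
    by_contra! hlt
    exact hR (lower _ κ (rect_succ_le_iff.2 hlt) hne)

/-- The case `κ = κ'` is included; it is that of one basis element with coefficient at least `2`. -/
theorem apply_eq_two (B : Module.Basis YoungDiagram ℕ R) (f : R →+* TruncNat 2)
    {μ κ κ' : YoungDiagram} (h : ∃ r, B μ * B μ = B κ + B κ' + r) (hκ : f (B κ) ≠ 0)
    (hκ' : f (B κ') ≠ 0) : f (B μ) = 2 := by
  obtain ⟨r, hr⟩ := h
  refine TruncNat.eq_two_of_mul_self (y := f (B κ)) (z := f (B κ')) (w := f r) ?_ hκ hκ'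
  rw [← map_mul, hr, map_add, map_add]

/-- Values in `{n - 1, n}` on the nontrivial basis elements can be prescribed arbitrarily. -/
theorem exists_hom (B : Module.Basis YoungDiagram ℕ R) (hone : B ⊥ = 1)
    (hmul : ∀ μ ν, μ ≠ ⊥ → ν ≠ ⊥ →
      ∃ κ κ' r, κ ≠ ⊥ ∧ κ' ≠ ⊥ ∧ B μ * B ν = B κ + B κ' + r)
    {n : ℕ} (hn : 3 ≤ n) (u : YoungDiagram → TruncNat n) (hbot : u ⊥ = 1)
    (hu : ∀ μ, μ ≠ ⊥ → u μ = (n - 1 : ℕ) ∨ u μ = n) :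
    ∃ f : R →+* TruncNat n, ∀ μ, f (B μ) = u μ := by
  let φ : R →ₗ[ℕ] TruncNat n := B.constr ℕ u
  have hφ : ∀ μ, φ (B μ) = u μ := fun μ => B.constr_basis ℕ u μ
  -- Away from `⊥` both sides equal `n`: the left one has two summands from `{n - 1, n}`, the right
  -- one is a product of two such elements.
  have h1 : ∀ μ ν, φ (B μ * B ν) = φ (B μ) * φ (B ν) := by
    intro μ ν
    by_cases hμ : μ = ⊥
    · rw [hμ, hφ, hbot, hone, one_mul, one_mul]
    by_cases hν : ν = ⊥
    · rw [hν, hφ ⊥, hbot, hone, mul_one, mul_one]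
    obtain ⟨κ, κ', r, hκ, hκ', h⟩ := hmul μ ν hμ hν
    rw [h, map_add, map_add, hφ, hφ, hφ, hφ, TruncNat.mul_eq hn (hu _ hμ) (hu _ hν),
      TruncNat.add_add_eq (by omega) (hu _ hκ) (hu _ hκ')]
  have h2 : (LinearMap.mul ℕ R).compr₂ φ = (LinearMap.mul ℕ (TruncNat n)).compl₁₂ φ φ :=
    B.ext fun μ => B.ext fun ν => by simpa using h1 μ ν
  exact ⟨{ toFun := φ
           map_zero' := map_zero φ
           map_add' := map_add φ
           map_one' := by rw [← hone, hφ, hbot]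
           map_mul' := fun x y => LinearMap.congr_fun₂ h2 x y }, hφ⟩

theorem exists_injective_family (B : Module.Basis YoungDiagram ℕ R) (hone : B ⊥ = 1)
    (hmul : ∀ μ ν, μ ≠ ⊥ → ν ≠ ⊥ →
      ∃ κ κ' r, κ ≠ ⊥ ∧ κ' ≠ ⊥ ∧ B μ * B ν = B κ + B κ' + r)
    {n : ℕ} (hn : 3 ≤ n) :
    ∃ F : Set {μ : YoungDiagram // μ ≠ ⊥} → (R →+* TruncNat n), Function.Injective F ∧
      ∀ U, F U (B ⊥) = 1 ∧ (∀ μ ∈ U, F U (B μ.1) = ((n - 1 : ℕ) : TruncNat n)) ∧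
        (∀ μ ∉ U, F U (B μ.1) = (n : TruncNat n)) := by
  classical
  let u : Set {μ : YoungDiagram // μ ≠ ⊥} → YoungDiagram → TruncNat n := fun U μ =>
    if h : μ = ⊥ then 1 else if (⟨μ, h⟩ : {μ : YoungDiagram // μ ≠ ⊥}) ∈ U then (n - 1 : ℕ) else n
  have h : ∀ U, ∃ f : R →+* TruncNat n, ∀ μ, f (B μ) = u U μ := by
    refine fun U => exists_hom B hone hmul hn (u U) (dif_pos rfl) fun μ hμ => ?_
    simp only [u, dif_neg hμ]
    split_ifs
    · exact Or.inl rfl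
    · exact Or.inr rfl
  choose F hF using h
  have hin : ∀ U, ∀ μ ∈ U, F U (B μ.1) = ((n - 1 : ℕ) : TruncNat n) := fun U μ hμ => by
    rw [hF]
    simp only [u, dif_neg μ.2, if_pos hμ]
  have hout : ∀ U, ∀ μ ∉ U, F U (B μ.1) = (n : TruncNat n) := fun U μ hμ => by
    rw [hF]
    simp only [u, dif_neg μ.2, if_neg hμ]
  refine ⟨F, fun U V hUV => ?_, fun U => ⟨by rw [hF]; exact dif_pos rfl, hin U, hout U⟩⟩
  ext μ
  have hne := TruncNat.natCast_pred_ne (n := n) (by omega)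
  constructor
  · intro hμ
    by_contra hμ'
    exact hne (by rw [← hin U μ hμ, ← hout V μ hμ', hUV])
  · intro hμ
    by_contra hμ'
    exact hne (by rw [← hin V μ hμ, ← hout U μ hμ', hUV])

/-- Cantor's argument: an enumeration of the subsets of the infinite set of nonzero partitions,
followed by an embedding of `ℕ` in that set, would inject the power set into the set. -/
theorem countable_iff_le_two {W : ℕ → Type*}
    (hbig : ∀ n, 3 ≤ n → ∃ F : Set {μ : YoungDiagram // μ ≠ ⊥} → W n, Function.Injective F)
    (h0 : Countable (W 0)) (h1 : Countable (W 1)) (h2 : Countable (W 2)) (n : ℕ) :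
    Countable (W n) ↔ n ≤ 2 := by
  constructor
  · intro h
    by_contra! hn
    obtain ⟨F, hF⟩ := hbig n hn
    have hc : Countable (Set {μ : YoungDiagram // μ ≠ ⊥}) := hF.countable
    have := infinite_ne_bot
    obtain ⟨g, hg⟩ := exists_injective_nat (Set {μ : YoungDiagram // μ ≠ ⊥})
    refine Function.cantor_injective
      (fun U => (Infinite.natEmbedding {μ : YoungDiagram // μ ≠ ⊥}) (g U)) ?_
    exact (Infinite.natEmbedding _).injective.comp hg
  · intro h
    interval_cases n
    exacts [h0, h1, h2]

/-- Countably many homomorphisms have a fat hook as support, if each hook supports only countably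
many. -/
theorem countable_hom (B : Module.Basis YoungDiagram ℕ R) {n : ℕ}
    (hS : ∀ f : R →+* TruncNat n,
      {μ | f (B μ) ≠ 0} = Set.univ ∨ ∃ a b, {μ | f (B μ) ≠ 0} = {μ | μ.rowLen a ≤ b})
    (hc : ∀ S : Set YoungDiagram, {f : R →+* TruncNat n | {μ | f (B μ) ≠ 0} = S}.Countable) :
    Countable (R →+* TruncNat n) := by
  rw [← Set.countable_univ_iff]
  refine ((hc Set.univ).union (Set.countable_iUnion fun a : ℕ => Set.countable_iUnion fun b : ℕ =>
    hc {μ | μ.rowLen a ≤ b})).mono fun f _ => ?_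
  rcases hS f with h | ⟨a, b, h⟩
  · exact Or.inl h
  · exact Or.inr (Set.mem_iUnion.2 ⟨a, Set.mem_iUnion.2 ⟨b, h⟩⟩)

theorem hom_one_ext (B : Module.Basis YoungDiagram ℕ R) {f g : R →+* TruncNat 1}
    (h : {μ | f (B μ) ≠ 0} = {μ | g (B μ) ≠ 0}) : f = g := by
  refine hom_ext B fun μ => ?_
  have hμ : f (B μ) ≠ 0 ↔ g (B μ) ≠ 0 := Set.ext_iff.1 h μ
  rcases TruncNat.eq_zero_or_eq_one (f (B μ)) with hf | hf <;>
  rcases TruncNat.eq_zero_or_eq_one (g (B μ)) with hg | hg <;>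
  simp_all [TruncNat.one_ne_zero le_rfl]

theorem countable_hom_one (B : Module.Basis YoungDiagram ℕ R)
    (hS : ∀ f : R →+* TruncNat 1,
      {μ | f (B μ) ≠ 0} = Set.univ ∨ ∃ a b, {μ | f (B μ) ≠ 0} = {μ | μ.rowLen a ≤ b}) :
    Countable (R →+* TruncNat 1) :=
  countable_hom B hS fun _ => Set.Subsingleton.countable fun _ hf _ hg =>
    hom_one_ext B (hf.trans hg.symm)

theorem countable_hom_zero : Countable (R →+* TruncNat 0) := by
  have := TruncNat.subsingleton_zero
  have : Subsingleton (R →+* TruncNat 0) := ⟨fun f g => RingHom.ext fun x => Subsingleton.elim _ _⟩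
  infer_instance

end PartitionBasis

/-! ### Monomial symmetric functions -/

open YoungDiagram

/-- The exponent sequence `(μ₀, μ₁, …)` of a partition. -/
noncomputable def YoungDiagram.rowFinsupp (μ : YoungDiagram) : ℕ →₀ ℕ :=
  Finsupp.ofSupportFinite μ.rowLen ((finite_setOf_lt_rowLen μ 0).subset fun _ hi =>
    Nat.pos_of_ne_zero hi)

theorem YoungDiagram.rowFinsupp_apply (μ : YoungDiagram) (i : ℕ) : μ.rowFinsupp i = μ.rowLen i :=
  rfl

/-- The exponent sequence `α` is a rearrangement of the parts of `μ`. -/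
def IsRearrangement (α : ℕ →₀ ℕ) (μ : YoungDiagram) : Prop :=
  ∃ σ : Equiv.Perm ℕ, ∀ i, α (σ i) = μ.rowLen i

theorem isRearrangement_rowFinsupp (μ : YoungDiagram) : IsRearrangement μ.rowFinsupp μ :=
  ⟨1, fun _ => rfl⟩

theorem IsRearrangement.equivMapDomain {α : ℕ →₀ ℕ} {μ : YoungDiagram} (h : IsRearrangement α μ)
    (σ : Equiv.Perm ℕ) : IsRearrangement (Finsupp.equivMapDomain σ α) μ := by
  obtain ⟨τ, hτ⟩ := h
  exact ⟨τ.trans σ, fun i => by simpa using hτ i⟩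

theorem isRearrangement_rowFinsupp_iff {μ κ : YoungDiagram} :
    IsRearrangement κ.rowFinsupp μ ↔ κ = μ := by
  constructor
  · rintro ⟨σ, h⟩
    exact eq_of_rowLen_perm σ h
  · rintro rfl
    exact isRearrangement_rowFinsupp κ

/-- The inequality says that at most `a` parts exceed `b`, a condition that does not depend on the
order of the parts. It allows membership in a hook to be tested on an unsorted sum of exponent
sequences. -/
theorem IsRearrangement.rowLen_le_iff {γ : ℕ →₀ ℕ} {κ : YoungDiagram} (h : IsRearrangement γ κ)
    {a b : ℕ} : κ.rowLen a ≤ b ↔ ∃ s : Finset ℕ, s.card ≤ a ∧ ∀ i, i ∉ s → γ i ≤ b := by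
  classical
  obtain ⟨σ, hσ⟩ := h
  constructor
  · intro hb
    refine ⟨(Finset.range a).image σ, Finset.card_image_le.trans (by simp), fun i hi => ?_⟩
    have hi' : a ≤ σ.symm i := by
      by_contra! hlt
      exact hi (Finset.mem_image.2 ⟨σ.symm i, Finset.mem_range.2 hlt, by simp⟩)
    have := hσ (σ.symm i)
    rw [Equiv.apply_symm_apply] at this
    rw [this]
    exact (κ.rowLen_anti _ _ hi').trans hb
  · rintro ⟨s, hs, hle⟩
    by_contra! hb
    have : ((Finset.range (a + 1)).image σ).card ≤ s.card := by
      refine Finset.card_le_card fun x hx => ?_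
      obtain ⟨i, hi, rfl⟩ := Finset.mem_image.1 hx
      by_contra hxs
      have h1 := hle _ hxs
      rw [hσ] at h1
      have h2 := κ.rowLen_anti i a (by rw [Finset.mem_range] at hi; omega)
      omega
    rw [Finset.card_image_of_injective _ σ.injective, Finset.card_range] at this
    omega

namespace LambdaN

open Classical in
theorem coeff_m (μ : YoungDiagram) (α : ℕ →₀ ℕ) :
    MvPowerSeries.coeff α (m μ : MvPowerSeries ℕ ℤ) = if IsRearrangement α μ then 1 else 0 :=
  coeff_monomialSymmetric μ α

open Classical in
theorem coeff_rowFinsupp_m (μ κ : YoungDiagram) :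
    MvPowerSeries.coeff κ.rowFinsupp (m μ : MvPowerSeries ℕ ℤ) = if κ = μ then 1 else 0 := by
  rw [coeff_m]
  exact if_congr isRearrangement_rowFinsupp_iff rfl rfl

/-- The exponent sequence of `κ` occurs in `m κ` alone, with coefficient `1`, so coordinates can be
read off. This gives linear independence and the formula for `repr`. -/
theorem coeff_linearCombination_m (c : YoungDiagram →₀ ℕ) (κ : YoungDiagram) :
    MvPowerSeries.coeff κ.rowFinsupp
      (Finsupp.linearCombination ℕ m c : MvPowerSeries ℕ ℤ) = c κ := by
  classical
  have : ((Finsupp.linearCombination ℕ m c : LambdaN) : MvPowerSeries ℕ ℤ) =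
      c.sum fun μ a => a • (m μ : MvPowerSeries ℕ ℤ) := by
    rw [Finsupp.linearCombination_apply, Finsupp.sum, Finsupp.sum,
      ← LambdaN.coe_subtype, map_sum]
    exact Finset.sum_congr rfl fun μ _ => map_nsmul _ _ _
  rw [this, Finsupp.sum, map_sum]
  simp only [map_nsmul, coeff_rowFinsupp_m]
  simp +contextual

/-- The monomial symmetric functions form a basis of `Λ_ℕ`. -/
noncomputable def basis : Module.Basis YoungDiagram ℕ LambdaN :=
  Module.Basis.mk (v := m)
    (linearIndependent_iff_injective_finsuppLinearCombination.2 fun c d h => by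
      ext κ
      have := coeff_linearCombination_m c κ
      rw [h, coeff_linearCombination_m d κ] at this
      exact_mod_cast this.symm)
    (by
      rintro ⟨x, hx⟩ -
      obtain ⟨c, rfl⟩ := (Finsupp.mem_span_range_iff_exists_finsupp).1
        (show x ∈ Submodule.span ℕ (Set.range monomialSymmetric) from hx)
      have : (⟨_, hx⟩ : LambdaN) = c.sum fun μ a => a • m μ := by
        apply Subtype.ext
        show _ = LambdaN.subtype _
        simp only [Finsupp.sum, map_sum, map_nsmul]
        rfl
      rw [this]
      exact Submodule.sum_mem _ fun μ _ =>
        Submodule.smul_mem _ _ (Submodule.subset_span (Set.mem_range_self μ)))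

theorem basis_apply (μ : YoungDiagram) : basis μ = m μ := Module.Basis.mk_apply _ _ μ

theorem coe_repr (x : LambdaN) (κ : YoungDiagram) :
    (basis.repr x κ : ℤ) = MvPowerSeries.coeff κ.rowFinsupp (x : MvPowerSeries ℕ ℤ) := by
  rw [← coeff_linearCombination_m]
  congr 2
  conv_rhs => rw [← basis.linearCombination_repr x]
  congr 2
  ext1 μ
  exact (basis_apply μ).symm

open Classical in
/-- The coefficient of `m_κ` in `m_μ m_ν`. -/
theorem repr_mul (μ ν κ : YoungDiagram) :
    basis.repr (basis μ * basis ν) κ =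
      ((Finset.HasAntidiagonal.antidiagonal κ.rowFinsupp).filter fun p =>
        IsRearrangement p.1 μ ∧ IsRearrangement p.2 ν).card := by
  have := coe_repr (basis μ * basis ν) κ
  rw [Subsemiring.coe_mul, MvPowerSeries.coeff_mul] at this
  simp only [basis_apply, coeff_m, ite_mul, one_mul, zero_mul, ← ite_and] at this
  rw [Finset.sum_boole] at this
  simp only [basis_apply]
  exact_mod_cast this

theorem basis_bot : basis ⊥ = 1 := by
  classical
  rw [basis_apply]
  apply Subtype.ext
  ext α
  rw [coeff_m, Subsemiring.coe_one, MvPowerSeries.coeff_one]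
  refine if_congr ⟨?_, ?_⟩ rfl rfl
  · rintro ⟨σ, hσ⟩
    ext i
    simpa [rowLen_bot] using hσ (σ.symm i)
  · rintro rfl
    exact ⟨1, fun i => by simp [rowLen_bot]⟩

theorem repr_mul_ne_zero_iff {μ ν κ : YoungDiagram} :
    basis.repr (basis μ * basis ν) κ ≠ 0 ↔
      ∃ α β, α + β = κ.rowFinsupp ∧ IsRearrangement α μ ∧ IsRearrangement β ν := by
  classical
  rw [repr_mul, Finset.card_ne_zero]
  constructor
  · rintro ⟨⟨α, β⟩, h⟩
    rw [Finset.mem_filter, Finset.HasAntidiagonal.mem_antidiagonal] at h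
    exact ⟨α, β, h⟩
  · rintro ⟨α, β, h⟩
    refine ⟨(α, β), ?_⟩
    rwa [Finset.mem_filter, Finset.HasAntidiagonal.mem_antidiagonal]

/-- The permutation that sorts `α + β` is applied to `α` and `β` separately. -/
theorem exists_repr_mul_ne_zero {μ ν : YoungDiagram} {α β : ℕ →₀ ℕ} (hα : IsRearrangement α μ)
    (hβ : IsRearrangement β ν) :
    ∃ κ, IsRearrangement (α + β) κ ∧ basis.repr (basis μ * basis ν) κ ≠ 0 := by
  obtain ⟨κ, σ, h⟩ := exists_perm_rowLen (α + β)
  refine ⟨κ, ⟨σ, h⟩, repr_mul_ne_zero_iff.2 ⟨_, _, ?_, hα.equivMapDomain σ.symm,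
    hβ.equivMapDomain σ.symm⟩⟩
  ext i
  simpa [rowFinsupp_apply] using h i

/-- The pairs `(α, β)` and `(β, α)` are different and contribute to the same coefficient. -/
theorem exists_two_le_repr_mul {μ : YoungDiagram} {α β : ℕ →₀ ℕ} (hα : IsRearrangement α μ)
    (hβ : IsRearrangement β μ) (hne : α ≠ β) :
    ∃ κ, IsRearrangement (α + β) κ ∧ 2 ≤ basis.repr (basis μ * basis μ) κ := by
  classical
  obtain ⟨κ, σ, h⟩ := exists_perm_rowLen (α + β)
  refine ⟨κ, ⟨σ, h⟩, ?_⟩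
  set α' := Finsupp.equivMapDomain σ.symm α with hα'
  set β' := Finsupp.equivMapDomain σ.symm β with hβ'
  have hne' : α' ≠ β' := fun h => hne (by
    ext i
    simpa [hα', hβ'] using DFunLike.congr_fun h (σ.symm i))
  have hsum : α' + β' = κ.rowFinsupp := by
    ext i
    simpa [rowFinsupp_apply, hα', hβ'] using h i
  rw [repr_mul, ← Finset.card_pair (a := (α', β')) (b := (β', α'))
    (fun h => hne' (Prod.ext_iff.1 h).1)]
  refine Finset.card_le_card fun p hp => ?_
  rw [Finset.mem_filter, Finset.HasAntidiagonal.mem_antidiagonal]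
  rw [Finset.mem_insert, Finset.mem_singleton] at hp
  rcases hp with rfl | rfl
  · exact ⟨hsum, hα.equivMapDomain _, hβ.equivMapDomain _⟩
  · exact ⟨(add_comm _ _).trans hsum, hβ.equivMapDomain _, hα.equivMapDomain _⟩

/-- The difference of the exponent sequences need not be decreasing, but it is a rearrangement of
some partition `ν`. -/
theorem repr_mul_lower (μ κ : YoungDiagram) (h : μ ≤ κ) :
    ∃ x, basis.repr (basis μ * x) κ ≠ 0 := by
  obtain ⟨ν, σ, hν⟩ := exists_perm_rowLen (κ.rowFinsupp - μ.rowFinsupp)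
  refine ⟨basis ν, repr_mul_ne_zero_iff.2 ⟨_, _, ?_, isRearrangement_rowFinsupp μ, σ, hν⟩⟩
  exact add_tsub_cancel_of_le fun i => le_iff_rowLen.1 h i

theorem le_of_repr_mul_ne_zero (μ ν κ : YoungDiagram)
    (h : basis.repr (basis μ * basis ν) κ ≠ 0) : μ ≤ κ := by
  obtain ⟨α, β, hsum, hα, -⟩ := repr_mul_ne_zero_iff.1 h
  refine le_iff_rowLen.2 fun a => hα.rowLen_le_iff.2 ⟨Finset.range a, by simp, fun i hi => ?_⟩
  have h1 := DFunLike.congr_fun hsum i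
  rw [Finsupp.add_apply, rowFinsupp_apply] at h1
  have h2 := κ.rowLen_anti a i (by simpa using hi)
  omega

/-- A pigeonhole argument. If `κ` had only `L` parts of size at least `b`, those of the first factor
would occupy all their positions. The `a + 1` parts of the second factor would then fall on top of
them and produce `a + 1` parts of size at least `2b > b`, but `κ` has at most `a` parts above `b`.
-/
theorem repr_mul_step (a b L : ℕ) (κ : YoungDiagram) (_ : a < L)
    (h : basis.repr (basis (rect a (b + 1) ⊔ rect L b) * basis (rect (a + 1) b)) κ ≠ 0)
    (hκ : κ.rowLen a ≤ b) : rect (L + 1) b ≤ κ := by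
  classical
  obtain ⟨α, β, hsum, ⟨σ, hσ⟩, ⟨τ, hτ⟩⟩ := repr_mul_ne_zero_iff.1 h
  obtain _ | b := b
  · rw [rect_zero_right]
    exact bot_le
  -- From here on the width is written `b + 1`, so it is positive.
  rw [rect_succ_le_iff]
  by_contra! hlt
  have hsum' : ∀ i, α i + β i = κ.rowLen i := fun i => DFunLike.congr_fun hsum i
  have hσL : ∀ i, i < L → b + 1 ≤ α (σ i) := by
    intro i hi
    rw [hσ, rowLen_sup, rowLen_rect, rowLen_rect, if_pos hi]
    exact le_max_right _ _
  have hlow : ∀ i, b < κ.rowLen i → i < L := by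
    intro i hi
    by_contra! hLi
    have := κ.rowLen_anti _ _ hLi
    omega
  have himage : (Finset.range L).image σ = Finset.range L := by
    refine Finset.eq_of_subset_of_card_le (fun x hx => ?_) ?_
    · obtain ⟨i, hi, rfl⟩ := Finset.mem_image.1 hx
      have h1 := hσL i (Finset.mem_range.1 hi)
      have h2 := hsum' (σ i)
      exact Finset.mem_range.2 (hlow _ (by omega))
    · rw [Finset.card_image_of_injective _ σ.injective]
  have hτa : ∀ j, j < a + 1 → τ j < a := by
    intro j hj
    have h1 := hτ j
    rw [rowLen_rect, if_pos hj] at h1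
    have h2 := hsum' (τ j)
    have h3 : τ j ∈ (Finset.range L).image σ := by
      rw [himage]
      exact Finset.mem_range.2 (hlow _ (by omega))
    obtain ⟨i, hi, hi'⟩ := Finset.mem_image.1 h3
    have h4 := hσL i (Finset.mem_range.1 hi)
    rw [hi'] at h4
    by_contra! hge
    have := κ.rowLen_anti _ _ hge
    omega
  have := Finset.card_le_card_of_injOn (s := Finset.range (a + 1)) (t := Finset.range a) τ
    (fun j hj => by simpa using hτa j (by simpa using hj)) τ.injective.injOn
  simp at this

/-! ### Homomorphisms from `Λ_ℕ` to `A_n`: supports and values -/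

theorem support_hom {n : ℕ} (hn : 1 ≤ n) (f : LambdaN →+* TruncNat n) :
    {μ | f (basis μ) ≠ 0} = Set.univ ∨
      ∃ a b, {μ | f (basis μ) ≠ 0} = {μ | μ.rowLen a ≤ b} :=
  PartitionBasis.support_eq_univ_or_eq_hook basis basis_bot repr_mul_lower le_of_repr_mul_ne_zero
    repr_mul_step hn f

/-- The permutation that exchanges the intervals `[a, a + N)` and `[a + N, a + 2N)`. -/
def blockSwap (a N : ℕ) : Equiv.Perm ℕ :=
  Function.Involutive.toPerm
    (fun i => if i < a then i else if i < a + N then i + N else if i < a + 2 * N then i - N else i)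
    (fun i => by dsimp only; split_ifs <;> omega)

theorem blockSwap_apply (a N i : ℕ) : blockSwap a N i =
    if i < a then i else if i < a + N then i + N else if i < a + 2 * N then i - N else i := rfl

theorem blockSwap_symm (a N : ℕ) : (blockSwap a N).symm = blockSwap a N := rfl

/-- Moving the rows of `μ` with index at least `a` away makes the sum of the parts in these rows
small. -/
theorem rowLen_add_blockSwap_le (μ ν : YoungDiagram) {a N i b : ℕ} (hμ : μ.colLen 0 ≤ N)
    (hν : ν.colLen 0 ≤ N) (hi : a ≤ i) (hb : μ.rowLen a ≤ b) (hb' : ν.rowLen a ≤ b) :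
    (μ.rowFinsupp + Finsupp.equivMapDomain (blockSwap a N) ν.rowFinsupp) i ≤ b := by
  rw [Finsupp.add_apply, Finsupp.equivMapDomain_apply, blockSwap_symm, rowFinsupp_apply,
    rowFinsupp_apply]
  have h1 := μ.rowLen_anti _ _ hi
  have h2 : blockSwap a N i < N → N ≤ i := by
    rw [blockSwap_apply]
    split_ifs <;> omega
  have h3 : a ≤ blockSwap a N i := by
    rw [blockSwap_apply]
    split_ifs <;> omega
  have h4 := ν.rowLen_anti _ _ h3
  by_cases h : blockSwap a N i < N
  · have := rowLen_eq_zero_iff.2 (hμ.trans (h2 h))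
    omega
  · have := rowLen_eq_zero_iff.2 (hν.trans (not_lt.1 h))
    omega

/-- Adding the parts in order gives a component with largest part `μ₀ + ν₀`. Placing the parts of
`ν` in positions disjoint from those of `μ` gives one with largest part at most `max μ₀ ν₀`. -/
theorem exists_mul_eq (μ ν : YoungDiagram) (hμ : μ ≠ ⊥) (hν : ν ≠ ⊥) :
    ∃ κ κ' r, κ ≠ ⊥ ∧ κ' ≠ ⊥ ∧ basis μ * basis ν = basis κ + basis κ' + r := by
  obtain ⟨κ, hκ, h⟩ := exists_repr_mul_ne_zero (isRearrangement_rowFinsupp μ)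
    (isRearrangement_rowFinsupp ν)
  obtain ⟨κ', hκ', h'⟩ := exists_repr_mul_ne_zero (isRearrangement_rowFinsupp μ)
    ((isRearrangement_rowFinsupp ν).equivMapDomain
      (blockSwap 0 (max (μ.colLen 0) (ν.colLen 0))))
  have hne : ∀ κ, basis.repr (basis μ * basis ν) κ ≠ 0 → κ ≠ ⊥ := by
    rintro κ h rfl
    exact hμ (le_bot_iff.1 (le_of_repr_mul_ne_zero _ _ _ h))
  rw [Ne, eq_bot_iff_rowLen_zero] at hμ hν
  have hne' : κ ≠ κ' := by
    rintro rfl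
    obtain ⟨s, hs, hle⟩ := (hκ.rowLen_le_iff (a := 0) (b := max (μ.rowLen 0) (ν.rowLen 0))).1
      (hκ'.rowLen_le_iff.2 ⟨∅, by simp, fun i _ =>
        rowLen_add_blockSwap_le μ ν (le_max_left _ _) (le_max_right _ _) (Nat.zero_le i)
          (le_max_left _ _) (le_max_right _ _)⟩)
    have h0 : (0 : ℕ) ∉ s := by
      rw [Finset.card_eq_zero.1 (Nat.le_zero.1 hs)]
      simp
    have := hle 0 h0
    rw [Finsupp.add_apply, rowFinsupp_apply, rowFinsupp_apply] at this
    omega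
  obtain ⟨r, hr⟩ := PartitionBasis.eq_add_add_of_repr_ne_zero basis hne' h h'
  exact ⟨κ, κ', r, hne κ h, hne κ' h', hr⟩

/-- A second arrangement `β` of the parts makes `m_κ`, with `κ` the sorted `μ + β`, occur at least
twice in `m_μ²`. So it suffices to find a `β` for which `κ` stays in the support. -/
theorem apply_eq_two_of_rearrangement (f : LambdaN →+* TruncNat 2) {μ : YoungDiagram}
    {β : ℕ →₀ ℕ} (hβ : IsRearrangement β μ) (hne : μ.rowFinsupp ≠ β)
    (hS : ∀ κ, IsRearrangement (μ.rowFinsupp + β) κ → f (basis κ) ≠ 0) : f (basis μ) = 2 := by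
  obtain ⟨κ, hκ, h⟩ := exists_two_le_repr_mul (isRearrangement_rowFinsupp μ) hβ hne
  exact PartitionBasis.apply_eq_two basis f
    (PartitionBasis.eq_add_self_add_of_two_le_repr basis h) (hS κ hκ) (hS κ hκ)

/-- The swap empties position `a`: it receives the entry at `a + N`, which lies below the last part.
-/
theorem rowFinsupp_ne_blockSwap {μ : YoungDiagram} {a N : ℕ} (ha : μ.rowLen a ≠ 0)
    (hN : μ.colLen 0 ≤ N) :
    μ.rowFinsupp ≠ Finsupp.equivMapDomain (blockSwap a N) μ.rowFinsupp := by
  intro h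
  have := DFunLike.congr_fun h a
  rw [Finsupp.equivMapDomain_apply, blockSwap_symm, rowFinsupp_apply, rowFinsupp_apply,
    blockSwap_apply, if_neg (lt_irrefl a)] at this
  rw [Ne, rowLen_eq_zero_iff] at ha
  rw [if_pos (by omega), rowLen_eq_zero_iff.2 (by omega : μ.colLen 0 ≤ a + N)] at this
  exact ha (rowLen_eq_zero_iff.1 this)

theorem apply_eq_two_of_univ (f : LambdaN →+* TruncNat 2)
    (hf : {μ | f (basis μ) ≠ 0} = Set.univ) {μ : YoungDiagram} (hμ : μ ≠ ⊥) :
    f (basis μ) = 2 := by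
  rw [Ne, eq_bot_iff_rowLen_zero] at hμ
  exact apply_eq_two_of_rearrangement f ((isRearrangement_rowFinsupp μ).equivMapDomain _)
    (rowFinsupp_ne_blockSwap hμ le_rfl) fun κ _ => (Set.ext_iff.1 hf κ).2 trivial

/-- The only basis elements on which a homomorphism is not determined by its support are the
large rectangles. -/
theorem apply_eq_two_of_hook (f : LambdaN →+* TruncNat 2) {a b : ℕ}
    (hf : {μ | f (basis μ) ≠ 0} = {μ | μ.rowLen a ≤ b}) {μ : YoungDiagram} (hμ : μ ≠ ⊥)
    (hμS : μ.rowLen a ≤ b) (hrect : ∀ k, b < k → μ ≠ rect a k) : f (basis μ) = 2 := by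
  have hS : ∀ κ, κ.rowLen a ≤ b → f (basis κ) ≠ 0 := fun κ => (Set.ext_iff.1 hf κ).2
  -- Three ways to rearrange within the hook. If `μ` has more than `a` parts, the rows from `a` on
  -- are moved to empty positions. If it has at most `a` parts and two adjacent ones among the first
  -- `a` positions differ, these are exchanged. Otherwise `μ` is a rectangle of width at most `b`,
  -- and all its rows are moved.
  by_cases ha : μ.rowLen a = 0
  · by_cases hr : ∃ r, r + 1 < a ∧ μ.rowLen (r + 1) < μ.rowLen r
    · obtain ⟨r, hra, hr⟩ := hr
      refine apply_eq_two_of_rearrangement f ((isRearrangement_rowFinsupp μ).equivMapDomain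
        (Equiv.swap r (r + 1))) (fun h => ?_) fun κ hκ => hS κ (hκ.rowLen_le_iff.2
          ⟨Finset.range a, by simp, fun i hi => ?_⟩)
      · have := DFunLike.congr_fun h r
        rw [Finsupp.equivMapDomain_apply, Equiv.symm_swap, Equiv.swap_apply_left,
          rowFinsupp_apply, rowFinsupp_apply] at this
        omega
      · have hi' : a ≤ i := by simpa using hi
        rw [Finsupp.add_apply, Finsupp.equivMapDomain_apply, Equiv.symm_swap,
          Equiv.swap_apply_of_ne_of_ne (by omega) (by omega), rowFinsupp_apply]
        have := μ.rowLen_anti _ _ hi'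
        omega
    · push Not at hr
      have hconst : ∀ i, i < a → μ.rowLen i = μ.rowLen 0 := by
        intro i hi
        induction i with
        | zero => rfl
        | succ i ih =>
          have := hr i hi
          have := μ.rowLen_anti i (i + 1) (Nat.le_succ i)
          have := ih (by omega)
          omega
      have hμr : μ = rect a (μ.rowLen 0) := by
        refine ext_rowLen fun i => ?_
        rw [rowLen_rect]
        split_ifs with hi
        · exact hconst i hi
        · have := μ.rowLen_anti _ _ (not_lt.1 hi)
          omega
      have hk : μ.rowLen 0 ≤ b := by
        by_contra! hk
        exact hrect _ hk hμr
      rw [Ne, eq_bot_iff_rowLen_zero] at hμ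
      exact apply_eq_two_of_rearrangement f ((isRearrangement_rowFinsupp μ).equivMapDomain _)
        (rowFinsupp_ne_blockSwap hμ le_rfl) fun κ hκ => hS κ (hκ.rowLen_le_iff.2
          ⟨∅, by simp, fun i _ =>
            rowLen_add_blockSwap_le μ μ le_rfl le_rfl (Nat.zero_le i) hk hk⟩)
  · exact apply_eq_two_of_rearrangement f ((isRearrangement_rowFinsupp μ).equivMapDomain _)
      (rowFinsupp_ne_blockSwap ha le_rfl) fun κ hκ => hS κ (hκ.rowLen_le_iff.2
        ⟨Finset.range a, by simp, fun i hi =>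
          rowLen_add_blockSwap_le μ μ le_rfl le_rfl (by simpa using hi) hμS hμS⟩)

/-- Entries `k > b` can only stand where `κ` exceeds `b`, that is, in the first `a` positions; as
there are `a` of them, they fill these. -/
theorem eq_rowFinsupp_of_isRearrangement_rect {α : ℕ →₀ ℕ} {a k b : ℕ} {κ : YoungDiagram}
    (hα : IsRearrangement α (rect a k)) (hle : ∀ i, α i ≤ κ.rowLen i) (hκ : κ.rowLen a ≤ b)
    (hk : b < k) : α = (rect a k).rowFinsupp := by
  classical
  obtain ⟨σ, hσ⟩ := hα
  have himage : (Finset.range a).image σ = Finset.range a := by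
    refine Finset.eq_of_subset_of_card_le (fun x hx => ?_) ?_
    · obtain ⟨i, hi, rfl⟩ := Finset.mem_image.1 hx
      have h1 := hσ i
      rw [rowLen_rect, if_pos (Finset.mem_range.1 hi)] at h1
      rw [Finset.mem_range]
      by_contra! hge
      have h2 := κ.rowLen_anti _ _ hge
      have h3 := hle (σ i)
      omega
    · rw [Finset.card_image_of_injective _ σ.injective]
  ext j
  rw [rowFinsupp_apply]
  have h1 := hσ (σ.symm j)
  rw [Equiv.apply_symm_apply] at h1
  rw [h1, rowLen_rect, rowLen_rect]
  refine if_congr ?_ rfl rfl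
  have h2 := Finset.ext_iff.1 himage j
  rw [Finset.mem_image, Finset.mem_range] at h2
  rw [← h2]
  constructor
  · intro h
    exact ⟨_, Finset.mem_range.2 h, by simp⟩
  · rintro ⟨i, hi, rfl⟩
    simpa using hi

/-- Within the hook both factors have all their parts in the first `a` positions. Hence the wider
rectangle is the only component of the product in the support, and it occurs once. -/
theorem apply_rect_add {n : ℕ} (f : LambdaN →+* TruncNat n) {a b : ℕ}
    (hf : {μ | f (basis μ) ≠ 0} = {μ | μ.rowLen a ≤ b}) {k l : ℕ} (hk : b < k) (hl : b < l) :
    f (basis (rect a (k + l))) = f (basis (rect a k)) * f (basis (rect a l)) := by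
  classical
  have hrow : (rect a k).rowFinsupp + (rect a l).rowFinsupp = (rect a (k + l)).rowFinsupp := by
    ext i
    rw [Finsupp.add_apply, rowFinsupp_apply, rowFinsupp_apply, rowFinsupp_apply, rowLen_rect,
      rowLen_rect, rowLen_rect]
    split_ifs <;> simp
  have key : ∀ κ : YoungDiagram, κ.rowLen a ≤ b → ∀ α β : ℕ →₀ ℕ, α + β = κ.rowFinsupp →
      IsRearrangement α (rect a k) → IsRearrangement β (rect a l) →
      α = (rect a k).rowFinsupp ∧ β = (rect a l).rowFinsupp := by
    intro κ hκ α β hsum hα hβ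
    have hsum' : ∀ i, α i + β i = κ.rowLen i := fun i => DFunLike.congr_fun hsum i
    exact ⟨eq_rowFinsupp_of_isRearrangement_rect hα
        (fun i => by have := hsum' i; omega) hκ hk,
      eq_rowFinsupp_of_isRearrangement_rect hβ (fun i => by have := hsum' i; omega) hκ hl⟩
  have hrectS : (rect a (k + l)).rowLen a ≤ b := by
    rw [rowLen_rect, if_neg (lt_irrefl a)]
    exact Nat.zero_le b
  have hone : basis.repr (basis (rect a k) * basis (rect a l)) (rect a (k + l)) = 1 := by
    rw [repr_mul, Finset.card_eq_one]
    refine ⟨((rect a k).rowFinsupp, (rect a l).rowFinsupp), ?_⟩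
    ext ⟨α, β⟩
    rw [Finset.mem_filter, Finset.HasAntidiagonal.mem_antidiagonal, Finset.mem_singleton,
      Prod.mk.injEq]
    constructor
    · rintro ⟨hsum, hα, hβ⟩
      exact key _ hrectS α β hsum hα hβ
    · rintro ⟨rfl, rfl⟩
      exact ⟨hrow, isRearrangement_rowFinsupp _, isRearrangement_rowFinsupp _⟩
  rw [← map_mul, ← basis.linearCombination_repr (basis (rect a k) * basis (rect a l)),
    Finsupp.linearCombination_apply, Finsupp.sum, map_sum,
    Finset.sum_eq_single (rect a (k + l))]
  · rw [hone, one_smul]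
  · intro κ hκ hne
    rw [map_nsmul]
    have : f (basis κ) = 0 := by
      by_contra h0
      have hκS : κ.rowLen a ≤ b := (Set.ext_iff.1 hf κ).1 h0
      obtain ⟨α, β, hsum, hα, hβ⟩ := repr_mul_ne_zero_iff.1 (Finsupp.mem_support_iff.1 hκ)
      obtain ⟨rfl, rfl⟩ := key κ hκS α β hsum hα hβ
      refine hne (ext_rowLen fun i => ?_)
      exact (DFunLike.congr_fun (hsum.symm.trans hrow) i)
    rw [this]
    exact nsmul_zero _
  · intro h
    rw [Finsupp.notMem_support_iff.1 h, zero_smul, map_zero]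

theorem finite_support_eq (S : Set YoungDiagram) :
    {f : LambdaN →+* TruncNat 2 | {μ | f (basis μ) ≠ 0} = S}.Finite := by
  by_cases hne : {f : LambdaN →+* TruncNat 2 | {μ | f (basis μ) ≠ 0} = S}.Nonempty
  swap
  · rw [Set.not_nonempty_iff_eq_empty.1 hne]
    exact Set.finite_empty
  obtain ⟨f₀, hf₀⟩ := hne
  have hzero : ∀ f g : LambdaN →+* TruncNat 2, {μ | f (basis μ) ≠ 0} = S →
      {μ | g (basis μ) ≠ 0} = S → ∀ μ, f (basis μ) = 0 → g (basis μ) = 0 := by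
    intro f g hf hg μ h
    by_contra hne
    exact (Set.ext_iff.1 (hf.trans hg.symm) μ).2 hne h
  rcases support_hom one_le_two f₀ with h | ⟨a, b, h⟩
  · refine Set.Subsingleton.finite fun f hf g hg => PartitionBasis.hom_ext basis fun μ => ?_
    have hf' : _ = Set.univ := (Set.mem_ofPred_eq ▸ hf : _ = S).trans (hf₀.symm.trans h)
    have hg' : _ = Set.univ := (Set.mem_ofPred_eq ▸ hg : _ = S).trans (hf₀.symm.trans h)
    by_cases hμ : μ = ⊥
    · rw [hμ, basis_bot, map_one, map_one]
    · rw [apply_eq_two_of_univ f hf' hμ, apply_eq_two_of_univ g hg' hμ]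
  · have hS : S = {μ | μ.rowLen a ≤ b} := hf₀.symm.trans h
    -- The values at widths `k` with `b < k < 2b + 2` suffice, since larger widths are sums of two
    -- widths greater than `b`.
    refine Set.Finite.of_finite_image (f := fun (f : LambdaN →+* TruncNat 2)
      (k : Fin (2 * b + 2)) => f (basis (rect a k))) (Set.toFinite _) fun f hf g hg hfg => ?_
    have hf' : {μ | f (basis μ) ≠ 0} = S := hf
    have hg' : {μ | g (basis μ) ≠ 0} = S := hg
    have hrect : ∀ k, b < k → f (basis (rect a k)) = g (basis (rect a k)) := by
      intro k
      induction k using Nat.strong_induction_on with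
      | _ k ih =>
        intro hk
        by_cases hk' : k < 2 * b + 2
        · exact congrFun hfg ⟨k, hk'⟩
        -- As `k ≥ 2b + 2`, splitting off `b + 1` leaves a width that is still greater than `b`.
        · obtain ⟨l, rfl⟩ := Nat.exists_eq_add_of_le (show b + 1 ≤ k by omega)
          rw [apply_rect_add f (hf'.trans hS) (Nat.lt_succ_self b) (by omega),
            apply_rect_add g (hg'.trans hS) (Nat.lt_succ_self b) (by omega),
            ih _ (by omega) (by omega), ih _ (by omega) (by omega)]
    refine PartitionBasis.hom_ext basis fun μ => ?_
    by_cases hμ : μ = ⊥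
    · rw [hμ, basis_bot, map_one, map_one]
    by_cases hμS : μ.rowLen a ≤ b
    · by_cases hex : ∃ k, b < k ∧ μ = rect a k
      · obtain ⟨k, hk, rfl⟩ := hex
        exact hrect k hk
      · push Not at hex
        rw [apply_eq_two_of_hook f (hf'.trans hS) hμ hμS hex,
          apply_eq_two_of_hook g (hg'.trans hS) hμ hμS hex]
    · have h0 : f (basis μ) = 0 := by
        by_contra h0
        exact hμS ((Set.ext_iff.1 (hf'.trans hS) μ).1 h0)
      rw [h0, hzero f g hf' hg' μ h0]

/-- An element of `A_2` is zero if and only if its image in `𝐁` is, so all members of the fibre over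
`z` have the support of `z`. -/
theorem finite_fibre (z : BigWitt (TruncNat 1)) :
    {a : BigWitt (TruncNat 2) | BigWitt.map (truncMap one_le_two) a = z}.Finite := by
  refine (finite_support_eq {μ | z (basis μ) ≠ 0}).subset ?_
  rintro f rfl
  exact Set.ext fun μ => not_congr (TruncNat.truncMap_eq_zero_iff _).symm

theorem countable_bigWitt_iff (n : ℕ) : Countable (BigWitt (TruncNat n)) ↔ n ≤ 2 :=
  PartitionBasis.countable_iff_le_two (W := fun n => BigWitt (TruncNat n))
    (fun _ hn => (PartitionBasis.exists_injective_family basis basis_bot exists_mul_eq hn).imp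
      fun _ h => h.1)
    PartitionBasis.countable_hom_zero
    (PartitionBasis.countable_hom_one basis (support_hom le_rfl))
    (PartitionBasis.countable_hom basis (support_hom one_le_two)
      fun S => (finite_support_eq S).countable) n

end LambdaN

/-! ### Semistandard tableaux and the Bender-Knuth involutions -/

/-- A downward closed condition selects an initial segment, and the cardinality of the segment is
the place where it ends. -/
theorem Finset.lt_card_filter_range {n : ℕ} {P : ℕ → Prop} [DecidablePred P]
    (hP : ∀ a b, a ≤ b → b < n → P b → P a) {c : ℕ} :
    c < ((Finset.range n).filter P).card ↔ c < n ∧ P c := by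
  set F := (Finset.range n).filter P with hF
  have hsub : Finset.range F.card ⊆ F := by
    intro c hc
    by_contra hcF
    have : F ⊆ Finset.range c := by
      intro d hd
      rw [Finset.mem_range]
      by_contra! hcd
      rw [hF, Finset.mem_filter, Finset.mem_range] at hd hcF
      exact hcF ⟨by omega, hP c d hcd hd.1 hd.2⟩
    have := Finset.card_le_card this
    rw [Finset.card_range] at this
    rw [Finset.mem_range] at hc
    omega
  have heq := Finset.eq_of_subset_of_card_le hsub (by rw [Finset.card_range])
  rw [← Finset.mem_range, heq, hF, Finset.mem_filter, Finset.mem_range]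

namespace SemistandardYoungTableau

variable {ν : YoungDiagram}

/-- The number of entries `k` of `T` in the columns with index at least `j`. -/
def colWt (T : SemistandardYoungTableau ν) (j k : ℕ) : ℕ :=
  (ν.cells.filter fun c => j ≤ c.2 ∧ T c.1 c.2 = k).card

/-- The number of entries less than `v` of `T` in the columns with index less than `j`. -/
def cumWt (T : SemistandardYoungTableau ν) (j v : ℕ) : ℕ :=
  (ν.cells.filter fun c => c.2 < j ∧ T c.1 c.2 < v).card

/-- The number of entries less than `v` of `T` in row `i` and in the columns with index less
than `j`. -/
def threshold (T : SemistandardYoungTableau ν) (j v i : ℕ) : ℕ :=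
  ((Finset.range (min j (ν.rowLen i))).filter fun c => T i c < v).card

theorem lt_threshold {T : SemistandardYoungTableau ν} {j v i c : ℕ} :
    c < T.threshold j v i ↔ c < j ∧ (i, c) ∈ ν ∧ T i c < v := by
  rw [threshold, Finset.lt_card_filter_range, lt_min_iff, ← YoungDiagram.mem_iff_lt_rowLen,
    and_assoc]
  intro a b hab hb hlt
  exact (T.row_weak_of_le hab (YoungDiagram.mem_iff_lt_rowLen.2
    (hb.trans_le (min_le_right _ _)))).trans_lt hlt

theorem threshold_mono (T : SemistandardYoungTableau ν) (j i : ℕ) {v w : ℕ} (h : v ≤ w) :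
    T.threshold j v i ≤ T.threshold j w i := by
  refine le_of_forall_lt fun c hc => ?_
  rw [lt_threshold] at hc ⊢
  exact ⟨hc.1, hc.2.1, hc.2.2.trans_le h⟩

/-- Strict columns become interlacing inequalities between the thresholds of adjacent rows. -/
theorem threshold_succ_le (T : SemistandardYoungTableau ν) (j v i : ℕ) :
    T.threshold j (v + 1) (i + 1) ≤ T.threshold j v i := by
  refine le_of_forall_lt fun c hc => ?_
  rw [lt_threshold] at hc ⊢
  have := T.col_strict (Nat.lt_add_one i) hc.2.1
  exact ⟨hc.1, ν.up_left_mem (Nat.le_succ i) le_rfl hc.2.1, by omega⟩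

theorem cumWt_eq_sum (T : SemistandardYoungTableau ν) (j v : ℕ) :
    T.cumWt j v = ∑ i ∈ Finset.range (ν.colLen 0), T.threshold j v i := by
  rw [cumWt, Finset.card_eq_sum_card_fiberwise (f := Prod.fst) (t := Finset.range (ν.colLen 0))]
  · refine Finset.sum_congr rfl fun i _ => ?_
    refine Finset.card_bij' (fun c _ => c.2) (fun c _ => (i, c)) ?_ ?_ ?_ ?_
    · rintro ⟨i', c⟩ hc
      simp only [Finset.mem_filter, YoungDiagram.mem_cells] at hc
      obtain ⟨⟨h1, h2, h3⟩, rfl⟩ := hc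
      rw [Finset.mem_filter, Finset.mem_range, lt_min_iff, ← YoungDiagram.mem_iff_lt_rowLen]
      exact ⟨⟨h2, h1⟩, h3⟩
    · intro c hc
      rw [Finset.mem_filter, Finset.mem_range, lt_min_iff, ← YoungDiagram.mem_iff_lt_rowLen] at hc
      simp only [Finset.mem_filter, YoungDiagram.mem_cells]
      exact ⟨⟨hc.1.2, hc.1.1, hc.2⟩, trivial⟩
    · rintro ⟨i', c⟩ hc
      simp only [Finset.mem_filter] at hc
      exact Prod.ext hc.2.symm rfl
    · intro c _
      rfl
  · rintro ⟨i, c⟩ hc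
    simp only [Finset.coe_filter, Set.mem_ofPred_eq, YoungDiagram.mem_cells] at hc
    have h : i < ν.colLen c := YoungDiagram.mem_iff_lt_colLen.1 hc.1
    have := ν.colLen_anti 0 c (Nat.zero_le _)
    simp only [Finset.coe_range, Set.mem_Iio]
    omega

/-- The columns left of `j` contain `cumWt j (v + 1) - cumWt j v` entries `v`; the equation avoids
the subtraction. -/
theorem colWt_zero_add_cumWt (T : SemistandardYoungTableau ν) (j v : ℕ) :
    T.colWt 0 v + T.cumWt j v = T.colWt j v + T.cumWt j (v + 1) := by
  have h1 : T.colWt 0 v = T.colWt j v +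
      (ν.cells.filter fun c => c.2 < j ∧ T c.1 c.2 = v).card := by
    rw [colWt, colWt, ← Finset.card_union_of_disjoint]
    · congr 1
      ext c
      simp only [Finset.mem_filter, Finset.mem_union]
      have := lt_or_ge c.2 j
      have := Nat.zero_le c.2
      tauto
    · rw [Finset.disjoint_left]
      intro c hc hc'
      rw [Finset.mem_filter] at hc hc'
      omega
  have h2 : T.cumWt j (v + 1) = T.cumWt j v +
      (ν.cells.filter fun c => c.2 < j ∧ T c.1 c.2 = v).card := by
    rw [cumWt, cumWt, ← Finset.card_union_of_disjoint]
    · congr 1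
      ext c
      simp only [Finset.mem_filter, Finset.mem_union, Nat.lt_succ_iff_lt_or_eq]
      tauto
    · rw [Finset.disjoint_left]
      intro c hc hc'
      rw [Finset.mem_filter] at hc hc'
      omega
  omega

/-- The upper bound for the number of entries at most `k` in row `i` that the rows around it
allow. -/
def bkUpper (T : SemistandardYoungTableau ν) (j k : ℕ) : ℕ → ℕ
  | 0 => T.threshold j (k + 2) 0
  | i + 1 => min (T.threshold j k i) (T.threshold j (k + 2) (i + 1))

/-- The reflection of `T.threshold j (k + 1) i` in the interval of values that the entries other
than `k` and `k + 1` allow. -/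
def bkThreshold (T : SemistandardYoungTableau ν) (j k i : ℕ) : ℕ :=
  max (T.threshold j k i) (T.threshold j (k + 2) (i + 1)) + T.bkUpper j k i -
    T.threshold j (k + 1) i

theorem threshold_mem_Icc (T : SemistandardYoungTableau ν) (j k i : ℕ) :
    max (T.threshold j k i) (T.threshold j (k + 2) (i + 1)) ≤ T.threshold j (k + 1) i ∧
      T.threshold j (k + 1) i ≤ T.bkUpper j k i := by
  refine ⟨max_le (T.threshold_mono j i (Nat.le_succ k)) (T.threshold_succ_le j (k + 1) i), ?_⟩
  cases i with
  | zero => exact T.threshold_mono j 0 (Nat.le_succ _)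
  | succ i => exact le_min (T.threshold_succ_le j k i) (T.threshold_mono j _ (Nat.le_succ _))

theorem bkUpper_le (T : SemistandardYoungTableau ν) (j k i : ℕ) :
    T.bkUpper j k i ≤ T.threshold j (k + 2) i := by
  cases i with
  | zero => exact le_rfl
  | succ i => exact min_le_right _ _

theorem bkThreshold_mem_Icc (T : SemistandardYoungTableau ν) (j k i : ℕ) :
    max (T.threshold j k i) (T.threshold j (k + 2) (i + 1)) ≤ T.bkThreshold j k i ∧
      T.bkThreshold j k i ≤ T.bkUpper j k i := by
  have := T.threshold_mem_Icc j k i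
  rw [bkThreshold]
  omega

/-- The lower bound in row `i` and the upper bound in row `i + 1` are the maximum and the minimum of
the same two thresholds. Their sum is the sum of these thresholds, so the sum over all rows
telescopes. -/
theorem sum_bkThreshold (T : SemistandardYoungTableau ν) (j k : ℕ) :
    ∑ i ∈ Finset.range (ν.colLen 0), T.bkThreshold j k i + T.cumWt j (k + 1) =
      T.cumWt j k + T.cumWt j (k + 2) := by
  have key : ∀ R, ∑ i ∈ Finset.range R, (T.bkThreshold j k i + T.threshold j (k + 1) i) +
      T.bkUpper j k R = ∑ i ∈ Finset.range R, T.threshold j k i +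
        ∑ i ∈ Finset.range (R + 1), T.threshold j (k + 2) i := by
    intro R
    induction R with
    | zero => simp [bkUpper]
    | succ R ih =>
      have h1 := T.threshold_mem_Icc j k R
      rw [Finset.sum_range_succ, Finset.sum_range_succ (n := R),
        Finset.sum_range_succ (n := R + 1), bkThreshold]
      have h2 : T.bkUpper j k (R + 1) =
        min (T.threshold j k R) (T.threshold j (k + 2) (R + 1)) := rfl
      omega
  have h0 : T.threshold j (k + 2) (ν.colLen 0) = 0 := by
    by_contra h
    have := (lt_threshold.1 (Nat.pos_of_ne_zero h)).2.1
    rw [YoungDiagram.mem_iff_lt_colLen] at this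
    exact lt_irrefl _ this
  have h1 := key (ν.colLen 0)
  have h2 := T.bkUpper_le j k (ν.colLen 0)
  rw [Finset.sum_range_succ, Finset.sum_add_distrib, ← cumWt_eq_sum, ← cumWt_eq_sum,
    ← cumWt_eq_sum] at h1
  omega

/-- The Bender-Knuth involution that exchanges the numbers of entries `k` and `k + 1` in the
columns with index less than `j`, for a tableau without entry `k` in column `j`. -/
def bkAux (j k : ℕ) (T : SemistandardYoungTableau ν) (hT : ∀ i, (i, j) ∈ ν → T i j ≠ k) :
    SemistandardYoungTableau ν where
  entry i c := if c < j ∧ (i, c) ∈ ν ∧ k ≤ T i c ∧ T i c ≤ k + 1 then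
    (if c < T.bkThreshold j k i then k else k + 1) else T i c
  row_weak' := by
    intro i c1 c2 hc hmem
    have h1 := T.row_weak hc hmem
    have hmem1 := ν.up_left_mem le_rfl hc.le hmem
    -- The rewritten part meets the unchanged part at column `j`. A rewritten entry may rise from
    -- `k` to `k + 1`; the entry in column `j` is at least `k` and not `k`, so the row stays weakly
    -- increasing.
    have h2 : c1 < j → j ≤ c2 → T i c1 ≤ T i j ∧ T i j ≤ T i c2 ∧ T i j ≠ k := fun h h' =>
      have hj := ν.up_left_mem le_rfl h' hmem
      ⟨T.row_weak h hj, T.row_weak_of_le h' hmem, hT i hj⟩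
    split_ifs <;> simp_all <;> omega
  col_strict' := by
    intro i1 i2 c hi hmem
    have h1 := T.col_strict hi hmem
    have hmem1 := ν.up_left_mem hi.le le_rfl hmem
    -- A strict column has room for `k` and `k + 1` only in adjacent rows.
    have h2 : k ≤ T i1 c → T i2 c ≤ k + 1 → i2 = i1 + 1 := by
      intro h h'
      by_contra hne
      have h3 := T.col_strict (show i1 + 1 < i2 by omega) hmem
      have h4 := T.col_strict (Nat.lt_add_one i1)
        (ν.up_left_mem (show i1 + 1 ≤ i2 by omega) le_rfl hmem)
      omega
    by_cases hcj : c < j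
    swap
    · simp only [hcj, false_and, if_false]
      exact h1
    by_cases h3 : k ≤ T i1 c ∧ T i2 c ≤ k + 1
    · obtain rfl := h2 h3.1 h3.2
      have h4 : T i1 c = k ∧ T (i1 + 1) c = k + 1 := by omega
      -- A `k` directly above a `k + 1` is not free: the bounds on the reflected thresholds keep
      -- both entries.
      have h5 : c < T.bkThreshold j k i1 :=
        lt_of_lt_of_le (lt_threshold.2 ⟨hcj, hmem, by omega⟩)
          ((le_max_right _ _).trans (T.bkThreshold_mem_Icc j k i1).1)
      have h6 : ¬ c < T.bkThreshold j k (i1 + 1) := fun h =>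
        absurd (lt_threshold.1 (h.trans_le ((T.bkThreshold_mem_Icc j k (i1 + 1)).2.trans
          (min_le_left _ _)))).2.2 (by omega)
      have h7 : c < j ∧ (i1, c) ∈ ν ∧ k ≤ T i1 c ∧ T i1 c ≤ k + 1 :=
        ⟨hcj, hmem1, by omega, by omega⟩
      have h8 : c < j ∧ (i1 + 1, c) ∈ ν ∧ k ≤ T (i1 + 1) c ∧ T (i1 + 1) c ≤ k + 1 :=
        ⟨hcj, hmem, by omega, by omega⟩
      rw [if_pos h7, if_pos h5, if_pos h8, if_neg h6]
      exact Nat.lt_succ_self k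
    · split_ifs <;> omega
  zeros' := by
    intro i c hmem
    rw [if_neg fun h => hmem h.2.1, T.zeros hmem]

open Classical in
/-- The Bender-Knuth involution, extended by the identity. -/
noncomputable def bk (j k : ℕ) (T : SemistandardYoungTableau ν) : SemistandardYoungTableau ν :=
  if hT : ∀ i, (i, j) ∈ ν → T i j ≠ k then bkAux j k T hT else T

section

variable {j k : ℕ} {T : SemistandardYoungTableau ν}

theorem bk_apply (hT : ∀ i, (i, j) ∈ ν → T i j ≠ k) (i c : ℕ) : T.bk j k i c =
    if c < j ∧ (i, c) ∈ ν ∧ k ≤ T i c ∧ T i c ≤ k + 1 then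
      (if c < T.bkThreshold j k i then k else k + 1) else T i c := by
  rw [bk, dif_pos hT]
  rfl

theorem bk_apply_of_le {i c : ℕ} (hc : j ≤ c) : T.bk j k i c = T i c := by
  by_cases hT : ∀ i, (i, j) ∈ ν → T i j ≠ k
  · rw [bk_apply hT, if_neg fun h => absurd h.1 (not_lt.2 hc)]
  · rw [bk, dif_neg hT]

theorem colWt_bk {j' : ℕ} (hj : j ≤ j') (v : ℕ) : (T.bk j k).colWt j' v = T.colWt j' v := by
  rw [colWt, colWt]
  congr 1
  refine Finset.filter_congr fun c _ => and_congr_right fun hc => ?_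
  rw [bk_apply_of_le (hj.trans hc)]

theorem bk_lt (hT : ∀ i, (i, j) ∈ ν → T i j ≠ k) {N i c : ℕ} (hk : k + 1 < N)
    (h : T i c < N) : T.bk j k i c < N := by
  rw [bk_apply hT]
  split_ifs <;> omega

theorem threshold_bk_of_ne (hT : ∀ i, (i, j) ∈ ν → T i j ≠ k) {v : ℕ} (hv : v ≠ k + 1) (i : ℕ) :
    (T.bk j k).threshold j v i = T.threshold j v i := by
  refine eq_of_forall_lt_iff fun c => ?_
  rw [lt_threshold, lt_threshold, bk_apply hT]
  refine and_congr_right fun _ => and_congr_right fun _ => ?_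
  split_ifs <;> omega

theorem threshold_bk (hT : ∀ i, (i, j) ∈ ν → T i j ≠ k) (i : ℕ) :
    (T.bk j k).threshold j (k + 1) i = T.bkThreshold j k i := by
  refine eq_of_forall_lt_iff fun c => ?_
  rw [lt_threshold, bk_apply hT]
  have h1 : c < T.bkThreshold j k i → c < j ∧ (i, c) ∈ ν ∧ T i c < k + 2 := fun h =>
    lt_threshold.1 (h.trans_le ((T.bkThreshold_mem_Icc j k i).2.trans (T.bkUpper_le j k i)))
  have h2 : c < j → (i, c) ∈ ν → T i c < k → c < T.bkThreshold j k i := fun hc hmem hlt =>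
    (lt_threshold.2 ⟨hc, hmem, hlt⟩).trans_le
      ((le_max_left _ _).trans (T.bkThreshold_mem_Icc j k i).1)
  constructor
  · rintro ⟨hc, hmem, hlt⟩
    by_contra h
    rw [if_neg h] at hlt
    split_ifs at hlt with h3
    · omega
    · exact h (h2 hc hmem (by by_contra h4; exact h3 ⟨hc, hmem, by omega, by omega⟩))
  · intro h
    obtain ⟨hc, hmem, hlt⟩ := h1 h
    refine ⟨hc, hmem, ?_⟩
    rw [if_pos h]
    split_ifs with h3
    · omega
    · by_contra h4
      exact h3 ⟨hc, hmem, by omega, by omega⟩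

theorem bk_ne (hT : ∀ i, (i, j) ∈ ν → T i j ≠ k) (i : ℕ) (hi : (i, j) ∈ ν) :
    T.bk j k i j ≠ k := by
  rw [bk_apply_of_le le_rfl]
  exact hT i hi

/-- Only the threshold at `k + 1` changes. It is reflected in an interval whose ends depend on the
thresholds at `k` and `k + 2`, so a second reflection restores it. -/
theorem bk_bk (hT : ∀ i, (i, j) ∈ ν → T i j ≠ k) : (T.bk j k).bk j k = T := by
  ext i c
  have h1 : (T.bk j k).bkThreshold j k i = T.threshold j (k + 1) i := by
    have h2 := T.bkThreshold_mem_Icc j k i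
    have h3 := T.threshold_mem_Icc j k i
    have h4 : (T.bk j k).bkUpper j k i = T.bkUpper j k i := by
      cases i with
      | zero => exact threshold_bk_of_ne hT (by omega) 0
      | succ i => rw [bkUpper, bkUpper, threshold_bk_of_ne hT (by omega),
          threshold_bk_of_ne hT (by omega)]
    rw [bkThreshold, threshold_bk hT, threshold_bk_of_ne hT (by omega),
      threshold_bk_of_ne hT (by omega), h4]
    rw [bkThreshold] at h2 ⊢
    omega
  rw [bk_apply (bk_ne hT), h1, bk_apply hT]
  by_cases h : c < j ∧ (i, c) ∈ ν ∧ k ≤ T i c ∧ T i c ≤ k + 1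
  · rw [if_pos h, if_pos (by split_ifs <;> exact ⟨h.1, h.2.1, by omega, by omega⟩)]
    split_ifs with h2
    · have := (lt_threshold.1 h2).2.2
      omega
    · have : ¬ T i c < k + 1 := fun h3 => h2 (lt_threshold.2 ⟨h.1, h.2.1, h3⟩)
      omega
  · rw [if_neg h, if_neg h]

theorem cumWt_bk_of_ne (hT : ∀ i, (i, j) ∈ ν → T i j ≠ k) {v : ℕ} (hv : v ≠ k + 1) :
    (T.bk j k).cumWt j v = T.cumWt j v := by
  rw [cumWt_eq_sum, cumWt_eq_sum]
  exact Finset.sum_congr rfl fun i _ => threshold_bk_of_ne hT hv i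

theorem cumWt_bk (hT : ∀ i, (i, j) ∈ ν → T i j ≠ k) :
    (T.bk j k).cumWt j (k + 1) + T.cumWt j (k + 1) = T.cumWt j k + T.cumWt j (k + 2) := by
  rw [cumWt_eq_sum, Finset.sum_congr rfl fun i _ => threshold_bk hT i, sum_bkThreshold]

theorem colWt_zero_bk_of_ne (hT : ∀ i, (i, j) ∈ ν → T i j ≠ k) {v : ℕ} (hv : v ≠ k)
    (hv' : v ≠ k + 1) : (T.bk j k).colWt 0 v = T.colWt 0 v := by
  have h1 := T.colWt_zero_add_cumWt j v
  have h2 := (T.bk j k).colWt_zero_add_cumWt j v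
  rw [cumWt_bk_of_ne hT hv', cumWt_bk_of_ne hT (by omega), colWt_bk le_rfl] at h2
  omega

/-- The counts of `k` and `k + 1` left of column `j` are exchanged, those from `j` on are kept. If
column `j` lies beyond the diagram the correction terms vanish; at a pivot they differ by the amount
that the staircase compensates. -/
theorem colWt_zero_bk_left (hT : ∀ i, (i, j) ∈ ν → T i j ≠ k) :
    (T.bk j k).colWt 0 k + T.colWt j (k + 1) = T.colWt 0 (k + 1) + T.colWt j k := by
  have h1 := T.colWt_zero_add_cumWt j (k + 1)
  have h2 := (T.bk j k).colWt_zero_add_cumWt j k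
  have h3 := cumWt_bk hT
  rw [cumWt_bk_of_ne hT (by omega), colWt_bk le_rfl] at h2
  rw [show k + 1 + 1 = k + 2 from rfl] at h1
  omega

theorem colWt_zero_bk_right (hT : ∀ i, (i, j) ∈ ν → T i j ≠ k) :
    (T.bk j k).colWt 0 (k + 1) + T.colWt j k = T.colWt 0 k + T.colWt j (k + 1) := by
  have h1 := T.colWt_zero_add_cumWt j k
  have h2 := (T.bk j k).colWt_zero_add_cumWt j (k + 1)
  have h3 := cumWt_bk hT
  rw [show k + 1 + 1 = k + 2 from rfl, cumWt_bk_of_ne hT (show k + 2 ≠ k + 1 by omega),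
    colWt_bk le_rfl] at h2
  omega

end

end SemistandardYoungTableau

/-! ### Alternants and the Littlewood-Richardson rule -/

open YoungDiagram

/-! ### Littlewood-Richardson tableaux and the first failure of the condition -/

namespace SemistandardYoungTableau

variable {ν : YoungDiagram}

theorem ext_of_mem {T T' : SemistandardYoungTableau ν} (h : ∀ i j, (i, j) ∈ ν → T i j = T' i j) :
    T = T' := by
  ext i j
  by_cases hij : (i, j) ∈ ν
  · exact h i j hij
  · rw [T.zeros hij, T'.zeros hij]

theorem finite_setOf_lt (N : ℕ) (ν : YoungDiagram) :
    {T : SemistandardYoungTableau ν | ∀ i j, (i, j) ∈ ν → T i j < N}.Finite := by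
  refine @Set.toFinite _ _ (Finite.of_injective (fun T (c : ν.cells) =>
    (⟨T.1 c.1.1 c.1.2, T.2 _ _ c.2⟩ : Fin N)) fun T T' h =>
      Subtype.ext (ext_of_mem fun i j hij => ?_))
  exact congrArg Fin.val (congrFun h ⟨(i, j), hij⟩)

/-- The tableaux of shape `ν` with entries less than `N`. -/
noncomputable def boundedTableaux (N : ℕ) (ν : YoungDiagram) :
    Finset (SemistandardYoungTableau ν) := (finite_setOf_lt N ν).toFinset

theorem mem_boundedTableaux {N : ℕ} {T : SemistandardYoungTableau ν} :
    T ∈ boundedTableaux N ν ↔ ∀ i j, (i, j) ∈ ν → T i j < N := by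
  rw [boundedTableaux, Set.Finite.mem_toFinset]
  rfl

theorem exists_of_colWt_ne_zero {T : SemistandardYoungTableau ν} {j v : ℕ}
    (h : T.colWt j v ≠ 0) : ∃ i c, (i, c) ∈ ν ∧ j ≤ c ∧ T i c = v := by
  obtain ⟨⟨i, c⟩, hc⟩ := Finset.card_ne_zero.1 h
  rw [Finset.mem_filter, YoungDiagram.mem_cells] at hc
  exact ⟨i, c, hc⟩

theorem colWt_ne_zero {T : SemistandardYoungTableau ν} {i j c : ℕ} (h : (i, c) ∈ ν)
    (hj : j ≤ c) : T.colWt j (T i c) ≠ 0 :=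
  Finset.card_ne_zero.2 ⟨(i, c), Finset.mem_filter.2 ⟨h, hj, rfl⟩⟩

theorem colWt_eq_zero_of_le {T : SemistandardYoungTableau ν} {j : ℕ} (hj : ν.rowLen 0 ≤ j)
    (v : ℕ) : T.colWt j v = 0 := by
  by_contra h
  obtain ⟨i, c, hmem, hc, -⟩ := exists_of_colWt_ne_zero h
  have h1 := mem_iff_lt_rowLen.1 hmem
  have h2 := ν.rowLen_anti 0 i (Nat.zero_le _)
  omega

theorem colWt_eq_zero_of_bounded {T : SemistandardYoungTableau ν} {N : ℕ}
    (hT : T ∈ boundedTableaux N ν) (j : ℕ) {v : ℕ} (hv : N ≤ v) : T.colWt j v = 0 := by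
  by_contra h
  obtain ⟨i, c, hmem, -, rfl⟩ := exists_of_colWt_ne_zero h
  have := mem_boundedTableaux.1 hT i c hmem
  omega

theorem colWt_succ_le (T : SemistandardYoungTableau ν) (j v : ℕ) :
    T.colWt (j + 1) v ≤ T.colWt j v :=
  Finset.card_le_card fun c hc => by
    rw [Finset.mem_filter] at hc ⊢
    exact ⟨hc.1, by omega, hc.2.2⟩

theorem colWt_of_mem {T : SemistandardYoungTableau ν} {i j : ℕ} (h : (i, j) ∈ ν) :
    T.colWt j (T i j) = T.colWt (j + 1) (T i j) + 1 := by
  rw [colWt, colWt, ← Finset.card_insert_of_notMem (a := (i, j))]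
  · congr 1
    ext ⟨i', c⟩
    simp only [Finset.mem_filter, Finset.mem_insert, Prod.mk.injEq, YoungDiagram.mem_cells]
    constructor
    · rintro ⟨hmem, hc, heq⟩
      rcases hc.eq_or_lt with rfl | hlt
      · refine Or.inl ⟨?_, rfl⟩
        rcases lt_trichotomy i' i with h' | h' | h'
        · have := T.col_strict h' h
          omega
        · exact h'
        · have := T.col_strict h' hmem
          omega
      · exact Or.inr ⟨hmem, hlt, heq⟩
    · rintro (⟨rfl, rfl⟩ | ⟨hmem, hc, heq⟩)
      · exact ⟨h, le_rfl, rfl⟩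
      · exact ⟨hmem, by omega, heq⟩
  · rw [Finset.mem_filter]
    rintro ⟨-, h', -⟩
    simp at h'

theorem colWt_of_notMem {T : SemistandardYoungTableau ν} {j v : ℕ}
    (h : ∀ i, (i, j) ∈ ν → T i j ≠ v) : T.colWt j v = T.colWt (j + 1) v := by
  rw [colWt, colWt]
  congr 1
  ext ⟨i, c⟩
  simp only [Finset.mem_filter, YoungDiagram.mem_cells]
  refine and_congr_right fun hmem => ?_
  constructor
  · rintro ⟨hc, heq⟩
    rcases hc.eq_or_lt with rfl | hlt
    · exact absurd heq (h i hmem)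
    · exact ⟨hlt, heq⟩
  · rintro ⟨hc, heq⟩
    exact ⟨by omega, heq⟩

theorem le_entry (T : SemistandardYoungTableau ν) {i j : ℕ} (h : (i, j) ∈ ν) : i ≤ T i j := by
  induction i with
  | zero => exact Nat.zero_le _
  | succ i ih =>
    have h1 := ih (ν.up_left_mem (Nat.le_succ i) le_rfl h)
    have h2 := T.col_strict (Nat.lt_add_one i) h
    omega

theorem colWt_of_eq_row {T : SemistandardYoungTableau ν} (hT : ∀ i j, (i, j) ∈ ν → T i j = i)
    (j v : ℕ) : T.colWt j v = ν.rowLen v - j := by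
  rw [colWt, ← Nat.card_Ico]
  refine Finset.card_bij' (fun c _ => c.2) (fun c _ => (v, c)) ?_ ?_ ?_ ?_
  · rintro ⟨i, c⟩ hc
    rw [Finset.mem_filter, YoungDiagram.mem_cells] at hc
    obtain ⟨h1, h2, h3⟩ := hc
    dsimp only at h2 h3
    rw [hT i c h1] at h3
    subst h3
    exact Finset.mem_Ico.2 ⟨h2, mem_iff_lt_rowLen.1 h1⟩
  · intro c hc
    rw [Finset.mem_Ico] at hc
    have hmem := mem_iff_lt_rowLen.2 hc.2
    exact Finset.mem_filter.2 ⟨hmem, hc.1, hT v c hmem⟩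
  · rintro ⟨i, c⟩ hc
    rw [Finset.mem_filter, YoungDiagram.mem_cells] at hc
    obtain ⟨h1, h2, h3⟩ := hc
    dsimp only at h3
    rw [hT i c h1] at h3
    exact Prod.ext h3.symm rfl
  · intro c _
    rfl

/-- The Littlewood-Richardson condition: adding the columns of `T` to `μ`, from the right to the
left, gives a partition at each step. -/
def Good (μ : YoungDiagram) (T : SemistandardYoungTableau ν) : Prop :=
  ∀ j, Antitone fun k => μ.rowLen k + T.colWt j k

theorem good_of_eq_row (μ : YoungDiagram) {T : SemistandardYoungTableau ν}
    (hT : ∀ i j, (i, j) ∈ ν → T i j = i) : T.Good μ := by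
  intro j k l hkl
  dsimp only
  rw [colWt_of_eq_row hT, colWt_of_eq_row hT]
  have := μ.rowLen_anti _ _ hkl
  have := ν.rowLen_anti _ _ hkl
  omega

/-- Induction on columns from the right and on rows from the top. At a first entry `T i j > i` the
number `T i j - 1` is missing from column `j`, so the condition requires it further right. There
entries equal their row index, which puts row `i` in column `j + 1` with entry `i < T i j`, against
the weak increase. -/
theorem eq_row_of_good_bot {T : SemistandardYoungTableau ν} (hT : T.Good ⊥) :
    ∀ i j, (i, j) ∈ ν → T i j = i := by
  have key : ∀ n j, ν.rowLen 0 ≤ j + n → ∀ i, (i, j) ∈ ν → T i j = i := by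
    intro n
    induction n with
    | zero =>
      intro j hj i hmem
      have h1 := mem_iff_lt_rowLen.1 hmem
      have h2 := ν.rowLen_anti 0 i (Nat.zero_le _)
      omega
    | succ n ih =>
      intro j hj i
      induction i using Nat.strong_induction_on with
      | _ i ihi =>
        intro hmem
        by_contra hne
        have hle := T.le_entry hmem
        obtain ⟨v, hv⟩ := Nat.exists_eq_add_of_le (show i + 1 ≤ T i j by omega)
        have h1 := colWt_of_mem (T := T) hmem
        have h2 : T.colWt j (i + v) = T.colWt (j + 1) (i + v) := by
          refine colWt_of_notMem fun i' hmem' heq => ?_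
          rcases lt_trichotomy i' i with h' | rfl | h'
          · have := ihi i' h' hmem'
            omega
          · omega
          · have := T.col_strict h' hmem'
            omega
        have h3 := hT j (show i + v ≤ T i j by omega)
        simp only [rowLen_bot, zero_add] at h3
        obtain ⟨i', c, hmem', hc, heq⟩ := exists_of_colWt_ne_zero
          (T := T) (j := j + 1) (v := i + v) (by omega)
        have h4 := ih c (by omega) i' hmem'
        have h5 : (i, j + 1) ∈ ν := ν.up_left_mem (by omega) hc hmem'
        have h6 := ih (j + 1) (by omega) i h5
        have h7 := T.row_weak (Nat.lt_add_one j) h5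
        omega
  exact fun i j => key (ν.rowLen 0) j (by omega) i

/-- Rows below `μ` must be filled without gaps: every value from `μ.colLen 0` up to an entry of `T`
occurs in `T`, and `T` has only `ν.cells.card` cells. -/
theorem Good.lt_of_mem {μ : YoungDiagram} {T : SemistandardYoungTableau ν} (hT : T.Good μ)
    {i j : ℕ} (h : (i, j) ∈ ν) : T i j < μ.colLen 0 + ν.cells.card := by
  classical
  by_contra! hge
  have hpos : ∀ v, μ.colLen 0 ≤ v → v ≤ T i j → T.colWt 0 v ≠ 0 := by
    intro v hv hv' h0
    have h1 := hT 0 hv'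
    have h2 := colWt_ne_zero (T := T) h (Nat.zero_le j)
    simp only [h0, rowLen_eq_zero_iff.2 hv] at h1
    omega
  have h1 : (Finset.Icc (μ.colLen 0) (T i j)).card ≤ ν.cells.card := by
    refine (Finset.card_le_card (t := ν.cells.image fun c => T c.1 c.2) fun v hv => ?_).trans
      Finset.card_image_le
    rw [Finset.mem_Icc] at hv
    obtain ⟨i', c, hmem, -, rfl⟩ := exists_of_colWt_ne_zero (hpos v hv.1 hv.2)
    exact Finset.mem_image.2 ⟨(i', c), hmem, rfl⟩
  rw [Nat.card_Icc] at h1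
  omega

/-- The partition obtained by adding the content of `T` to `μ`. -/
noncomputable def shape (μ : YoungDiagram) (T : SemistandardYoungTableau ν) : YoungDiagram :=
  ofFun fun k => μ.rowLen k + T.colWt 0 k

theorem Good.rowLen_shape {μ : YoungDiagram} {T : SemistandardYoungTableau ν} (hT : T.Good μ)
    (k : ℕ) : (T.shape μ).rowLen k = μ.rowLen k + T.colWt 0 k := by
  refine rowLen_ofFun (hT 0) (N := μ.colLen 0 + ν.cells.card) ?_ k
  rw [rowLen_eq_zero_iff.2 (Nat.le_add_right _ _), zero_add]
  refine colWt_eq_zero_of_bounded (N := μ.colLen 0 + ν.cells.card) ?_ 0 le_rfl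
  exact mem_boundedTableaux.2 fun i j h => hT.lt_of_mem h

open Classical in
/-- The Littlewood-Richardson tableaux of shape `ν` relative to `μ`. -/
noncomputable def littlewoodRichardson (μ ν : YoungDiagram) :
    Finset (SemistandardYoungTableau ν) :=
  (boundedTableaux (μ.colLen 0 + ν.cells.card) ν).filter fun T => T.Good μ

theorem mem_littlewoodRichardson {μ : YoungDiagram} {T : SemistandardYoungTableau ν} :
    T ∈ littlewoodRichardson μ ν ↔ T.Good μ := by
  classical
  rw [littlewoodRichardson, Finset.mem_filter, mem_boundedTableaux, and_iff_right_iff_imp]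
  exact fun hT i j h => hT.lt_of_mem h

/-- The place of the first failure of the Littlewood-Richardson condition. -/
def IsPivot (μ : YoungDiagram) (T : SemistandardYoungTableau ν) (p : ℕ × ℕ) : Prop :=
  μ.rowLen p.2 + T.colWt p.1 p.2 < μ.rowLen (p.2 + 1) + T.colWt p.1 (p.2 + 1) ∧
    (∀ j, p.1 < j → ∀ k, μ.rowLen (k + 1) + T.colWt j (k + 1) ≤ μ.rowLen k + T.colWt j k) ∧
    ∀ k < p.2, μ.rowLen (k + 1) + T.colWt p.1 (k + 1) ≤ μ.rowLen k + T.colWt p.1 k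

/-- Beyond column `ν.rowLen 0` nothing has been added to `μ`, so the columns with a failure are
bounded. The pivot takes the largest one and in it the least row. -/
theorem exists_isPivot {μ : YoungDiagram} {T : SemistandardYoungTableau ν} (hT : ¬ T.Good μ) :
    ∃ p, T.IsPivot μ p := by
  classical
  let P : ℕ → Prop := fun j =>
    ∃ k, μ.rowLen k + T.colWt j k < μ.rowLen (k + 1) + T.colWt j (k + 1)
  have hP : ∃ j, P j := by
    by_contra! h
    refine hT fun j => antitone_nat_of_succ_le fun k => ?_
    by_contra! hlt
    exact h j ⟨k, hlt⟩
  obtain ⟨j₀, hj₀⟩ := hP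
  have hbound : ∀ j, P j → j ≤ ν.rowLen 0 := by
    rintro j ⟨k, hk⟩
    by_contra! hlt
    rw [colWt_eq_zero_of_le hlt.le, colWt_eq_zero_of_le hlt.le] at hk
    have := μ.rowLen_anti k (k + 1) (Nat.le_succ k)
    omega
  have hj := Nat.findGreatest_spec (P := P) (hbound j₀ hj₀) hj₀
  refine ⟨(Nat.findGreatest P (ν.rowLen 0), Nat.find hj), Nat.find_spec hj, fun j hlt k => ?_,
    fun k hk => not_lt.1 (Nat.find_min hj hk)⟩
  by_contra! h
  exact absurd (Nat.le_findGreatest (hbound j ⟨k, h⟩) (P := P) ⟨k, h⟩) (not_le.2 hlt)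

theorem IsPivot.unique {μ : YoungDiagram} {T : SemistandardYoungTableau ν} {p q : ℕ × ℕ}
    (hp : T.IsPivot μ p) (hq : T.IsPivot μ q) : p = q := by
  have h1 : p.1 = q.1 := by
    rcases lt_trichotomy p.1 q.1 with h | h | h
    · exact absurd (hp.2.1 _ h q.2) (not_le.2 hq.1)
    · exact h
    · exact absurd (hq.2.1 _ h p.2) (not_le.2 hp.1)
  refine Prod.ext h1 ?_
  rcases lt_trichotomy p.2 q.2 with h | h | h
  · have h2 := hq.2.2 _ h
    rw [← h1] at h2
    exact absurd h2 (not_le.2 hp.1)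
  · exact h
  · have h2 := hp.2.2 _ h
    rw [h1] at h2
    exact absurd h2 (not_le.2 hq.1)

/-- An entry `k` in column `j` would offset the at most one new entry `k + 1`, and the condition
would already fail at column `j + 1`. -/
theorem IsPivot.ne {μ : YoungDiagram} {T : SemistandardYoungTableau ν} {j k : ℕ}
    (h : T.IsPivot μ (j, k)) : ∀ i, (i, j) ∈ ν → T i j ≠ k := by
  rintro i hmem rfl
  have h1 := h.1
  have h2 := h.2.1 (j + 1) (Nat.lt_succ_self j) (T i j)
  dsimp only at h1
  rw [colWt_of_mem hmem] at h1
  by_cases h3 : ∃ i', (i', j) ∈ ν ∧ T i' j = T i j + 1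
  · obtain ⟨i', hmem', heq⟩ := h3
    rw [← heq, colWt_of_mem hmem', heq] at h1
    omega
  · push Not at h3
    rw [colWt_of_notMem h3] at h1
    omega

theorem IsPivot.exists_entry {μ : YoungDiagram} {T : SemistandardYoungTableau ν} {j k : ℕ}
    (h : T.IsPivot μ (j, k)) : ∃ i, (i, j) ∈ ν ∧ T i j = k + 1 := by
  by_contra! h3
  have h1 := h.1
  have h2 := h.2.1 (j + 1) (Nat.lt_succ_self j) k
  dsimp only at h1
  rw [colWt_of_notMem h3] at h1
  have := T.colWt_succ_le j k
  omega

/-- One column adds at most one entry `k + 1`, so the first failure is by exactly `1`. After the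
staircase is added, the two exponents counted from column `j` on are equal. -/
theorem IsPivot.eq {μ : YoungDiagram} {T : SemistandardYoungTableau ν} {j k : ℕ}
    (h : T.IsPivot μ (j, k)) :
    μ.rowLen (k + 1) + T.colWt j (k + 1) = μ.rowLen k + T.colWt j k + 1 := by
  obtain ⟨i, hmem, heq⟩ := h.exists_entry
  have h1 := h.1
  have h2 := h.2.1 (j + 1) (Nat.lt_succ_self j) k
  have h3 := colWt_of_mem (T := T) hmem
  rw [heq] at h3
  dsimp only at h1
  have h4 := T.colWt_succ_le j k
  omega

theorem IsPivot.bk {μ : YoungDiagram} {T : SemistandardYoungTableau ν} {j k : ℕ}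
    (h : T.IsPivot μ (j, k)) : (T.bk j k).IsPivot μ (j, k) := by
  refine ⟨?_, fun j' hj' k' => ?_, fun k' hk' => ?_⟩
  · rw [colWt_bk le_rfl, colWt_bk le_rfl]
    exact h.1
  · rw [colWt_bk (le_of_lt hj'), colWt_bk (le_of_lt hj')]
    exact h.2.1 j' hj' k'
  · rw [colWt_bk le_rfl, colWt_bk le_rfl]
    exact h.2.2 k' hk'

theorem IsPivot.not_good {μ : YoungDiagram} {T : SemistandardYoungTableau ν} {p : ℕ × ℕ}
    (h : T.IsPivot μ p) : ¬ T.Good μ := fun hT =>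
  absurd (hT p.1 (Nat.le_succ p.2)) (not_le.2 h.1)

end SemistandardYoungTableau

/-! ### Alternants and Schur polynomials in finitely many variables -/

open YoungDiagram SemistandardYoungTableau MvPolynomial

/-- The alternant `∑ sgn(σ) x^{σ β}` in the variables `x₀, …, x_{N - 1}`. -/
noncomputable def alternant (N : ℕ) (β : ℕ → ℕ) : MvPolynomial ℕ ℤ :=
  Matrix.det (Matrix.of fun i j : Fin N => (X (i : ℕ) : MvPolynomial ℕ ℤ) ^ β j)

/-- The Schur polynomial in the variables `x₀, …, x_{N - 1}`. -/
noncomputable def schurPoly (N : ℕ) (ν : YoungDiagram) : MvPolynomial ℕ ℤ :=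
  ∑ T ∈ boundedTableaux N ν, ∏ i : Fin N, X (i : ℕ) ^ T.colWt 0 i

theorem alternant_eq_sum (N : ℕ) (β : ℕ → ℕ) : alternant N β =
    ∑ σ : Equiv.Perm (Fin N), (Equiv.Perm.sign σ : ℤ) •
      ∏ i : Fin N, (X (σ i : ℕ) : MvPolynomial ℕ ℤ) ^ β i := by
  rw [alternant, Matrix.det_apply]
  rfl

theorem alternant_swap {N k : ℕ} (hk : k + 1 < N) {β β' : ℕ → ℕ} (h1 : β' k = β (k + 1))
    (h2 : β' (k + 1) = β k) (h3 : ∀ i, i ≠ k → i ≠ k + 1 → β' i = β i) :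
    alternant N β' = - alternant N β := by
  let a : Fin N := ⟨k, by omega⟩
  let b : Fin N := ⟨k + 1, hk⟩
  have hab : a ≠ b := fun h => by
    have := congrArg Fin.val h
    simp [a, b] at this
  have : (Matrix.of fun i j : Fin N => (X (i : ℕ) : MvPolynomial ℕ ℤ) ^ β' j) =
      (Matrix.of fun i j : Fin N => (X (i : ℕ) : MvPolynomial ℕ ℤ) ^ β j).submatrix id
        (Equiv.swap a b) := by
    ext1 i j
    simp only [Matrix.of_apply, Matrix.submatrix_apply, id]
    congr 1
    by_cases hja : j = a
    · rw [hja, Equiv.swap_apply_left]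
      exact h1
    by_cases hjb : j = b
    · rw [hjb, Equiv.swap_apply_right]
      exact h2
    rw [Equiv.swap_apply_of_ne_of_ne hja hjb]
    exact h3 j (fun h => hja (Fin.ext h)) (fun h => hjb (Fin.ext h))
  rw [alternant, this, Matrix.det_permute', Equiv.Perm.sign_swap hab, alternant]
  simp

/-- This is the Vandermonde determinant up to the order of the columns. -/
theorem alternant_staircase_ne_zero (N : ℕ) : alternant N (fun i => N - 1 - i) ≠ 0 := by
  have : (Matrix.of fun i j : Fin N => (X (i : ℕ) : MvPolynomial ℕ ℤ) ^ (N - 1 - (j : ℕ))) =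
      (Matrix.vandermonde fun i : Fin N => (X (i : ℕ) : MvPolynomial ℕ ℤ)).submatrix id
        (Fin.revPerm) := by
    ext1 i j
    simp only [Matrix.of_apply, Matrix.submatrix_apply, id, Matrix.vandermonde_apply,
      Fin.revPerm_apply, Fin.val_rev]
    congr 1
    omega
  rw [alternant, this, Matrix.det_permute']
  refine mul_ne_zero ?_ (Matrix.det_vandermonde_ne_zero_iff.2
    ((X_injective).comp Fin.val_injective))
  rcases Int.units_eq_one_or (Equiv.Perm.sign (Fin.revPerm : Equiv.Perm (Fin N))) with h | h <;>
  simp [h]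

/-- The Schur polynomials are symmetric. -/
theorem sum_boundedTableaux_perm (N : ℕ) (ν : YoungDiagram) (σ : Equiv.Perm (Fin N)) :
    ∑ T ∈ boundedTableaux N ν, ∏ i : Fin N, (X (σ i : ℕ) : MvPolynomial ℕ ℤ) ^ T.colWt 0 i =
      schurPoly N ν := by
  obtain _ | n := N
  · rw [Subsingleton.elim σ 1]
    rfl
  have key : ∀ (σ : Equiv.Perm (Fin (n + 1))) (k : Fin n),
      ∑ T ∈ boundedTableaux (n + 1) ν, ∏ i : Fin (n + 1),
        (X ((σ * Equiv.swap k.castSucc k.succ) i : ℕ) : MvPolynomial ℕ ℤ) ^ T.colWt 0 i =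
      ∑ T ∈ boundedTableaux (n + 1) ν, ∏ i : Fin (n + 1),
        (X (σ i : ℕ) : MvPolynomial ℕ ℤ) ^ T.colWt 0 i := by
    intro σ k
    -- Column `ν.rowLen 0` is empty, so there the involution acts on the whole tableau and exchanges
    -- the numbers of entries `k` and `k + 1`.
    have hne : ∀ (T : SemistandardYoungTableau ν) (i : ℕ), (i, ν.rowLen 0) ∈ ν →
        T i (ν.rowLen 0) ≠ k := fun T i hmem => by
      have h1 := mem_iff_lt_rowLen.1 hmem
      have h2 := ν.rowLen_anti 0 i (Nat.zero_le _)
      omega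
    have hmem : ∀ T ∈ boundedTableaux (n + 1) ν,
        T.bk (ν.rowLen 0) k ∈ boundedTableaux (n + 1) ν := by
      intro T hT
      rw [mem_boundedTableaux] at hT ⊢
      exact fun i j hij => bk_lt (hne T) (by omega) (hT i j hij)
    refine Finset.sum_nbij' (fun T => T.bk (ν.rowLen 0) k) (fun T => T.bk (ν.rowLen 0) k)
      hmem hmem (fun T _ => bk_bk (hne T)) (fun T _ => bk_bk (hne T)) fun T _ => ?_
    rw [← Equiv.prod_comp (Equiv.swap k.castSucc k.succ)]
    refine Finset.prod_congr rfl fun i _ => ?_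
    rw [Equiv.Perm.mul_apply, Equiv.swap_apply_self]
    congr 1
    have h1 := colWt_zero_bk_left (hne T)
    have h2 := colWt_zero_bk_right (hne T)
    rw [colWt_eq_zero_of_le le_rfl, colWt_eq_zero_of_le le_rfl] at h1 h2
    by_cases hia : i = k.castSucc
    · rw [hia, Equiv.swap_apply_left, Fin.val_succ, Fin.val_castSucc]
      omega
    by_cases hib : i = k.succ
    · rw [hib, Equiv.swap_apply_right, Fin.val_succ, Fin.val_castSucc]
      omega
    rw [Equiv.swap_apply_of_ne_of_ne hia hib,
      colWt_zero_bk_of_ne (hne T) (fun h => hia (Fin.ext h)) (fun h => hib (Fin.ext h))]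
  have hσ : σ ∈ Submonoid.closure
      (Set.range fun i : Fin n => Equiv.swap i.castSucc i.succ) := by
    rw [Equiv.Perm.mclosure_swap_castSucc_succ]
    trivial
  induction hσ using Submonoid.closure_induction_right with
  | one => rfl
  | mul_right σ _ τ hτ ih =>
    obtain ⟨k, rfl⟩ := hτ
    rw [key, ih]

/-- By symmetry the Schur polynomial may be permuted by `σ` in the summand of `σ`. The product is
then a sum of alternants over tableaux. -/
theorem alternant_mul_schurPoly (N : ℕ) (β : ℕ → ℕ) (ν : YoungDiagram) :
    alternant N β * schurPoly N ν =
      ∑ T ∈ boundedTableaux N ν, alternant N (fun i => β i + T.colWt 0 i) := by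
  simp only [alternant_eq_sum]
  rw [Finset.sum_comm, Finset.sum_mul]
  refine Finset.sum_congr rfl fun σ _ => ?_
  rw [← sum_boundedTableaux_perm N ν σ, smul_mul_assoc, Finset.mul_sum, Finset.smul_sum]
  refine Finset.sum_congr rfl fun T _ => ?_
  rw [← Finset.prod_mul_distrib]
  simp only [pow_add]

open Classical in
-- A sign-reversing involution: the Bender-Knuth move on the columns left of the pivot. It leaves
-- the pivot in place, and it exchanges two neighbouring exponents of the alternant.
theorem sum_alternant_not_good (N : ℕ) (μ ν : YoungDiagram) :
    ∑ T ∈ (boundedTableaux N ν).filter (fun T => ¬ T.Good μ),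
      alternant N (fun i => μ.rowLen i + (N - 1 - i) + T.colWt 0 i) = 0 := by
  have hbad : ∀ T ∈ (boundedTableaux N ν).filter (fun T => ¬ T.Good μ), ∃ p, T.IsPivot μ p :=
    fun T hT => exists_isPivot (Finset.mem_filter.1 hT).2
  have hneg : ∀ T ∈ boundedTableaux N ν, ∀ p : ℕ × ℕ, T.IsPivot μ p →
      alternant N (fun i => μ.rowLen i + (N - 1 - i) + (T.bk p.1 p.2).colWt 0 i) =
        - alternant N (fun i => μ.rowLen i + (N - 1 - i) + T.colWt 0 i) := by
    rintro T hT ⟨j, k⟩ hp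
    obtain ⟨i, hmem, heq⟩ := hp.exists_entry
    have hk := mem_boundedTableaux.1 hT i j hmem
    have h1 := colWt_zero_bk_left hp.ne
    have h2 := colWt_zero_bk_right hp.ne
    have h3 := hp.eq
    -- The excess `1` at the pivot equals the difference of the staircase exponents at `k` and `k +
    -- 1`, so the total exponents are exchanged exactly.
    refine alternant_swap (k := k) (by omega) ?_ ?_ fun i hi hi' => ?_
    · dsimp only
      omega
    · dsimp only
      omega
    · dsimp only
      rw [colWt_zero_bk_of_ne hp.ne hi hi']
  refine Finset.sum_involution
    (fun T hT => T.bk (hbad T hT).choose.1 (hbad T hT).choose.2) ?_ ?_ ?_ ?_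
  · intro T hT
    rw [hneg T (Finset.mem_filter.1 hT).1 _ (hbad T hT).choose_spec, add_neg_cancel]
  -- A fixed tableau would have an alternant equal to its negative, hence zero.
  · intro T hT hne heq
    have := hneg T (Finset.mem_filter.1 hT).1 _ (hbad T hT).choose_spec
    rw [heq] at this
    exact hne (self_eq_neg.1 this)
  · intro T hT
    have hp := (hbad T hT).choose_spec
    rw [Finset.mem_filter] at hT ⊢
    refine ⟨mem_boundedTableaux.2 fun i j hij => ?_, hp.bk.not_good⟩
    obtain ⟨i', hmem, heq⟩ := hp.exists_entry
    have := mem_boundedTableaux.1 hT.1 i' _ hmem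
    exact bk_lt hp.ne (by omega) (mem_boundedTableaux.1 hT.1 i j hij)
  · intro T hT
    have hp := (hbad T hT).choose_spec
    have hq := hp.bk
    generalize_proofs h1 h2
    rw [← h2.choose_spec.unique hq |>.symm]
    exact bk_bk hp.ne

open Classical in
theorem alternant_mul_schurPoly_eq_sum_good (N : ℕ) (μ ν : YoungDiagram) :
    alternant N (fun i => μ.rowLen i + (N - 1 - i)) * schurPoly N ν =
      ∑ T ∈ (boundedTableaux N ν).filter (fun T => T.Good μ),
        alternant N (fun i => μ.rowLen i + T.colWt 0 i + (N - 1 - i)) := by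
  rw [alternant_mul_schurPoly, ← Finset.sum_filter_add_sum_filter_not _ (fun T => T.Good μ),
    sum_alternant_not_good, add_zero]
  simp only [add_right_comm]

/-- The bialternant formula is the case `μ = ⊥`, in which only the highest weight tableau is good.
-/
theorem alternant_staircase_mul_schurPoly {N : ℕ} {ν : YoungDiagram} (hN : ν.colLen 0 ≤ N) :
    alternant N (fun i => N - 1 - i) * schurPoly N ν =
      alternant N (fun i => ν.rowLen i + (N - 1 - i)) := by
  classical
  have h := alternant_mul_schurPoly_eq_sum_good N ⊥ ν
  simp only [rowLen_bot, zero_add] at h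
  rw [h]
  have hT : ∀ i j, (i, j) ∈ ν → highestWeight ν i j = i := fun i j hij => by
    rw [highestWeight_apply, if_pos hij]
  have : (boundedTableaux N ν).filter (fun T => T.Good ⊥) = {highestWeight ν} := by
    ext T
    rw [Finset.mem_filter, Finset.mem_singleton]
    constructor
    · rintro ⟨-, hgood⟩
      exact ext_of_mem fun i j hij => by rw [eq_row_of_good_bot hgood i j hij, hT i j hij]
    · rintro rfl
      refine ⟨mem_boundedTableaux.2 fun i j hij => ?_, good_of_eq_row ⊥ hT⟩
      rw [hT i j hij]
      have h1 := mem_iff_lt_colLen.1 hij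
      have h2 := ν.colLen_anti 0 j (Nat.zero_le _)
      omega
  rw [this, Finset.sum_singleton]
  simp only [colWt_of_eq_row hT, Nat.sub_zero]

/-- The Littlewood-Richardson rule in finitely many variables. -/
theorem schurPoly_mul {N : ℕ} {μ ν : YoungDiagram} (hN : μ.colLen 0 + ν.cells.card ≤ N) :
    schurPoly N μ * schurPoly N ν =
      ∑ T ∈ littlewoodRichardson μ ν, schurPoly N (T.shape μ) := by
  classical
  -- Both sides are compared after multiplication by the Vandermonde determinant. The bound on `N`
  -- makes room for all good tableaux.
  refine mul_left_cancel₀ (alternant_staircase_ne_zero N) ?_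
  rw [← mul_assoc, alternant_staircase_mul_schurPoly (by omega),
    alternant_mul_schurPoly_eq_sum_good, Finset.mul_sum]
  refine Finset.sum_congr ?_ fun T hT => ?_
  · ext T
    rw [Finset.mem_filter, mem_littlewoodRichardson, mem_boundedTableaux, and_iff_right_iff_imp]
    exact fun hT i j h => (hT.lt_of_mem h).trans_le hN
  · rw [mem_littlewoodRichardson] at hT
    have hcol : (T.shape μ).colLen 0 ≤ N := by
      rw [← rowLen_eq_zero_iff, hT.rowLen_shape, rowLen_eq_zero_iff.2 (by omega),
        colWt_eq_zero_of_bounded (N := N) (mem_boundedTableaux.2 fun i j h =>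
          (hT.lt_of_mem h).trans_le hN) 0 le_rfl]
    rw [alternant_staircase_mul_schurPoly hcol]
    simp only [hT.rowLen_shape]

theorem prod_X_pow_eq_monomial (N : ℕ) (w : ℕ → ℕ) :
    ∏ i : Fin N, (X (i : ℕ) : MvPolynomial ℕ ℤ) ^ w i =
      monomial (∑ i : Fin N, Finsupp.single (i : ℕ) (w i)) 1 := by
  rw [monomial_sum_one]
  exact Finset.prod_congr rfl fun i _ => X_pow_eq_monomial

theorem sum_single_apply (N : ℕ) (w : ℕ → ℕ) (j : ℕ) :
    (∑ i : Fin N, Finsupp.single (i : ℕ) (w i)) j = if j < N then w j else 0 := by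
  rw [Finsupp.finsetSum_apply]
  split_ifs with h
  · rw [Finset.sum_eq_single (⟨j, h⟩ : Fin N)]
    · simp
    · intro i _ hi
      exact Finsupp.single_eq_of_ne fun hij => hi (Fin.ext hij.symm)
    · simp
  · refine Finset.sum_eq_zero fun i _ => Finsupp.single_eq_of_ne ?_
    omega

open Classical in
-- The Schur polynomial is the Schur function with the variables from `x_N` on set to `0`.
theorem coeff_schurPoly (N : ℕ) (ν : YoungDiagram) (α : ℕ →₀ ℕ) :
    coeff α (schurPoly N ν) =
      if ∀ i, N ≤ i → α i = 0 then MvPowerSeries.coeff α (schurFunction ν) else 0 := by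
  have hcoeff : ∀ T : SemistandardYoungTableau ν, T ∈ boundedTableaux N ν →
      ((∑ i : Fin N, Finsupp.single (i : ℕ) (T.colWt 0 i)) = α ↔ ∀ i, T.colWt 0 i = α i) := by
    intro T hT
    rw [DFunLike.ext_iff]
    refine forall_congr' fun i => ?_
    rw [sum_single_apply]
    split_ifs with h
    · rfl
    · rw [colWt_eq_zero_of_bounded hT 0 (not_lt.1 h)]
  rw [schurPoly, coeff_sum]
  simp only [prod_X_pow_eq_monomial, coeff_monomial]
  rw [Finset.sum_boole, Finset.filter_congr hcoeff]
  split_ifs with hα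
  · show _ = ((Nat.card {T : SemistandardYoungTableau ν //
      ∀ i, (ν.cells.filter fun c => T c.1 c.2 = i).card = α i} : ℕ) : ℤ)
    rw [Nat.cast_inj]
    refine (Nat.subtype_card _ fun T => ?_).symm
    have hw : ∀ i, (ν.cells.filter fun c => T c.1 c.2 = i).card = T.colWt 0 i := fun i => by
      rw [colWt]
      simp only [Nat.zero_le, true_and]
    simp only [hw, Finset.mem_filter, and_iff_right_iff_imp]
    refine fun h => mem_boundedTableaux.2 fun i j hij => ?_
    by_contra! hlt
    have h1 := colWt_ne_zero (T := T) hij (Nat.zero_le j)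
    rw [h, hα _ hlt] at h1
    exact h1 rfl
  · rw [Finset.card_eq_zero.2, Nat.cast_zero]
    refine Finset.filter_eq_empty_iff.2 fun T hT h => hα fun i hi => ?_
    rw [← h i, colWt_eq_zero_of_bounded hT 0 hi]

/-- The Littlewood-Richardson rule. -/
theorem schurFunction_mul (μ ν : YoungDiagram) : schurFunction μ * schurFunction ν =
    ∑ T ∈ littlewoodRichardson μ ν, schurFunction (T.shape μ) := by
  classical
  ext α
  let N := max (μ.colLen 0 + ν.cells.card) (α.support.sup id + 1)
  have hα : ∀ i, N ≤ i → α i = 0 := by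
    intro i hi
    by_contra h
    have h1 := Finset.le_sup (f := id) (Finsupp.mem_support_iff.2 h)
    have h2 := (le_max_right _ _).trans hi
    simp only [id] at h1
    omega
  have hle : ∀ β : ℕ →₀ ℕ, β ≤ α → ∀ ν, MvPowerSeries.coeff β (schurFunction ν) =
      coeff β (schurPoly N ν) := by
    intro β hβ ν
    rw [coeff_schurPoly, if_pos fun i hi => Nat.le_zero.1 ((hβ i).trans (hα i hi).le)]
  have h := congrArg (coeff α) (schurPoly_mul (N := N) (μ := μ) (ν := ν) (le_max_left _ _))
  rw [coeff_sum, coeff_mul] at h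
  rw [MvPowerSeries.coeff_mul, map_sum]
  simp only [hle α le_rfl, ← h]
  refine Finset.sum_congr rfl fun p hp => ?_
  rw [Finset.HasAntidiagonal.mem_antidiagonal] at hp
  rw [hle _ (hp ▸ le_self_add), hle _ (hp ▸ le_add_self)]

open Classical in
-- Two strictly decreasing sequences that differ by a permutation are equal, and the permutation,
-- being strictly monotone, is the identity. So only one term of the determinant can contribute.
theorem coeff_alternant {N : ℕ} {β γ : ℕ → ℕ} (hβ : ∀ i j, i < j → j < N → β j < β i)
    (hγ : ∀ i j, i < j → j < N → γ j < γ i) :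
    coeff (∑ i : Fin N, Finsupp.single (i : ℕ) (γ i)) (alternant N β) =
      if ∀ i < N, β i = γ i then 1 else 0 := by
  have hσ : ∀ σ : Equiv.Perm (Fin N),
      ∏ i : Fin N, (X (σ i : ℕ) : MvPolynomial ℕ ℤ) ^ β i =
        monomial (∑ i : Fin N, Finsupp.single (σ i : ℕ) (β i)) 1 := fun σ => by
    rw [monomial_sum_one]
    exact Finset.prod_congr rfl fun i _ => X_pow_eq_monomial
  have happly : ∀ (σ : Equiv.Perm (Fin N)) (w : ℕ → ℕ) (j : Fin N),
      (∑ i : Fin N, Finsupp.single (σ i : ℕ) (w i)) (σ j : ℕ) = w j := by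
    intro σ w j
    rw [Finsupp.finsetSum_apply, Finset.sum_eq_single j]
    · simp
    · intro i _ hi
      exact Finsupp.single_eq_of_ne fun hij => hi (σ.injective (Fin.ext hij.symm))
    · simp
  have heq : ∀ σ : Equiv.Perm (Fin N),
      ∑ i : Fin N, Finsupp.single (σ i : ℕ) (β i) = ∑ i : Fin N, Finsupp.single (i : ℕ) (γ i) →
      σ = 1 := by
    intro σ h
    have h1 : ∀ j : Fin N, β j = γ (σ j) := fun j => by
      have h2 := happly 1 γ (σ j)
      rw [← happly σ β j, h]
      exact h2
    have hmono : StrictMono σ := by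
      intro i j hij
      by_contra! hle
      rcases hle.eq_or_lt with h2 | h2
      · exact hij.ne' (σ.injective h2)
      · have h3 := hγ _ _ (Fin.lt_def.1 h2) (σ i).2
        have h4 := hβ _ _ (Fin.lt_def.1 hij) j.2
        rw [h1, h1] at h4
        omega
    have : (hmono.orderIsoOfSurjective _ σ.surjective) = OrderIso.refl _ := Subsingleton.elim _ _
    ext1 i
    exact DFunLike.congr_fun this i
  rw [alternant_eq_sum, coeff_sum, Finset.sum_eq_single 1]
  · rw [coeff_smul, hσ, coeff_monomial]
    simp only [Equiv.Perm.sign_one, Units.val_one, one_smul]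
    refine if_congr ⟨fun h i hi => ?_, fun h => ?_⟩ rfl rfl
    · have h1 := happly 1 β ⟨i, hi⟩
      rw [h] at h1
      exact h1.symm.trans (happly 1 γ ⟨i, hi⟩)
    · exact Finset.sum_congr rfl fun i _ => by rw [h i i.2]; rfl
  · intro σ _ hne
    rw [coeff_smul, hσ, coeff_monomial, if_neg fun h => hne (heq σ h), smul_zero]
  · simp

/-- The Schur functions are linearly independent. -/
theorem linearIndependent_schurFunction : LinearIndependent ℤ schurFunction := by
  classical
  rw [linearIndependent_iff']
  intro s g hg κ hκ
  let N := s.sup fun μ => μ.colLen 0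
  have hN : ∀ μ ∈ s, μ.colLen 0 ≤ N := fun μ hμ => Finset.le_sup (f := fun μ => μ.colLen 0) hμ
  have h1 : ∑ μ ∈ s, g μ • schurPoly N μ = 0 := by
    ext α
    rw [coeff_sum, coeff_zero]
    simp only [coeff_smul, coeff_schurPoly]
    split_ifs with h
    · have := congrArg (MvPowerSeries.coeff α) hg
      rw [map_sum, map_zero] at this
      simpa only [map_zsmul] using this
    · simp
  -- Multiplication by the Vandermonde determinant turns the relation into one between alternants
  -- with distinct leading exponents.
  have h2 : ∑ μ ∈ s, g μ • alternant N (fun i => μ.rowLen i + (N - 1 - i)) = 0 := by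
    have h3 := congrArg (alternant N (fun i => N - 1 - i) * ·) h1
    simp only [Finset.mul_sum, mul_smul_comm, mul_zero] at h3
    rw [← h3]
    exact Finset.sum_congr rfl fun μ hμ => by rw [alternant_staircase_mul_schurPoly (hN μ hμ)]
  have hanti : ∀ μ : YoungDiagram, ∀ i j, i < j → j < N →
      μ.rowLen j + (N - 1 - j) < μ.rowLen i + (N - 1 - i) := fun μ i j hij hj => by
    have := μ.rowLen_anti i j hij.le
    omega
  have h3 := congrArg
    (coeff (∑ i : Fin N, Finsupp.single (i : ℕ) (κ.rowLen i + (N - 1 - i)))) h2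
  rw [coeff_sum, coeff_zero, Finset.sum_eq_single κ] at h3
  · rwa [coeff_smul, coeff_alternant (γ := fun i => κ.rowLen i + (N - 1 - i)) (hanti κ) (hanti κ),
      if_pos fun _ _ => rfl, smul_eq_mul, mul_one] at h3
  · intro μ hμ hne
    rw [coeff_smul, coeff_alternant (γ := fun i => κ.rowLen i + (N - 1 - i)) (hanti μ) (hanti κ),
      if_neg, smul_zero]
    intro h
    refine hne (ext_rowLen fun i => ?_)
    by_cases hi : i < N
    · have := h i hi
      omega
    · rw [rowLen_eq_zero_iff.2 ((hN μ hμ).trans (not_lt.1 hi)),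
        rowLen_eq_zero_iff.2 ((hN κ hκ).trans (not_lt.1 hi))]
  · exact fun h => absurd hκ h

open YoungDiagram SemistandardYoungTableau

/-! ### The Schur basis of `Λ^Sch` -/

namespace LambdaSch

/-- By the Littlewood-Richardson rule `s_⊥` is idempotent; being nonzero in a domain, it is `1`. -/
theorem schurFunction_bot : schurFunction ⊥ = 1 := by
  classical
  have h : schurFunction ⊥ * schurFunction ⊥ = schurFunction ⊥ := by
    rw [schurFunction_mul]
    have hmem : ∀ c : ℕ × ℕ, c ∉ (⊥ : YoungDiagram) := fun c => notMem_bot c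
    have hgood : ∀ T : SemistandardYoungTableau ⊥, T.Good ⊥ := fun T =>
      good_of_eq_row ⊥ fun i j h => absurd h (hmem _)
    have hLR : littlewoodRichardson ⊥ ⊥ = {highestWeight ⊥} := by
      ext T
      rw [mem_littlewoodRichardson, Finset.mem_singleton]
      exact ⟨fun _ => ext_of_mem fun i j h => absurd h (hmem _), fun _ => hgood T⟩
    rw [hLR, Finset.sum_singleton]
    congr 1
    rw [eq_bot_iff_rowLen_zero, (hgood _).rowLen_shape, rowLen_bot,
      colWt_eq_zero_of_le (by rw [rowLen_bot])]
  have hne : schurFunction ⊥ ≠ 0 := linearIndependent_schurFunction.ne_zero ⊥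
  exact mul_left_cancel₀ hne (by rw [h, mul_one])

theorem mem_span_of_mem {x : MvPowerSeries ℕ ℤ} (hx : x ∈ LambdaSch) :
    x ∈ Submodule.span ℕ (Set.range schurFunction) := by
  induction hx using Subsemiring.closure_induction with
  | mem x hx => exact Submodule.subset_span hx
  | zero => exact zero_mem _
  | one => exact schurFunction_bot ▸ Submodule.subset_span (Set.mem_range_self _)
  | add x y _ _ hx hy => exact add_mem hx hy
  | mul x y hx' hy' hx hy =>
    clear hx' hy'
    induction hx using Submodule.span_induction with
    | zero => rw [zero_mul]; exact zero_mem _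
    | add x x' _ _ hx hx' => rw [add_mul]; exact add_mem hx hx'
    | smul a x _ hx => rw [smul_mul_assoc]; exact Submodule.smul_mem _ a hx
    | mem x hx =>
      obtain ⟨μ, rfl⟩ := hx
      induction hy using Submodule.span_induction with
      | zero => rw [mul_zero]; exact zero_mem _
      | add y y' _ _ hy hy' => rw [mul_add]; exact add_mem hy hy'
      | smul a y _ hy => rw [mul_smul_comm]; exact Submodule.smul_mem _ a hy
      | mem y hy =>
        obtain ⟨ν, rfl⟩ := hy
        rw [schurFunction_mul]
        exact sum_mem fun T _ => Submodule.subset_span (Set.mem_range_self _)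

/-- The Schur functions form a basis of `Λ^Sch`. -/
noncomputable def basis : Module.Basis YoungDiagram ℕ LambdaSch :=
  Module.Basis.mk (v := s)
    (LinearIndependent.of_comp (LambdaSch.subtype : LambdaSch →+ MvPowerSeries ℕ ℤ).toNatLinearMap
      (linearIndependent_schurFunction.restrict_scalars (R := ℕ) (fun a b h => by simpa using h)))
    (by
      rintro ⟨x, hx⟩ -
      obtain ⟨c, rfl⟩ := (Finsupp.mem_span_range_iff_exists_finsupp).1 (mem_span_of_mem hx)
      have : (⟨_, hx⟩ : LambdaSch) = c.sum fun μ a => a • s μ := by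
        apply Subtype.ext
        show _ = LambdaSch.subtype _
        simp only [Finsupp.sum, map_sum, map_nsmul]
        rfl
      rw [this]
      exact Submodule.sum_mem _ fun μ _ =>
        Submodule.smul_mem _ _ (Submodule.subset_span (Set.mem_range_self μ)))

theorem basis_apply (μ : YoungDiagram) : basis μ = s μ := Module.Basis.mk_apply _ _ μ

theorem basis_bot : basis ⊥ = 1 := by
  rw [basis_apply]
  exact Subtype.ext schurFunction_bot

theorem basis_mul (μ ν : YoungDiagram) :
    basis μ * basis ν = ∑ T ∈ littlewoodRichardson μ ν, basis (T.shape μ) := by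
  simp only [basis_apply]
  apply Subtype.ext
  rw [Subsemiring.coe_mul]
  show _ = LambdaSch.subtype _
  rw [map_sum]
  exact schurFunction_mul μ ν

theorem repr_mul_ne_zero_iff {μ ν κ : YoungDiagram} :
    basis.repr (basis μ * basis ν) κ ≠ 0 ↔
      ∃ T : SemistandardYoungTableau ν, T.Good μ ∧ T.shape μ = κ := by
  classical
  rw [basis_mul, map_sum, Finsupp.finsetSum_apply, ne_eq, Finset.sum_eq_zero_iff]
  push Not
  simp only [mem_littlewoodRichardson, Module.Basis.repr_self, Finsupp.single_apply, ne_eq,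
    ite_eq_right_iff, one_ne_zero, imp_false, not_not]

theorem le_of_repr_mul_ne_zero (μ ν κ : YoungDiagram)
    (h : basis.repr (basis μ * basis ν) κ ≠ 0) : μ ≤ κ := by
  obtain ⟨T, hT, rfl⟩ := repr_mul_ne_zero_iff.1 h
  refine le_iff_rowLen.2 fun i => ?_
  rw [hT.rowLen_shape]
  exact Nat.le_add_right _ _

end LambdaSch

/-! ### The Pieri rules -/

/-- The weakly increasing sequence with `w v` terms equal to `v`: its term at `c` counts the values
used up by then. -/
theorem exists_sorted (w : ℕ → ℕ) (N : ℕ) :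
    ∃ t : ℕ → ℕ, ∀ c < ∑ v ∈ Finset.range N, w v, ∀ v,
      t c < v ↔ c < ∑ u ∈ Finset.range v, w u := by
  classical
  have hmono : ∀ a b, a ≤ b → ∑ u ∈ Finset.range a, w u ≤ ∑ u ∈ Finset.range b, w u := fun a b h =>
    Finset.sum_le_sum_of_subset (Finset.range_mono h)
  refine ⟨fun c => ((Finset.range N).filter fun v =>
    ∑ u ∈ Finset.range (v + 1), w u ≤ c).card, fun c hc v => ?_⟩
  have key : ∀ v, v < ((Finset.range N).filter fun v =>
      ∑ u ∈ Finset.range (v + 1), w u ≤ c).card ↔ v < N ∧ ∑ u ∈ Finset.range (v + 1), w u ≤ c :=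
    fun v => Finset.lt_card_filter_range fun a b hab _ h => (hmono _ _ (by omega)).trans h
  cases v with
  | zero => simp
  | succ v =>
    rw [Nat.lt_succ_iff, ← not_lt, key, not_and]
    constructor
    · intro h
      by_cases hv : v < N
      · exact not_le.1 (h hv)
      · exact hc.trans_le (hmono _ _ (by omega))
    · exact fun h _ => not_le.2 h

theorem lt_iff_lt_sum_card {t : ℕ → ℕ} {k : ℕ} (ht : ∀ a b, a ≤ b → b < k → t a ≤ t b)
    {c : ℕ} (hc : c < k) (v : ℕ) :
    t c < v ↔ c < ∑ u ∈ Finset.range v, ((Finset.range k).filter fun c => t c = u).card := by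
  have h : ∑ u ∈ Finset.range v, ((Finset.range k).filter fun c => t c = u).card =
      ((Finset.range k).filter fun c => t c < v).card := by
    rw [Finset.card_eq_sum_card_fiberwise (f := t) (t := Finset.range v)]
    · refine Finset.sum_congr rfl fun u hu => ?_
      rw [Finset.filter_filter]
      congr 1
      refine Finset.filter_congr fun c _ => ?_
      rw [Finset.mem_range] at hu
      omega
    · intro c hc
      simpa using (Finset.mem_filter.1 hc).2
  rw [h, Finset.lt_card_filter_range fun a b hab hb hlt => (ht a b hab hb).trans_lt hlt,
    and_iff_right hc]

theorem card_filter_eq_of_lt_iff {t w : ℕ → ℕ} {k : ℕ}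
    (ht : ∀ c < k, ∀ v, t c < v ↔ c < ∑ u ∈ Finset.range v, w u)
    (hk : ∀ v, ∑ u ∈ Finset.range v, w u ≤ k) (v : ℕ) :
    ((Finset.range k).filter fun c => t c = v).card = w v := by
  have : (Finset.range k).filter (fun c => t c = v) =
      Finset.Ico (∑ u ∈ Finset.range v, w u) (∑ u ∈ Finset.range (v + 1), w u) := by
    ext c
    rw [Finset.mem_filter, Finset.mem_range, Finset.mem_Ico]
    constructor
    · rintro ⟨hc, heq⟩
      have h1 := ht c hc v
      have h2 := ht c hc (v + 1)
      omega
    · rintro ⟨h1, h2⟩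
      have hc : c < k := h2.trans_le (hk _)
      have h3 := ht c hc v
      have h4 := ht c hc (v + 1)
      exact ⟨hc, by omega⟩
  rw [this, Nat.card_Ico, Finset.sum_range_succ]
  omega

namespace SemistandardYoungTableau

theorem colWt_row {k : ℕ} (T : SemistandardYoungTableau (rect 1 k)) (v : ℕ) :
    T.colWt 0 v = ((Finset.range k).filter fun c => T 0 c = v).card := by
  refine Finset.card_bij' (fun c _ => c.2) (fun c _ => (0, c)) ?_ ?_ ?_ ?_
  · rintro ⟨i, c⟩ hc
    simp only [Finset.mem_filter, mem_cells, mem_rect, Finset.mem_range] at hc ⊢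
    obtain ⟨⟨h1, h2⟩, -, h3⟩ := hc
    obtain rfl : i = 0 := by omega
    exact ⟨h2, h3⟩
  · intro c hc
    simp only [Finset.mem_filter, mem_cells, mem_rect, Finset.mem_range] at hc ⊢
    exact ⟨⟨Nat.one_pos, hc.1⟩, Nat.zero_le _, hc.2⟩
  · rintro ⟨i, c⟩ hc
    simp only [Finset.mem_filter, mem_cells, mem_rect] at hc
    exact Prod.ext (show 0 = i by omega) rfl
  · intro c _
    rfl

theorem colWt_column {k : ℕ} (T : SemistandardYoungTableau (rect k 1)) (v : ℕ) :
    T.colWt 0 v = ((Finset.range k).filter fun i => T i 0 = v).card := by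
  refine Finset.card_bij' (fun c _ => c.1) (fun i _ => (i, 0)) ?_ ?_ ?_ ?_
  · rintro ⟨i, c⟩ hc
    simp only [Finset.mem_filter, mem_cells, mem_rect, Finset.mem_range] at hc ⊢
    obtain ⟨⟨h1, h2⟩, -, h3⟩ := hc
    obtain rfl : c = 0 := by omega
    exact ⟨h1, h3⟩
  · intro c hc
    simp only [Finset.mem_filter, mem_cells, mem_rect, Finset.mem_range] at hc ⊢
    exact ⟨⟨hc.1, Nat.one_pos⟩, Nat.zero_le _, hc.2⟩
  · rintro ⟨i, c⟩ hc
    simp only [Finset.mem_filter, mem_cells, mem_rect] at hc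
    exact Prod.ext rfl (show 0 = c by omega)
  · intro c _
    rfl

theorem row_ext {k : ℕ} {T T' : SemistandardYoungTableau (rect 1 k)}
    (h : ∀ v, T.colWt 0 v = T'.colWt 0 v) : T = T' := by
  refine ext_of_mem fun i c hmem => ?_
  have hc := mem_rect.1 hmem
  obtain rfl : i = 0 := by have := hc.1; omega
  have hmono : ∀ T : SemistandardYoungTableau (rect 1 k), ∀ a b, a ≤ b → b < k → T 0 a ≤ T 0 b :=
    fun T a b hab hb => T.row_weak_of_le hab (mem_rect.2 ⟨Nat.one_pos, hb⟩)
  refine eq_of_forall_gt_iff fun v => ?_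
  rw [lt_iff_lt_sum_card (hmono T) hc.2, lt_iff_lt_sum_card (hmono T') hc.2]
  simp only [← colWt_row, h]

theorem column_ext {k : ℕ} {T T' : SemistandardYoungTableau (rect k 1)}
    (h : ∀ v, T.colWt 0 v = T'.colWt 0 v) : T = T' := by
  refine ext_of_mem fun i c hmem => ?_
  have hc := mem_rect.1 hmem
  obtain rfl : c = 0 := by have := hc.2; omega
  have hmono : ∀ T : SemistandardYoungTableau (rect k 1), ∀ a b, a ≤ b → b < k → T a 0 ≤ T b 0 :=
    fun T a b hab hb => T.col_weak hab (mem_rect.2 ⟨hb, Nat.one_pos⟩)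
  refine eq_of_forall_gt_iff fun v => ?_
  rw [lt_iff_lt_sum_card (hmono T) hc.1, lt_iff_lt_sum_card (hmono T') hc.1]
  simp only [← colWt_column, h]

theorem exists_row {w : ℕ → ℕ} {N k : ℕ} (hw : ∀ v, N ≤ v → w v = 0)
    (hk : ∑ v ∈ Finset.range N, w v = k) :
    ∃ T : SemistandardYoungTableau (rect 1 k), ∀ v, T.colWt 0 v = w v := by
  obtain ⟨t, ht⟩ := exists_sorted w N
  rw [hk] at ht
  have hk' : ∀ v, ∑ u ∈ Finset.range v, w u ≤ k := fun v => by
    by_contra! hlt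
    have h1 : ∑ u ∈ Finset.range v, w u ≤ ∑ u ∈ Finset.range (max v N), w u :=
      Finset.sum_le_sum_of_subset (Finset.range_mono (le_max_left _ _))
    have h2 : ∑ u ∈ Finset.range N, w u = ∑ u ∈ Finset.range (max v N), w u :=
      Finset.sum_subset (Finset.range_mono (le_max_right _ _)) fun u _ hu =>
        hw u (by simpa using hu)
    omega
  have hmono : ∀ a b, a ≤ b → b < k → t a ≤ t b := fun a b hab hb => by
    have h1 := (ht b hb (t b + 1)).1 (Nat.lt_succ_self _)
    have h2 := (ht a (hab.trans_lt hb) (t b + 1)).2 (hab.trans_lt h1)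
    omega
  let T : SemistandardYoungTableau (rect 1 k) :=
    { entry := fun i c => if i = 0 ∧ c < k then t c else 0
      row_weak' := fun {i a b} hab hmem => by
        have hb := mem_rect.1 hmem
        dsimp only at hb
        rw [if_pos ⟨by omega, by omega⟩, if_pos ⟨by omega, by omega⟩]
        exact hmono a b hab.le hb.2
      col_strict' := fun {a b c} hab hmem => by
        have hb := (mem_rect.1 hmem).1
        dsimp only at hb
        omega
      zeros' := fun {i c} hmem => if_neg fun h => hmem (mem_rect.2 ⟨by dsimp only; omega, h.2⟩) }
  refine ⟨T, fun v => ?_⟩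
  rw [colWt_row, ← card_filter_eq_of_lt_iff ht hk' v]
  congr 1
  refine Finset.filter_congr fun c hc => ?_
  show (if 0 = 0 ∧ c < k then t c else 0) = v ↔ _
  rw [if_pos ⟨rfl, Finset.mem_range.1 hc⟩]

/-- The content is sorted in a row and the row is stood upright; multiplicities at most `1` make it
strict. -/
theorem exists_column {w : ℕ → ℕ} {N k : ℕ} (hw : ∀ v, N ≤ v → w v = 0) (hw1 : ∀ v, w v ≤ 1)
    (hk : ∑ v ∈ Finset.range N, w v = k) :
    ∃ T : SemistandardYoungTableau (rect k 1), ∀ v, T.colWt 0 v = w v := by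
  obtain ⟨R, hR⟩ := exists_row hw hk
  have hinj : ∀ a b, a < b → b < k → R 0 a < R 0 b := by
    intro a b hab hb
    refine lt_of_le_of_ne (R.row_weak hab (mem_rect.2 ⟨Nat.one_pos, hb⟩)) fun heq => ?_
    have h1 := hw1 (R 0 a)
    rw [← hR, colWt_row] at h1
    have h2 := Finset.card_le_one.1 h1 a (Finset.mem_filter.2 ⟨Finset.mem_range.2 (by omega), rfl⟩)
      b (Finset.mem_filter.2 ⟨Finset.mem_range.2 hb, heq.symm⟩)
    omega
  let T : SemistandardYoungTableau (rect k 1) :=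
    { entry := fun i c => if c = 0 ∧ i < k then R 0 i else 0
      row_weak' := fun {i a b} hab hmem => by
        have hb := (mem_rect.1 hmem).2
        dsimp only at hb
        omega
      col_strict' := fun {a b c} hab hmem => by
        have hb := mem_rect.1 hmem
        dsimp only at hb
        rw [if_pos ⟨by omega, by omega⟩, if_pos ⟨by omega, by omega⟩]
        exact hinj a b hab hb.1
      zeros' := fun {i c} hmem => if_neg fun h => hmem (mem_rect.2 ⟨h.2, by dsimp only; omega⟩) }
  refine ⟨T, fun v => ?_⟩
  rw [← hR, colWt_column, colWt_row]
  congr 1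
  refine Finset.filter_congr fun i hi => ?_
  show (if 0 = 0 ∧ i < k then R 0 i else 0) = v ↔ _
  rw [if_pos ⟨rfl, Finset.mem_range.1 hi⟩]

variable {ν : YoungDiagram}

theorem sum_colWt {T : SemistandardYoungTableau ν} {N : ℕ} (hT : T ∈ boundedTableaux N ν) :
    ∑ v ∈ Finset.range N, T.colWt 0 v = ν.cells.card := by
  rw [Finset.card_eq_sum_card_fiberwise (f := fun c => T c.1 c.2) (t := Finset.range N)]
  · refine Finset.sum_congr rfl fun v _ => ?_
    rw [colWt]
    simp only [Nat.zero_le, true_and]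
  · rintro ⟨i, j⟩ hc
    simpa using mem_boundedTableaux.1 hT i j hc

theorem Good.card_shape {μ : YoungDiagram} {T : SemistandardYoungTableau ν} (hT : T.Good μ) :
    (T.shape μ).cells.card = μ.cells.card + ν.cells.card := by
  have hb : T ∈ boundedTableaux (μ.colLen 0 + ν.cells.card) ν :=
    mem_boundedTableaux.2 fun i j h => hT.lt_of_mem h
  have hsum := sum_colWt hb
  have hμ := card_eq_sum_rowLen μ (N := μ.colLen 0 + ν.cells.card) (Nat.le_add_right _ _)
  rw [card_eq_sum_rowLen (T.shape μ) (N := μ.colLen 0 + ν.cells.card), hμ]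
  refine Eq.trans ?_ (congrArg _ hsum)
  rw [← Finset.sum_add_distrib]
  · exact Finset.sum_congr rfl fun i _ => hT.rowLen_shape i
  · rw [← rowLen_eq_zero_iff, hT.rowLen_shape, rowLen_eq_zero_iff.2 (Nat.le_add_right _ _),
      colWt_eq_zero_of_bounded hb 0 le_rfl]

end SemistandardYoungTableau

namespace YoungDiagram

open Classical in
/-- The partitions obtained from `μ` by adding a horizontal strip of size `k`. -/
noncomputable def horizontalStrips (μ : YoungDiagram) (k : ℕ) : Finset YoungDiagram :=
  (finite_card_le (μ.cells.card + k)).toFinset.filter fun κ =>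
    μ ≤ κ ∧ (∀ i, κ.rowLen (i + 1) ≤ μ.rowLen i) ∧ κ.cells.card = μ.cells.card + k

open Classical in
/-- The partitions obtained from `μ` by adding a vertical strip of size `k`. -/
noncomputable def verticalStrips (μ : YoungDiagram) (k : ℕ) : Finset YoungDiagram :=
  (finite_card_le (μ.cells.card + k)).toFinset.filter fun κ =>
    μ ≤ κ ∧ (∀ i, κ.rowLen i ≤ μ.rowLen i + 1) ∧ κ.cells.card = μ.cells.card + k

theorem mem_horizontalStrips {μ κ : YoungDiagram} {k : ℕ} : κ ∈ horizontalStrips μ k ↔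
    μ ≤ κ ∧ (∀ i, κ.rowLen (i + 1) ≤ μ.rowLen i) ∧ κ.cells.card = μ.cells.card + k := by
  classical
  rw [horizontalStrips, Finset.mem_filter, Set.Finite.mem_toFinset, and_iff_right_iff_imp]
  exact fun h => h.2.2.le

theorem mem_verticalStrips {μ κ : YoungDiagram} {k : ℕ} : κ ∈ verticalStrips μ k ↔
    μ ≤ κ ∧ (∀ i, κ.rowLen i ≤ μ.rowLen i + 1) ∧ κ.cells.card = μ.cells.card + k := by
  classical
  rw [verticalStrips, Finset.mem_filter, Set.Finite.mem_toFinset, and_iff_right_iff_imp]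
  exact fun h => h.2.2.le

theorem transpose_mem_horizontalStrips {μ κ : YoungDiagram} {k : ℕ} :
    κ.transpose ∈ horizontalStrips μ.transpose k ↔ κ ∈ verticalStrips μ k := by
  rw [mem_horizontalStrips, mem_verticalStrips, card_transpose, card_transpose,
    transpose_le_iff]
  refine and_congr_right fun _ => and_congr_left fun _ => ?_
  simp only [rowLen_transpose]
  constructor
  · intro h j
    by_contra! hlt
    have h1 := mem_iff_lt_colLen.1 (mem_iff_lt_rowLen.2 hlt)
    have h2 := mem_iff_lt_rowLen.1 (mem_iff_lt_colLen.2 (h1.trans_le (h (μ.rowLen j))))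
    omega
  · intro h i
    by_contra! hlt
    have h1 := mem_iff_lt_rowLen.1 (mem_iff_lt_colLen.2 hlt)
    have h2 := h (μ.colLen i)
    have h3 := mem_iff_lt_colLen.1 (mem_iff_lt_rowLen.2 (show i < μ.rowLen (μ.colLen i) by omega))
    omega

theorem card_rect (p q : ℕ) : (rect p q).cells.card = p * q := by
  simp [rect]

end YoungDiagram

namespace LambdaSch

theorem exists_weight_of_card_eq {μ κ : YoungDiagram} {k : ℕ} (hle : μ ≤ κ)
    (hcard : κ.cells.card = μ.cells.card + k) :
    ∃ N, (∀ v, N ≤ v → κ.rowLen v - μ.rowLen v = 0) ∧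
      ∑ v ∈ Finset.range N, (κ.rowLen v - μ.rowLen v) = k := by
  refine ⟨max (κ.colLen 0) (μ.colLen 0), fun v hv => ?_, ?_⟩
  · rw [rowLen_eq_zero_iff.2 ((le_max_left _ _).trans hv), Nat.zero_sub]
  · rw [card_eq_sum_rowLen κ (le_max_left _ (μ.colLen 0)),
      card_eq_sum_rowLen μ (le_max_right (κ.colLen 0) _)] at hcard
    have : ∑ v ∈ Finset.range (max (κ.colLen 0) (μ.colLen 0)), (κ.rowLen v - μ.rowLen v) +
        ∑ v ∈ Finset.range (max (κ.colLen 0) (μ.colLen 0)), μ.rowLen v =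
        ∑ v ∈ Finset.range (max (κ.colLen 0) (μ.colLen 0)), κ.rowLen v := by
      rw [← Finset.sum_add_distrib]
      exact Finset.sum_congr rfl fun v _ => Nat.sub_add_cancel (le_iff_rowLen.1 hle v)
    omega

theorem rowLen_eq_of_colWt_eq {μ κ ν : YoungDiagram} (hle : μ ≤ κ)
    {T : SemistandardYoungTableau ν} (hT : ∀ v, T.colWt 0 v = κ.rowLen v - μ.rowLen v) (v : ℕ) :
    μ.rowLen v + T.colWt 0 v = κ.rowLen v := by
  rw [hT]
  exact Nat.add_sub_cancel' (le_iff_rowLen.1 hle v)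

/-- A one-row tableau is determined by its content, hence by its shape over `μ`, and the
Littlewood-Richardson condition becomes the horizontal strip condition. -/
theorem basis_mul_row (μ : YoungDiagram) (k : ℕ) :
    basis μ * basis (rect 1 k) = ∑ κ ∈ horizontalStrips μ k, basis κ := by
  rw [basis_mul]
  refine Finset.sum_nbij (fun T => T.shape μ) (fun T hT => ?_) (fun T hT T' hT' heq => ?_)
    (fun κ hκ => ?_) fun T _ => rfl
  · rw [mem_littlewoodRichardson] at hT
    have hmono : ∀ a b, a ≤ b → b < k → T 0 a ≤ T 0 b :=
      fun a b hab hb => T.row_weak_of_le hab (mem_rect.2 ⟨Nat.one_pos, hb⟩)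
    refine mem_horizontalStrips.2 ⟨le_iff_rowLen.2 fun i => ?_, fun i => ?_, ?_⟩
    · rw [hT.rowLen_shape]
      exact Nat.le_add_right _ _
    · have hlt : ∀ c < k, (T 0 c < i + 1 ↔ c < ∑ u ∈ Finset.range (i + 1), T.colWt 0 u) := by
        intro c hc
        rw [lt_iff_lt_sum_card hmono hc]
        simp only [colWt_row]
      -- Column `j` is where the entries greater than `i` begin: from there on every `i + 1` is
      -- counted and no `i`, so the condition at `j` reads `κ_{i+1} ≤ μ_i`.
      set j := ∑ u ∈ Finset.range (i + 1), T.colWt 0 u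
      have h1 : T.colWt j i = 0 := by
        by_contra h
        obtain ⟨r, c, hmem, hc, heq⟩ := exists_of_colWt_ne_zero h
        have hr := mem_rect.1 hmem
        dsimp only at hr
        obtain rfl : r = 0 := by omega
        have := hlt c hr.2
        omega
      have h2 : T.colWt j (i + 1) = T.colWt 0 (i + 1) := by
        rw [colWt, colWt]
        congr 1
        refine Finset.filter_congr ?_
        rintro ⟨r, c⟩ hmem
        have hr := mem_rect.1 hmem
        dsimp only at hr ⊢
        obtain rfl : r = 0 := by omega
        have := hlt c hr.2
        omega
      have h3 := hT j (Nat.le_succ i)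
      dsimp only [Nat.succ_eq_add_one] at h3
      rw [hT.rowLen_shape]
      omega
    · rw [hT.card_shape, card_rect, one_mul]
  · rw [Finset.mem_coe, mem_littlewoodRichardson] at hT hT'
    refine row_ext fun v => ?_
    have h := congrArg (fun κ => κ.rowLen v) heq
    simp only [hT.rowLen_shape, hT'.rowLen_shape] at h
    omega
  · obtain ⟨hle, hstrip, hcard⟩ := mem_horizontalStrips.1 hκ
    obtain ⟨N, hw, hk⟩ := exists_weight_of_card_eq hle hcard
    obtain ⟨T, hT⟩ := exists_row hw hk
    have hrow := rowLen_eq_of_colWt_eq hle hT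
    have hgood : T.Good μ := by
      refine fun j => antitone_nat_of_succ_le fun v => ?_
      have h1 : T.colWt j (v + 1) ≤ T.colWt 0 (v + 1) := Finset.card_le_card fun c hc => by
        rw [Finset.mem_filter] at hc ⊢
        exact ⟨hc.1, Nat.zero_le _, hc.2.2⟩
      have h2 := hrow (v + 1)
      have h3 := hstrip v
      omega
    refine ⟨T, mem_littlewoodRichardson.2 hgood, ext_rowLen fun i => ?_⟩
    rw [hgood.rowLen_shape, hrow]

/-- For a single column the condition has content only at `j = 0`, where it says that the result is
a partition. Strictness of the column gives at most one new cell in each row. -/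
theorem basis_mul_column (μ : YoungDiagram) (k : ℕ) :
    basis μ * basis (rect k 1) = ∑ κ ∈ verticalStrips μ k, basis κ := by
  rw [basis_mul]
  refine Finset.sum_nbij (fun T => T.shape μ) (fun T hT => ?_) (fun T hT T' hT' heq => ?_)
    (fun κ hκ => ?_) fun T _ => rfl
  · rw [mem_littlewoodRichardson] at hT
    refine mem_verticalStrips.2 ⟨le_iff_rowLen.2 fun i => ?_, fun i => ?_, ?_⟩
    · rw [hT.rowLen_shape]
      exact Nat.le_add_right _ _
    · rw [hT.rowLen_shape, colWt_column]
      refine Nat.add_le_add_left (Finset.card_le_one.2 fun a ha b hb => ?_) _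
      rw [Finset.mem_filter, Finset.mem_range] at ha hb
      by_contra hne
      rcases lt_or_gt_of_ne hne with h | h
      · have := T.col_strict h (mem_rect.2 ⟨hb.1, Nat.one_pos⟩)
        omega
      · have := T.col_strict h (mem_rect.2 ⟨ha.1, Nat.one_pos⟩)
        omega
    · rw [hT.card_shape, card_rect, mul_one]
  · rw [Finset.mem_coe, mem_littlewoodRichardson] at hT hT'
    refine column_ext fun v => ?_
    have h := congrArg (fun κ => κ.rowLen v) heq
    simp only [hT.rowLen_shape, hT'.rowLen_shape] at h
    omega
  · obtain ⟨hle, hstrip, hcard⟩ := mem_verticalStrips.1 hκ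
    obtain ⟨N, hw, hk⟩ := exists_weight_of_card_eq hle hcard
    obtain ⟨T, hT⟩ := exists_column hw (fun v => by have := hstrip v; omega) hk
    have hrow := rowLen_eq_of_colWt_eq hle hT
    have hgood : T.Good μ := by
      intro j
      cases j with
      | zero =>
        intro a b hab
        simp only [hrow]
        exact κ.rowLen_anti a b hab
      | succ j =>
        intro a b hab
        have h0 : ∀ v, T.colWt (j + 1) v = 0 := colWt_eq_zero_of_le (by
          rw [rowLen_rect]
          split_ifs <;> omega)
        simp only [h0, add_zero]
        exact μ.rowLen_anti a b hab
    refine ⟨T, mem_littlewoodRichardson.2 hgood, ext_rowLen fun i => ?_⟩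
    rw [hgood.rowLen_shape, hrow]

/-! ### The involution `ω` -/

/-- The linear map with `s_μ ↦ s_μ'`. -/
noncomputable def transposeLinear : LambdaSch →ₗ[ℕ] LambdaSch :=
  basis.constr ℕ fun μ => basis μ.transpose

theorem transposeLinear_basis (μ : YoungDiagram) :
    transposeLinear (basis μ) = basis μ.transpose := basis.constr_basis ℕ _ μ

theorem transposeLinear_mul_column (x : LambdaSch) (k : ℕ) :
    transposeLinear (x * basis (rect k 1)) = transposeLinear x * basis (rect 1 k) := by
  have h : transposeLinear ∘ₗ (LinearMap.mulRight ℕ (basis (rect k 1))) =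
      (LinearMap.mulRight ℕ (basis (rect 1 k))) ∘ₗ transposeLinear := by
    refine basis.ext fun μ => ?_
    simp only [LinearMap.comp_apply, LinearMap.mulRight_apply, transposeLinear_basis]
    rw [basis_mul_column, basis_mul_row, map_sum]
    refine Finset.sum_nbij' transpose transpose (fun κ hκ => transpose_mem_horizontalStrips.2 hκ)
      (fun κ hκ => ?_) (fun κ _ => transpose_transpose κ) (fun κ _ => transpose_transpose κ)
      fun κ _ => transposeLinear_basis κ
    rwa [← transpose_mem_horizontalStrips, transpose_transpose]
  exact LinearMap.congr_fun h x

/-- Induction on the size and then on the size minus the number of rows. If `κ` is `μ` without its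
first column, of length `k`, then `s_κ s_{(1^k)}` is `s_μ` plus Schur functions of the same size
with more rows. The claim is known for these, for `κ` and for the column, so it follows for `μ` by
cancellation. -/
theorem transposeLinear_basis_mul (μ : YoungDiagram) :
    ∀ x, transposeLinear (x * basis μ) = transposeLinear x * basis μ.transpose := by
  generalize hd : μ.cells.card = d
  induction d using Nat.strong_induction_on generalizing μ with
  | _ d ihd =>
  generalize he : d - μ.colLen 0 = e
  induction e using Nat.strong_induction_on generalizing μ with
  | _ e ihe =>
  classical
  intro x
  by_cases hμ : μ = ⊥
  · have hbot : (⊥ : YoungDiagram).transpose = ⊥ := transpose_eq_bot_iff.2 rfl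
    rw [hμ, hbot, basis_bot, mul_one, mul_one]
  set k := μ.colLen 0 with hk
  have hkpos : 0 < k := by
    rw [eq_bot_iff_rowLen_zero, ← Ne, ← Nat.pos_iff_ne_zero] at hμ
    exact mem_iff_lt_colLen.1 (mem_iff_lt_rowLen.2 hμ)
  set κ := ofFun fun i => μ.rowLen i - 1 with hκ
  have hrow : ∀ i, κ.rowLen i = μ.rowLen i - 1 := by
    refine rowLen_ofFun (fun a b hab => ?_) (N := k) ?_
    · have := μ.rowLen_anti a b hab
      omega
    · rw [rowLen_eq_zero_iff.2 hk.symm.le]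
  have hpos : ∀ i < k, 0 < μ.rowLen i := fun i hi =>
    mem_iff_lt_rowLen.1 (mem_iff_lt_colLen.2 hi)
  have hkzero : ∀ i, k ≤ i → μ.rowLen i = 0 := fun i hi => rowLen_eq_zero_iff.2 hi
  have hκk : κ.colLen 0 ≤ k := by
    rw [← rowLen_eq_zero_iff, hrow, hkzero k le_rfl]
  have hcard : μ.cells.card = κ.cells.card + k := by
    rw [card_eq_sum_rowLen μ hk.symm.le, card_eq_sum_rowLen κ hκk]
    have h : ∑ i ∈ Finset.range k, μ.rowLen i = ∑ i ∈ Finset.range k, (κ.rowLen i + 1) :=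
      Finset.sum_congr rfl fun i hi => by
        rw [hrow]
        exact (Nat.sub_add_cancel (hpos i (Finset.mem_range.1 hi))).symm
    rw [h, Finset.sum_add_distrib, Finset.sum_const, Finset.card_range, smul_eq_mul, mul_one]
  have hmem : μ ∈ verticalStrips κ k := by
    refine mem_verticalStrips.2 ⟨le_iff_rowLen.2 fun i => ?_, fun i => ?_, hcard⟩
    · rw [hrow]
      omega
    · rw [hrow]
      omega
  have hother : ∀ ξ ∈ (verticalStrips κ k).erase μ,
      transposeLinear (x * basis ξ) = transposeLinear x * basis ξ.transpose := by
    intro ξ hξ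
    obtain ⟨hne, hξ⟩ := Finset.mem_erase.1 hξ
    obtain ⟨-, hstrip, hcard'⟩ := mem_verticalStrips.1 hξ
    -- With at most `k` rows, `ξ` would lie inside `μ` and have the same size.
    have hlen : k < ξ.colLen 0 := by
      by_contra! hle
      have hξμ : ξ ≤ μ := le_iff_rowLen.2 fun i => by
        by_cases hi : i < k
        · have h1 := hstrip i
          have h2 := hpos i hi
          rw [hrow] at h1
          omega
        · rw [rowLen_eq_zero_iff.2 (hle.trans (not_lt.1 hi))]
          exact Nat.zero_le _
      exact hne (YoungDiagram.ext (Finset.eq_of_subset_of_card_le hξμ (by omega)))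
    have hle : ξ.colLen 0 ≤ ξ.cells.card := by
      rw [colLen_eq_card]
      exact Finset.card_le_card (Finset.filter_subset _ _)
    exact ihe (d - ξ.colLen 0) (by omega) ξ (by omega) rfl x
  have hcol := transposeLinear_mul_column (x * basis κ) k
  rw [ihd κ.cells.card (by omega) κ rfl, mul_assoc, mul_assoc, basis_mul_column,
    ← Finset.add_sum_erase _ _ hmem, mul_add, map_add, Finset.mul_sum, map_sum,
    Finset.sum_congr rfl hother] at hcol
  have hκcol : basis κ.transpose * basis (rect 1 k) =
      ∑ ξ ∈ verticalStrips κ k, basis ξ.transpose := by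
    rw [← transposeLinear_basis, ← transposeLinear_mul_column, basis_mul_column, map_sum]
    exact Finset.sum_congr rfl fun ξ _ => transposeLinear_basis ξ
  rw [hκcol, ← Finset.add_sum_erase _ _ hmem, mul_add, Finset.mul_sum] at hcol
  -- The common summands are cancelled in the ambient ring of power series.
  exact Subtype.ext (by simpa using congrArg Subtype.val hcol)

/-- The involution `ω` of `Λ^Sch`. -/
noncomputable def transposeHom : LambdaSch →+* LambdaSch where
  toFun := transposeLinear
  map_zero' := map_zero _
  map_add' := map_add _
  map_one' := by
    rw [← basis_bot, transposeLinear_basis, transpose_eq_bot_iff.2 rfl]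
  map_mul' x y := by
    have h : (LinearMap.mul ℕ LambdaSch).compr₂ transposeLinear =
        (LinearMap.mul ℕ LambdaSch).compl₁₂ transposeLinear transposeLinear := by
      refine basis.ext fun μ => LinearMap.ext fun x => ?_
      show transposeLinear (basis μ * x) = transposeLinear (basis μ) * transposeLinear x
      rw [mul_comm, transposeLinear_basis_mul, transposeLinear_basis, mul_comm]
    exact LinearMap.congr_fun₂ h x y

theorem transposeHom_basis (μ : YoungDiagram) :
    transposeHom (basis μ) = basis μ.transpose := transposeLinear_basis μ

theorem repr_transposeHom (x : LambdaSch) (κ : YoungDiagram) :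
    basis.repr (transposeHom x) κ.transpose = basis.repr x κ := by
  classical
  have h : (Finsupp.lapply κ.transpose ∘ₗ basis.repr.toLinearMap) ∘ₗ transposeLinear =
      Finsupp.lapply κ ∘ₗ basis.repr.toLinearMap := by
    refine basis.ext fun μ => ?_
    simp only [LinearMap.comp_apply, transposeLinear_basis, LinearEquiv.coe_coe,
      Module.Basis.repr_self, Finsupp.lapply_apply, Finsupp.single_apply]
    refine if_congr ⟨fun h => ?_, fun h => by rw [h]⟩ rfl rfl
    rw [← transpose_transpose μ, h, transpose_transpose]
  exact LinearMap.congr_fun h x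

theorem repr_mul_transpose (μ ν κ : YoungDiagram) :
    basis.repr (basis μ.transpose * basis ν.transpose) κ.transpose =
      basis.repr (basis μ * basis ν) κ := by
  rw [← transposeHom_basis, ← transposeHom_basis, ← map_mul, repr_transposeHom]

end LambdaSch

open YoungDiagram SemistandardYoungTableau

/-! ### Components of products of Schur functions -/

namespace YoungDiagram

/-- The partition `(μ₁, μ₂, …)`. -/
noncomputable def tail (μ : YoungDiagram) : YoungDiagram := ofFun fun i => μ.rowLen (i + 1)

theorem rowLen_tail (μ : YoungDiagram) (i : ℕ) : μ.tail.rowLen i = μ.rowLen (i + 1) :=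
  rowLen_ofFun (fun a b h => μ.rowLen_anti _ _ (by omega)) (N := μ.colLen 0)
    (rowLen_eq_zero_iff.2 (Nat.le_succ _)) i

theorem mem_tail {μ : YoungDiagram} {i j : ℕ} : (i, j) ∈ μ.tail ↔ (i + 1, j) ∈ μ := by
  rw [mem_iff_lt_rowLen, rowLen_tail, mem_iff_lt_rowLen]

theorem colLen_tail (μ : YoungDiagram) (j : ℕ) : μ.tail.colLen j = μ.colLen j - 1 := by
  refine eq_of_forall_lt_iff fun i => ?_
  rw [← mem_iff_lt_colLen, mem_tail, mem_iff_lt_colLen]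
  omega

theorem colLen_zero_eq_zero_iff {μ : YoungDiagram} : μ.colLen 0 = 0 ↔ μ = ⊥ := by
  rw [colLen_eq_zero_iff, Nat.le_zero, eq_bot_iff_rowLen_zero]

end YoungDiagram

namespace SemistandardYoungTableau

variable {ν : YoungDiagram}

theorem colWt_le_succ_add_one (T : SemistandardYoungTableau ν) (j v : ℕ) :
    T.colWt j v ≤ T.colWt (j + 1) v + 1 := by
  by_cases h : ∃ i, (i, j) ∈ ν ∧ T i j = v
  · obtain ⟨i, hmem, rfl⟩ := h
    exact (colWt_of_mem hmem).le
  · push Not at h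
    rw [colWt_of_notMem h]
    exact Nat.le_succ _

theorem colWt_le (T : SemistandardYoungTableau ν) (j v : ℕ) :
    T.colWt j v ≤ ν.rowLen 0 - j := by
  generalize hn : ν.rowLen 0 - j = n
  induction n generalizing j with
  | zero => rw [colWt_eq_zero_of_le (by omega)]
  | succ n ih =>
    have h1 := T.colWt_le_succ_add_one j v
    have h2 := ih (j + 1) (by omega)
    omega

theorem colWt_eq_of_forall_mem {T : SemistandardYoungTableau ν} {j v : ℕ}
    (h : ∀ c, j ≤ c → c < ν.rowLen 0 → ∃ i, (i, c) ∈ ν ∧ T i c = v) :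
    T.colWt j v = ν.rowLen 0 - j := by
  generalize hn : ν.rowLen 0 - j = n
  induction n generalizing j with
  | zero => rw [colWt_eq_zero_of_le (by omega)]
  | succ n ih =>
    obtain ⟨i, hmem, heq⟩ := h j le_rfl (by omega)
    have h1 := colWt_of_mem (T := T) hmem
    have h2 := ih (j := j + 1) (fun c hc => h c (by omega)) (by omega)
    rw [heq, h2] at h1
    exact h1

/-- If a tableau of rectangular shape is good for a partition with at most `L` rows, then the
entries at least `L` of a column form an interval starting at `L`. -/
theorem Good.exists_entry_eq {μ : YoungDiagram} {T : SemistandardYoungTableau ν} (hT : T.Good μ)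
    {p q L : ℕ} (hν : ν = rect p q) (hμ : μ.rowLen L = 0) {i j e : ℕ} (hmem : (i, j) ∈ ν)
    (hL : L ≤ e) (he : e ≤ T i j) : ∃ i', (i', j) ∈ ν ∧ T i' j = e := by
  have hμ' : ∀ v, L ≤ v → μ.rowLen v = 0 := fun v hv =>
    Nat.eq_zero_of_le_zero (hμ ▸ μ.rowLen_anti _ _ hv)
  obtain ⟨n, hn⟩ : ∃ n, ν.rowLen 0 - j ≤ n := ⟨_, le_rfl⟩
  induction n generalizing i j e with
  | zero =>
    have h1 := mem_iff_lt_rowLen.1 hmem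
    have h2 := ν.rowLen_anti 0 i (Nat.zero_le _)
    omega
  | succ n ih =>
    -- If `e + 1` is in column `j` and `e` is not, then by induction `e + 1` is in all later columns
    -- too. Its count thus exceeds any possible count of `e`, while `μ` contributes nothing to rows
    -- `e` and `e + 1`.
    have step : ∀ e, L ≤ e → (∃ i', (i', j) ∈ ν ∧ T i' j = e + 1) →
        ∃ i', (i', j) ∈ ν ∧ T i' j = e := by
      rintro e hL ⟨i', hmem', heq⟩
      by_contra! hno
      have h1 := hT j (Nat.le_succ e)
      have h2 := colWt_of_mem (T := T) hmem'
      have h3 : T.colWt (j + 1) (e + 1) = ν.rowLen 0 - (j + 1) := by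
        refine colWt_eq_of_forall_mem fun c hc hc' => ?_
        have hmemc : (i', c) ∈ ν := by
          subst hν
          rw [mem_rect] at hmem' ⊢
          rw [rowLen_rect] at hc'
          split_ifs at hc' with h0
          · exact ⟨hmem'.1, hc'⟩
          · omega
        refine ih hmemc (by omega) ?_ (by omega)
        rw [← heq]
        exact T.row_weak_of_le (by omega) hmemc
      have h4 := T.colWt_le (j + 1) e
      simp only [Nat.succ_eq_add_one, hμ' e hL, hμ' (e + 1) (by omega), zero_add,
        colWt_of_notMem hno] at h1
      rw [heq] at h2
      omega
    obtain ⟨d, hd⟩ := Nat.exists_eq_add_of_le he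
    induction d generalizing e with
    | zero => exact ⟨i, hmem, hd⟩
    | succ d ihd => exact step e hL (ihd (by omega) (by omega) (by omega))

end SemistandardYoungTableau

namespace LambdaSch

theorem repr_mul_transpose_right (μ ν κ : YoungDiagram) :
    basis.repr (basis μ.transpose * basis ν.transpose) κ =
      basis.repr (basis μ * basis ν) κ.transpose := by
  rw [← repr_mul_transpose, transpose_transpose, transpose_transpose]

/-- The cells of `κ` outside `μ` are added in vertical strips, at most one cell per row each time,
by multiplying with columns. -/
theorem exists_mul_eq_add {μ κ : YoungDiagram} (h : μ ≤ κ) : ∃ x r, basis μ * x = basis κ + r := by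
  classical
  obtain ⟨n, hn⟩ : ∃ n, ∀ i, κ.rowLen i ≤ μ.rowLen i + n :=
    ⟨κ.rowLen 0, fun i => (κ.rowLen_anti _ _ (Nat.zero_le i)).trans (Nat.le_add_left _ _)⟩
  induction n generalizing μ with
  | zero =>
    exact ⟨1, 0, by rw [mul_one, add_zero, le_antisymm h (le_iff_rowLen.2 hn)]⟩
  | succ n ih =>
    have hle := le_iff_rowLen.1 h
    set ξ := ofFun fun i => min (κ.rowLen i) (μ.rowLen i + 1) with hξ
    have hrow : ∀ i, ξ.rowLen i = min (κ.rowLen i) (μ.rowLen i + 1) := by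
      refine rowLen_ofFun (fun a b hab => ?_) (N := κ.colLen 0) ?_
      · have h1 := μ.rowLen_anti a b hab
        have h2 := κ.rowLen_anti a b hab
        omega
      · rw [rowLen_eq_zero_iff.2 le_rfl, Nat.zero_min]
    have hμξ : μ ≤ ξ := le_iff_rowLen.2 fun i => by
      have := hle i
      rw [hrow]
      omega
    obtain ⟨x, r, hx⟩ := ih (μ := ξ) (le_iff_rowLen.2 fun i => by rw [hrow]; omega) fun i => by
      have := hn i
      rw [hrow]
      omega
    have hmem : ξ ∈ verticalStrips μ (ξ.cells.card - μ.cells.card) := by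
      refine mem_verticalStrips.2 ⟨hμξ, fun i => ?_, ?_⟩
      · rw [hrow]
        omega
      · have : μ.cells.card ≤ ξ.cells.card := Finset.card_le_card hμξ
        omega
    refine ⟨basis (rect (ξ.cells.card - μ.cells.card) 1) * x, r +
      (∑ κ ∈ (verticalStrips μ (ξ.cells.card - μ.cells.card)).erase ξ, basis κ) * x, ?_⟩
    rw [← mul_assoc, basis_mul_column, ← Finset.add_sum_erase _ _ hmem, add_mul, hx, add_assoc]

theorem exists_repr_mul_ne_zero (μ κ : YoungDiagram) (h : μ ≤ κ) :
    ∃ x, basis.repr (basis μ * x) κ ≠ 0 := by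
  obtain ⟨x, r, hx⟩ := exists_mul_eq_add h
  refine ⟨x, ?_⟩
  rw [hx, map_add, Finsupp.add_apply, Module.Basis.repr_self, Finsupp.single_eq_same]
  omega

/-- Row `a` of the first factor already has length `b`, so `T` has no entries from `a` to `L - 1`.
Its row `a` then has entries at least `L`, which forces an entry `L` in every column, so row `L` of
`κ` has length `b`. -/
theorem rect_le_of_repr_mul_ne_zero (a b L : ℕ) (κ : YoungDiagram) (haL : a < L)
    (h : basis.repr (basis (rect a (b + 1) ⊔ rect L b) * basis (rect (a + 1) b)) κ ≠ 0)
    (hκ : κ.rowLen a ≤ b) : rect (L + 1) b ≤ κ := by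
  obtain rfl | hb := Nat.eq_zero_or_pos b
  · rw [rect_zero_right]
    exact bot_le
  obtain ⟨T, hT, rfl⟩ := repr_mul_ne_zero_iff.1 h
  have hX : ∀ i, (rect a (b + 1) ⊔ rect L b).rowLen i =
      max (if i < a then b + 1 else 0) (if i < L then b else 0) := fun i => by
    rw [rowLen_sup, rowLen_rect, rowLen_rect]
  have hX0 : (rect a (b + 1) ⊔ rect L b).rowLen L = 0 := by
    rw [hX, if_neg (by omega), if_neg (by omega), max_self]
  have hXa : ∀ i, a ≤ i → i < L → (rect a (b + 1) ⊔ rect L b).rowLen i = b := fun i hi hiL => by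
    rw [hX, if_neg (by omega), if_pos hiL, Nat.zero_max]
  have hr : (rect (a + 1) b).rowLen 0 = b := by rw [rowLen_rect, if_pos (Nat.succ_pos a)]
  have hno : ∀ v, a ≤ v → v < L → T.colWt 0 v = 0 := fun v hv hvL => by
    have h1 := hT 0 hv
    dsimp only at h1
    rw [hT.rowLen_shape, hXa a le_rfl haL] at hκ
    rw [hXa v hv hvL, hXa a le_rfl haL] at h1
    omega
  have hcol : T.colWt 0 L = b := by
    rw [colWt_eq_of_forall_mem fun c _ hc => ?_, hr, Nat.sub_zero]
    have hmem : (a, c) ∈ rect (a + 1) b := mem_rect.2 ⟨Nat.lt_succ_self a, by omega⟩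
    refine hT.exists_entry_eq rfl hX0 hmem le_rfl ?_
    by_contra! hlt
    exact colWt_ne_zero hmem (Nat.zero_le c) (hno _ (T.le_entry hmem) hlt)
  obtain ⟨d, rfl⟩ := Nat.exists_eq_add_of_lt hb
  rw [rect_succ_le_iff, hT.rowLen_shape, hcol]
  omega

theorem support_hom {n : ℕ} (hn : 1 ≤ n) (f : LambdaSch →+* TruncNat n) :
    {μ | f (basis μ) ≠ 0} = Set.univ ∨ ∃ a b, {μ | f (basis μ) ≠ 0} = {μ | μ.rowLen a ≤ b} :=
  PartitionBasis.support_eq_univ_or_eq_hook basis basis_bot exists_repr_mul_ne_zero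
    le_of_repr_mul_ne_zero rect_le_of_repr_mul_ne_zero hn f

theorem exists_repr_add_ne_zero (μ ν : YoungDiagram) :
    ∃ κ, basis.repr (basis μ * basis ν) κ ≠ 0 ∧ ∀ i, κ.rowLen i = μ.rowLen i + ν.rowLen i := by
  have hrow : ∀ i j, (i, j) ∈ ν → highestWeight ν i j = i := fun i j h => by
    rw [highestWeight_apply, if_pos h]
  have hgood := good_of_eq_row μ hrow
  refine ⟨_, repr_mul_ne_zero_iff.2 ⟨_, hgood, rfl⟩, fun i => ?_⟩
  rw [hgood.rowLen_shape, colWt_of_eq_row hrow, Nat.sub_zero]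

theorem exists_repr_union_ne_zero (μ ν : YoungDiagram) :
    ∃ κ, basis.repr (basis μ * basis ν) κ ≠ 0 ∧ ∀ j, κ.colLen j = μ.colLen j + ν.colLen j := by
  obtain ⟨κ, hκ, hrow⟩ := exists_repr_add_ne_zero μ.transpose ν.transpose
  rw [repr_mul_transpose_right] at hκ
  refine ⟨_, hκ, fun j => ?_⟩
  simpa only [rowLen_transpose, colLen_transpose] using hrow j

/-- The two components are the sum of the rows and the sum of the columns; they have different
numbers of rows. -/
theorem exists_mul_eq (μ ν : YoungDiagram) (hμ : μ ≠ ⊥) (hν : ν ≠ ⊥) :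
    ∃ κ κ' r, κ ≠ ⊥ ∧ κ' ≠ ⊥ ∧ basis μ * basis ν = basis κ + basis κ' + r := by
  obtain ⟨κ, hκ, hrow⟩ := exists_repr_add_ne_zero μ ν
  obtain ⟨κ', hκ', hcol⟩ := exists_repr_union_ne_zero μ ν
  have hbot : ∀ {ξ}, basis.repr (basis μ * basis ν) ξ ≠ 0 → ξ ≠ ⊥ := by
    rintro ξ hξ rfl
    exact hμ (le_bot_iff.1 (le_of_repr_mul_ne_zero _ _ _ hξ))
  have hne : κ ≠ κ' := by
    rintro rfl
    have h1 := hcol 0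
    have h2 : κ.colLen 0 ≤ max (μ.colLen 0) (ν.colLen 0) := by
      rw [← rowLen_eq_zero_iff, hrow, rowLen_eq_zero_iff.2 (le_max_left _ _),
        rowLen_eq_zero_iff.2 (le_max_right _ _)]
    have h3 := mt colLen_zero_eq_zero_iff.1 hμ
    have h4 := mt colLen_zero_eq_zero_iff.1 hν
    omega
  obtain ⟨r, hr⟩ := PartitionBasis.eq_add_add_of_repr_ne_zero basis hne hκ hκ'
  exact ⟨κ, κ', r, hbot hκ, hbot hκ', hr⟩

end LambdaSch

/-! ### Explicit Littlewood-Richardson tableaux -/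

open YoungDiagram SemistandardYoungTableau

namespace SemistandardYoungTableau

variable {ν : YoungDiagram}

/-- The tableau obtained from `T` by adding `1` to all entries and a new first row of zeros. -/
noncomputable def prependRow (T : SemistandardYoungTableau ν.tail) :
    SemistandardYoungTableau ν where
  entry i j := if 0 < i ∧ j < ν.rowLen i then T (i - 1) j + 1 else 0
  row_weak' := fun {i j k} hjk hmem => by
    have h1 := mem_iff_lt_rowLen.1 hmem
    obtain rfl | hi := Nat.eq_zero_or_pos i
    · rw [if_neg (by omega), if_neg (by omega)]
    · rw [if_pos ⟨hi, by omega⟩, if_pos ⟨hi, h1⟩]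
      refine Nat.succ_le_succ (T.row_weak hjk (mem_tail.2 ?_))
      rwa [Nat.sub_add_cancel hi]
  col_strict' := fun {i k j} hik hmem => by
    have h1 := mem_iff_lt_rowLen.1 hmem
    rw [if_pos (c := 0 < k ∧ j < ν.rowLen k) ⟨by omega, h1⟩]
    split_ifs with h
    · refine Nat.succ_lt_succ (T.col_strict (by omega) (mem_tail.2 ?_))
      rwa [Nat.sub_add_cancel (by omega)]
    · exact Nat.succ_pos _
  zeros' := fun {i j} hmem => if_neg fun h => hmem (mem_iff_lt_rowLen.2 h.2)

theorem prependRow_zero (T : SemistandardYoungTableau ν.tail) (j : ℕ) :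
    prependRow T 0 j = 0 := by
  show (if 0 < 0 ∧ j < ν.rowLen 0 then T (0 - 1) j + 1 else 0) = 0
  exact if_neg fun h => lt_irrefl 0 h.1

theorem prependRow_succ (T : SemistandardYoungTableau ν.tail) {i j : ℕ} (h : (i + 1, j) ∈ ν) :
    prependRow T (i + 1) j = T i j + 1 := if_pos ⟨Nat.succ_pos i, mem_iff_lt_rowLen.1 h⟩

theorem colWt_prependRow_zero (T : SemistandardYoungTableau ν.tail) (j : ℕ) :
    (prependRow T).colWt j 0 = ν.rowLen 0 - j :=
  colWt_eq_of_forall_mem fun c _ hc => ⟨0, mem_iff_lt_rowLen.2 hc, prependRow_zero T c⟩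

theorem colWt_prependRow_succ (T : SemistandardYoungTableau ν.tail) (j v : ℕ) :
    (prependRow T).colWt j (v + 1) = T.colWt j v := by
  refine (Finset.card_bij (fun c _ => (c.1 + 1, c.2)) ?_ ?_ ?_).symm
  · rintro ⟨i, c⟩ hc
    simp only [Finset.mem_filter, mem_cells, mem_tail] at hc ⊢
    exact ⟨hc.1, hc.2.1, by rw [prependRow_succ T hc.1, hc.2.2]⟩
  · rintro ⟨i, c⟩ _ ⟨i', c'⟩ _ h
    simpa using h
  · rintro ⟨i, c⟩ hc
    simp only [Finset.mem_filter, mem_cells] at hc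
    cases i with
    | zero =>
      rw [prependRow_zero] at hc
      omega
    | succ i =>
      rw [prependRow_succ T hc.1] at hc
      refine ⟨(i, c), ?_, rfl⟩
      simp only [Finset.mem_filter, mem_cells, mem_tail]
      exact ⟨hc.1, hc.2.1, by omega⟩

theorem Good.prependRow {μ : YoungDiagram} {T : SemistandardYoungTableau ν.tail}
    (hT : T.Good μ.tail) : (prependRow T).Good μ := by
  refine fun j => antitone_nat_of_succ_le fun v => ?_
  cases v with
  | zero =>
    rw [colWt_prependRow_succ, colWt_prependRow_zero]
    have h1 := T.colWt_le j 0
    rw [rowLen_tail] at h1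
    have h2 := ν.rowLen_anti 0 (0 + 1) (by omega)
    have h3 := μ.rowLen_anti 0 (0 + 1) (by omega)
    omega
  | succ v =>
    rw [colWt_prependRow_succ, colWt_prependRow_succ]
    have h := hT j (Nat.le_succ v)
    simp only [rowLen_tail] at h
    exact h

theorem colWt_add_ite {T T' : SemistandardYoungTableau ν} {p : ℕ × ℕ} (hp : p ∈ ν)
    (h : ∀ c, c ∈ ν → c ≠ p → T c.1 c.2 = T' c.1 c.2) (j v : ℕ) :
    T.colWt j v + (if j ≤ p.2 ∧ T' p.1 p.2 = v then 1 else 0) =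
      T'.colWt j v + (if j ≤ p.2 ∧ T p.1 p.2 = v then 1 else 0) := by
  classical
  have hp' : p ∈ ν.cells := hp
  rw [colWt, colWt, Finset.card_filter, Finset.card_filter, ← Finset.add_sum_erase _ _ hp',
    ← Finset.add_sum_erase _ _ hp']
  have hsum : ∑ c ∈ ν.cells.erase p, (if j ≤ c.2 ∧ T c.1 c.2 = v then 1 else 0) =
      ∑ c ∈ ν.cells.erase p, (if j ≤ c.2 ∧ T' c.1 c.2 = v then 1 else 0) :=
    Finset.sum_congr rfl fun c hc => by
      rw [Finset.mem_erase] at hc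
      rw [h c hc.2 hc.1]
  rw [hsum]
  ring

/-- The tableau whose entry in row `i` is `i`, except for the last entry of row `r`, which is
`r + 1`. -/
def raiseCorner (μ : YoungDiagram) {r : ℕ} (hr : μ.rowLen (r + 1) < μ.rowLen r) :
    SemistandardYoungTableau μ where
  entry i j := if j < μ.rowLen i then if i = r ∧ j + 1 = μ.rowLen r then r + 1 else i else 0
  row_weak' := fun {i j k} hjk hmem => by
    have h1 := mem_iff_lt_rowLen.1 hmem
    have h2 : i = r → μ.rowLen i = μ.rowLen r := congrArg _
    rw [if_pos h1, if_pos (hjk.trans h1)]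
    split_ifs <;> omega
  col_strict' := fun {i k j} hik hmem => by
    have h1 := mem_iff_lt_rowLen.1 hmem
    have h2 := μ.rowLen_anti i k hik.le
    have h3 : i = r → μ.rowLen k ≤ μ.rowLen (r + 1) := fun h => μ.rowLen_anti _ _ (by omega)
    rw [if_pos h1, if_pos (h1.trans_le h2)]
    split_ifs <;> omega
  zeros' := fun {i j} hmem => if_neg fun h => hmem (mem_iff_lt_rowLen.2 h)

theorem colWt_raiseCorner (μ : YoungDiagram) {r : ℕ} (hr : μ.rowLen (r + 1) < μ.rowLen r)
    (j v : ℕ) : (raiseCorner μ hr).colWt j v + (if j < μ.rowLen r ∧ v = r then 1 else 0) =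
      μ.rowLen v - j + (if j < μ.rowLen r ∧ v = r + 1 then 1 else 0) := by
  have hp : (r, μ.rowLen r - 1) ∈ μ := mem_iff_lt_rowLen.2 (by omega)
  have hhw : ∀ i j, (i, j) ∈ μ → highestWeight μ i j = i := fun i j h => by
    rw [highestWeight_apply, if_pos h]
  have hval : raiseCorner μ hr r (μ.rowLen r - 1) = r + 1 := by
    show (if _ then _ else _) = _
    rw [if_pos (by omega), if_pos ⟨rfl, by omega⟩]
  have h := colWt_add_ite (T := raiseCorner μ hr) (T' := highestWeight μ) hp (fun c hc hne => by
    rw [hhw _ _ hc]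
    show (if _ then _ else _) = _
    rw [if_pos (mem_iff_lt_rowLen.1 hc), if_neg]
    rintro ⟨h1, h2⟩
    exact hne (Prod.ext h1 (by dsimp only; omega))) j v
  rw [colWt_of_eq_row hhw, hval, hhw _ _ hp] at h
  convert h using 3 <;> refine and_congr ?_ eq_comm <;> dsimp only <;> omega

/-- The component is `μ + μ` with one cell moved from row `r` to row `r + 1`. While that cell is
counted, the drop between these rows is at least `1` in `μ` and at least `1` in the counted columns
of the second copy, which allows the move. -/
theorem good_raiseCorner (μ : YoungDiagram) {r : ℕ} (hr : μ.rowLen (r + 1) < μ.rowLen r) :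
    (raiseCorner μ hr).Good μ := by
  refine fun j => antitone_nat_of_succ_le fun v => ?_
  have h1 := colWt_raiseCorner μ hr j v
  have h2 := colWt_raiseCorner μ hr j (v + 1)
  have h3 := μ.rowLen_anti v (v + 1) (Nat.le_succ v)
  obtain rfl | hv := eq_or_ne v r
  · rw [if_neg (by omega : ¬ (j < μ.rowLen v ∧ v + 1 = v))] at h2
    split_ifs at h1 h2 <;> omega
  · rw [if_neg (by omega : ¬ (j < μ.rowLen r ∧ v + 1 = r + 1))] at h2
    rw [if_neg (by omega : ¬ (j < μ.rowLen r ∧ v = r))] at h1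
    omega

end SemistandardYoungTableau

namespace LambdaSch

theorem exists_repr_prepend_ne_zero {μ ν κ : YoungDiagram}
    (h : basis.repr (basis μ.tail * basis ν.tail) κ ≠ 0) :
    ∃ κ', basis.repr (basis μ * basis ν) κ' ≠ 0 ∧ κ'.rowLen 0 = μ.rowLen 0 + ν.rowLen 0 ∧
      κ'.tail = κ := by
  obtain ⟨T, hT, rfl⟩ := repr_mul_ne_zero_iff.1 h
  refine ⟨_, repr_mul_ne_zero_iff.2 ⟨_, hT.prependRow, rfl⟩, ?_, ext_rowLen fun i => ?_⟩
  · rw [hT.prependRow.rowLen_shape, colWt_prependRow_zero, Nat.sub_zero]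
  · rw [rowLen_tail, hT.prependRow.rowLen_shape, colWt_prependRow_succ, hT.rowLen_shape,
      rowLen_tail]

theorem rowLen_zero_le_of_repr_mul_ne_zero {μ ν κ : YoungDiagram}
    (h : basis.repr (basis μ * basis ν) κ ≠ 0) : κ.rowLen 0 ≤ μ.rowLen 0 + ν.rowLen 0 := by
  obtain ⟨T, hT, rfl⟩ := repr_mul_ne_zero_iff.1 h
  rw [hT.rowLen_shape]
  exact Nat.add_le_add_left (T.colWt_le 0 0) _

theorem colLen_zero_le_of_repr_mul_ne_zero {μ ν κ : YoungDiagram}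
    (h : basis.repr (basis μ * basis ν) κ ≠ 0) : κ.colLen 0 ≤ μ.colLen 0 + ν.colLen 0 := by
  rw [← repr_mul_transpose] at h
  simpa only [rowLen_transpose] using rowLen_zero_le_of_repr_mul_ne_zero h

/-- The first `a` rows are added to each other, and below them the columns of the remaining diagrams
are added. For `a > 0` the first rows merge into one, so the number of rows is smaller than the sum.
-/
theorem exists_repr_hook_ne_zero {a b : ℕ} {μ ν : YoungDiagram} (hμ : μ.rowLen a ≤ b)
    (hν : ν.rowLen a ≤ b) : ∃ κ, basis.repr (basis μ * basis ν) κ ≠ 0 ∧ κ.rowLen a ≤ b ∧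
      (0 < a → μ ≠ ⊥ → ν ≠ ⊥ → κ.rowLen 0 = μ.rowLen 0 + ν.rowLen 0 ∧
        κ.colLen 0 < μ.colLen 0 + ν.colLen 0) := by
  induction a generalizing μ ν with
  | zero =>
    obtain ⟨κ, hκ, hcol⟩ := exists_repr_union_ne_zero μ ν
    refine ⟨κ, hκ, ?_, fun h => absurd h (lt_irrefl 0)⟩
    rw [← colLen_eq_zero_iff, hcol, colLen_eq_zero_iff.2 hμ, colLen_eq_zero_iff.2 hν]
  | succ a ih =>
    obtain ⟨κ, hκ, hrow, -⟩ := ih (μ := μ.tail) (ν := ν.tail) (by rwa [rowLen_tail])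
      (by rwa [rowLen_tail])
    have hlen := colLen_zero_le_of_repr_mul_ne_zero hκ
    obtain ⟨κ', hκ', hzero, rfl⟩ := exists_repr_prepend_ne_zero hκ
    rw [rowLen_tail] at hrow
    refine ⟨κ', hκ', hrow, fun _ h1 h2 => ⟨hzero, ?_⟩⟩
    rw [colLen_tail, colLen_tail, colLen_tail] at hlen
    have h3 := mt colLen_zero_eq_zero_iff.1 h1
    have h4 := mt colLen_zero_eq_zero_iff.1 h2
    omega

/-! ### Schur Witt vectors of length two -/

theorem apply_eq_two_of_repr {f : LambdaSch →+* TruncNat 2} {μ κ κ' : YoungDiagram}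
    (hne : κ ≠ κ') (hκ : basis.repr (basis μ * basis μ) κ ≠ 0) (hf : f (basis κ) ≠ 0)
    (hκ' : basis.repr (basis μ * basis μ) κ' ≠ 0) (hf' : f (basis κ') ≠ 0) : f (basis μ) = 2 :=
  PartitionBasis.apply_eq_two basis f
    (PartitionBasis.eq_add_add_of_repr_ne_zero basis hne hκ hκ') hf hf'

theorem apply_eq_two_of_support_univ {f : LambdaSch →+* TruncNat 2}
    (hf : {μ | f (basis μ) ≠ 0} = Set.univ) {μ : YoungDiagram} (hμ : μ ≠ ⊥) :
    f (basis μ) = 2 := by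
  obtain ⟨κ, κ', r, -, -, h⟩ := exists_mul_eq μ μ hμ hμ
  have hf' : ∀ κ, f (basis κ) ≠ 0 := fun κ => Set.eq_univ_iff_forall.1 hf κ
  exact PartitionBasis.apply_eq_two basis f ⟨r, h⟩ (hf' κ) (hf' κ')

/-- The previous component and its transposed version, which adds the first `b` columns, both lie in
the hook. The second one has twice as many rows as `μ`, the first one fewer. -/
theorem apply_eq_two_of_support_hook {f : LambdaSch →+* TruncNat 2} {a b : ℕ} (ha : 0 < a)
    (hb : 0 < b) (hf : {μ | f (basis μ) ≠ 0} = {μ | μ.rowLen a ≤ b}) {μ : YoungDiagram}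
    (hμ : μ ≠ ⊥) (hmem : f (basis μ) ≠ 0) : f (basis μ) = 2 := by
  have hS : ∀ μ, f (basis μ) ≠ 0 ↔ μ.rowLen a ≤ b := fun μ => Set.ext_iff.1 hf μ
  have hflip : ∀ μ : YoungDiagram, μ.transpose.rowLen b ≤ a ↔ μ.rowLen a ≤ b := fun μ => by
    rw [rowLen_transpose, ← not_lt, ← not_lt, ← mem_iff_lt_colLen, mem_iff_lt_rowLen]
  have hμt := (hflip μ).2 ((hS μ).1 hmem)
  have hμ' := mt transpose_eq_bot_iff.1 hμ
  obtain ⟨κ, hκ, hrow, h1⟩ := exists_repr_hook_ne_zero ((hS μ).1 hmem) ((hS μ).1 hmem)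
  obtain ⟨κ', hκ', hrow', h2⟩ := exists_repr_hook_ne_zero hμt hμt
  rw [repr_mul_transpose_right] at hκ'
  rw [← transpose_transpose κ', hflip] at hrow'
  refine apply_eq_two_of_repr (fun heq => ?_) hκ ((hS _).2 hrow) hκ' ((hS _).2 hrow')
  have h3 := (h1 ha hμ hμ).2
  have h4 := (h2 hb hμ' hμ').1
  rw [heq, colLen_transpose] at h3
  rw [rowLen_transpose] at h4
  omega

/-- Moving a cell of `μ + μ` from row `r` to row `r + 1 < a` stays within `a` rows and gives a
second component in the support. -/
theorem apply_eq_two_of_rowLen_lt {f : LambdaSch →+* TruncNat 2} {a r : ℕ}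
    (hf : {μ | f (basis μ) ≠ 0} = {μ | μ.rowLen a ≤ 0}) {μ : YoungDiagram} (hra : r + 1 < a)
    (hr : μ.rowLen (r + 1) < μ.rowLen r) (hmem : f (basis μ) ≠ 0) : f (basis μ) = 2 := by
  have hS : ∀ μ, f (basis μ) ≠ 0 ↔ μ.rowLen a ≤ 0 := fun μ => Set.ext_iff.1 hf μ
  have hμ := (hS μ).1 hmem
  obtain ⟨κ, hκ, hrow⟩ := exists_repr_add_ne_zero μ μ
  have hgood := good_raiseCorner μ hr
  have hκ' := repr_mul_ne_zero_iff.2 ⟨_, hgood, rfl⟩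
  refine apply_eq_two_of_repr (fun heq => ?_) hκ ((hS _).2 ?_) hκ' ((hS _).2 ?_)
  · have h1 := hrow r
    have h2 := colWt_raiseCorner μ hr 0 r
    rw [heq, hgood.rowLen_shape] at h1
    rw [if_pos ⟨by omega, rfl⟩, if_neg (by omega)] at h2
    omega
  · rw [hrow]
    omega
  · have h2 := colWt_raiseCorner μ hr 0 a
    rw [if_neg (by omega), if_neg (by omega)] at h2
    rw [hgood.rowLen_shape]
    omega

/-- A vertical strip of `a` cells within the first `a` rows has one cell in each of them, so only
one Pieri summand survives. -/
theorem apply_rect_succ {f : LambdaSch →+* TruncNat 2} {a : ℕ}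
    (hf : {μ | f (basis μ) ≠ 0} = {μ | μ.rowLen a ≤ 0}) (k : ℕ) :
    f (basis (rect a (k + 1))) = f (basis (rect a k)) * f (basis (rect a 1)) := by
  have hS : ∀ μ, f (basis μ) ≠ 0 ↔ μ.rowLen a ≤ 0 := fun μ => Set.ext_iff.1 hf μ
  have hle : rect a k ≤ rect a (k + 1) := le_iff_rowLen.2 fun i => by
    rw [rowLen_rect, rowLen_rect]
    split_ifs <;> omega
  rw [← map_mul, basis_mul_column, map_sum, Finset.sum_eq_single (rect a (k + 1))]
  · intro κ hκ hne
    by_contra h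
    rw [← Ne, hS, Nat.le_zero] at h
    obtain ⟨-, hstrip, hcard⟩ := mem_verticalStrips.1 hκ
    have hκ' : κ ≤ rect a (k + 1) := le_iff_rowLen.2 fun i => by
      have h1 := hstrip i
      rw [rowLen_rect] at h1 ⊢
      split_ifs at h1 ⊢ with hi
      · exact h1
      · rw [← h]
        exact κ.rowLen_anti _ _ (not_lt.1 hi)
    refine hne (YoungDiagram.ext (Finset.eq_of_subset_of_card_le hκ' ?_))
    rw [hcard, card_rect, card_rect, Nat.mul_succ]
  · intro h
    refine absurd (mem_verticalStrips.2 ⟨hle, fun i => ?_, ?_⟩) h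
    · rw [rowLen_rect, rowLen_rect]
      split_ifs <;> omega
    · rw [card_rect, card_rect, Nat.mul_succ]

/-- A partition with at most `a` rows either drops between two of the first `a` rows, which forces
the value `2`, or is a rectangle with `a` rows, whose value is a power of that of the column. -/
theorem hom_ext_of_support_rows {f g : LambdaSch →+* TruncNat 2} {a : ℕ}
    (hf : {μ | f (basis μ) ≠ 0} = {μ | μ.rowLen a ≤ 0})
    (hg : {μ | g (basis μ) ≠ 0} = {μ | μ.rowLen a ≤ 0})
    (h : f (basis (rect a 1)) = g (basis (rect a 1))) : f = g := by
  refine PartitionBasis.hom_ext basis fun μ => ?_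
  by_cases hμ : μ.rowLen a ≤ 0
  · have hfμ : f (basis μ) ≠ 0 := (Set.ext_iff.1 hf μ).2 hμ
    have hgμ : g (basis μ) ≠ 0 := (Set.ext_iff.1 hg μ).2 hμ
    by_cases hr : ∃ r, r + 1 < a ∧ μ.rowLen (r + 1) < μ.rowLen r
    · obtain ⟨r, hra, hr⟩ := hr
      rw [apply_eq_two_of_rowLen_lt hf hra hr hfμ, apply_eq_two_of_rowLen_lt hg hra hr hgμ]
    · push Not at hr
      have hconst : ∀ i < a, μ.rowLen i = μ.rowLen 0 := by
        intro i
        induction i with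
        | zero => exact fun _ => rfl
        | succ i ih =>
          intro hi
          have h1 := hr i hi
          have h2 := μ.rowLen_anti i (i + 1) (Nat.le_succ i)
          have h3 := ih (by omega)
          omega
      have hrect : μ = rect a (μ.rowLen 0) := ext_rowLen fun i => by
        rw [rowLen_rect]
        split_ifs with hi
        · exact hconst i hi
        · have := μ.rowLen_anti a i (not_lt.1 hi)
          omega
      rw [hrect]
      generalize μ.rowLen 0 = k
      induction k with
      | zero => rw [rect_zero_right, basis_bot, map_one, map_one]
      | succ k ih => rw [apply_rect_succ hf, apply_rect_succ hg, ih, h]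
  · rw [not_not.1 (mt (Set.ext_iff.1 hf μ).1 hμ), not_not.1 (mt (Set.ext_iff.1 hg μ).1 hμ)]

theorem support_comp_transposeHom {f : LambdaSch →+* TruncNat 2} {b : ℕ}
    (hf : {μ | f (basis μ) ≠ 0} = {μ | μ.rowLen 0 ≤ b}) :
    {μ | f.comp transposeHom (basis μ) ≠ 0} = {μ | μ.rowLen b ≤ 0} := by
  ext μ
  rw [Set.mem_ofPred_eq, Set.mem_ofPred_eq, RingHom.comp_apply, transposeHom_basis]
  refine (Set.ext_iff.1 hf μ.transpose).trans ?_
  rw [Set.mem_ofPred_eq, rowLen_transpose, Nat.le_zero, rowLen_eq_zero_iff]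

/-- The case `b = 0` is the previous one, `a = 0` is reduced to it by `ω`, and for `a, b > 0` the
support alone decides. -/
theorem hom_two_ext {f g : LambdaSch →+* TruncNat 2} {a b : ℕ}
    (hf : {μ | f (basis μ) ≠ 0} = {μ | μ.rowLen a ≤ b})
    (hg : {μ | g (basis μ) ≠ 0} = {μ | μ.rowLen a ≤ b})
    (h1 : f (basis (rect a 1)) = g (basis (rect a 1)))
    (h2 : f (basis (rect 1 b)) = g (basis (rect 1 b))) : f = g := by
  obtain rfl | hb := Nat.eq_zero_or_pos b
  · exact hom_ext_of_support_rows hf hg h1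
  obtain rfl | ha := Nat.eq_zero_or_pos a
  · have h : f.comp transposeHom = g.comp transposeHom :=
      hom_ext_of_support_rows (support_comp_transposeHom hf) (support_comp_transposeHom hg) (by
        rwa [RingHom.comp_apply, RingHom.comp_apply, transposeHom_basis, transpose_rect])
    refine PartitionBasis.hom_ext basis fun μ => ?_
    have := DFunLike.congr_fun h (basis μ.transpose)
    rwa [RingHom.comp_apply, RingHom.comp_apply, transposeHom_basis, transpose_transpose] at this
  refine PartitionBasis.hom_ext basis fun μ => ?_
  by_cases hμ : μ = ⊥
  · rw [hμ, basis_bot, map_one, map_one]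
  by_cases h : f (basis μ) = 0
  · have h' : g (basis μ) = 0 := by
      by_contra hne
      exact (Set.ext_iff.1 (hf.trans hg.symm) μ).2 hne h
    rw [h, h']
  · have h' : g (basis μ) ≠ 0 := (Set.ext_iff.1 (hf.trans hg.symm) μ).1 h
    rw [apply_eq_two_of_support_hook ha hb hf hμ h, apply_eq_two_of_support_hook ha hb hg hμ h']

theorem countable_hom_two : Countable (LambdaSch →+* TruncNat 2) := by
  refine PartitionBasis.countable_hom basis (support_hom one_le_two) fun S => ?_
  obtain hS | ⟨f₀, hf₀⟩ :=
    {f : LambdaSch →+* TruncNat 2 | {μ | f (basis μ) ≠ 0} = S}.eq_empty_or_nonempty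
  · rw [hS]
    exact Set.countable_empty
  obtain hu | ⟨a, b, hu⟩ := support_hom one_le_two f₀
  · refine Set.Subsingleton.countable fun f hf g hg => PartitionBasis.hom_ext basis fun μ => ?_
    by_cases hμ : μ = ⊥
    · rw [hμ, basis_bot, map_one, map_one]
    · rw [apply_eq_two_of_support_univ (hf.trans (hf₀.symm.trans hu)) hμ,
        apply_eq_two_of_support_univ (hg.trans (hf₀.symm.trans hu)) hμ]
  -- Two values in the finite semiring `A_2` determine a homomorphism with this support.
  · refine Set.Finite.countable (Set.Finite.of_injOn
      (f := fun f => (f (basis (rect a 1)), f (basis (rect 1 b)))) (Set.mapsTo_univ _ _)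
      (fun f hf g hg h => ?_) Set.finite_univ)
    exact hom_two_ext (hf.trans (hf₀.symm.trans hu)) (hg.trans (hf₀.symm.trans hu))
      (Prod.ext_iff.1 h).1 (Prod.ext_iff.1 h).2

theorem countable_schurWitt_iff (n : ℕ) : Countable (SchurWitt (TruncNat n)) ↔ n ≤ 2 :=
  PartitionBasis.countable_iff_le_two (W := fun n => SchurWitt (TruncNat n))
    (fun _ hn => (PartitionBasis.exists_injective_family basis basis_bot exists_mul_eq hn).imp
      fun _ h => h.1)
    PartitionBasis.countable_hom_zero
    (PartitionBasis.countable_hom_one basis (support_hom le_rfl)) countable_hom_two n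

end LambdaSch

/-! ### The theorem -/

theorem mainTheorem4 :
    (∀ n : ℕ, Countable (BigWitt (TruncNat n)) ↔ n ≤ 2) ∧
    (∀ n : ℕ, Countable (SchurWitt (TruncNat n)) ↔ n ≤ 2) ∧
    (∀ n : ℕ, 3 ≤ n →
      ∃ F : Set {μ : YoungDiagram // μ ≠ ⊥} → BigWitt (TruncNat n), Function.Injective F ∧
        ∀ U, F U (LambdaN.m ⊥) = 1 ∧
          (∀ μ ∈ U, F U (LambdaN.m μ.1) = ((n - 1 : ℕ) : TruncNat n)) ∧
          (∀ μ ∉ U, F U (LambdaN.m μ.1) = (n : TruncNat n))) ∧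
    (∀ n : ℕ, 3 ≤ n →
      ∃ F : Set {μ : YoungDiagram // μ ≠ ⊥} → SchurWitt (TruncNat n), Function.Injective F ∧
        ∀ U, F U (LambdaSch.s ⊥) = 1 ∧
          (∀ μ ∈ U, F U (LambdaSch.s μ.1) = ((n - 1 : ℕ) : TruncNat n)) ∧
          (∀ μ ∉ U, F U (LambdaSch.s μ.1) = (n : TruncNat n))) ∧
    (∀ z : BigWitt (TruncNat 1),
      {a : BigWitt (TruncNat 2) | BigWitt.map (truncMap one_le_two) a = z}.Finite) := by
  refine ⟨LambdaN.countable_bigWitt_iff, LambdaSch.countable_schurWitt_iff, fun n hn => ?_,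
    fun n hn => ?_, LambdaN.finite_fibre⟩
  · simpa only [LambdaN.basis_apply] using
      PartitionBasis.exists_injective_family LambdaN.basis LambdaN.basis_bot
        LambdaN.exists_mul_eq hn
  · simpa only [LambdaSch.basis_apply] using
      PartitionBasis.exists_injective_family LambdaSch.basis LambdaSch.basis_bot
        LambdaSch.exists_mul_eq hn
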